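/- Let $d\ge 1$ be an integer, $T>0$, $\alpha>0$ and $s>\frac d2-\alpha$. Let $\rho:\mathbb R^d\to\mathbb R$ be $\mathcal C^\infty$ with compact support, let $2\le p<\infty$, and let $(\Omega,\mathcal F,\mathbb P)$ be a probability space. For $n\in\mathbb N$ put $B_n=\{\xi\in\mathbb R^d:|\xi|\le n\}$. For $\sigma\in\mathbb R$ let $\mathcal W^{\sigma,p}(\mathbb R^d)$ be the space of the tempered distributions $f$ for which $\|f\|_{\mathcal W^{\sigma,p}}=\|(1-\Delta)^{\sigma/2}f\|_{L^p}$ is finite. Let $\dot W$ be a real space-time white noise on $[0,T]\times\mathbb R^d$, that is, a random linear functional such that $\langle\dot W,f\rangle$ is a centered Gaussian variable of variance $\|f\|^2_{L^2([0,T]\times\mathbb R^d)}$ for every real $f\in L^2([0,T]\times\mathbb R^d)$. The truncated stochastic convolutions of $i\partial_t\Psi-\Delta\Psi=\langle\nabla\rangle^{-\alpha}\dot W$, $\Psi(0,\cdot)=0$, are $$\Psi_n(t,x)=-i\int_0^t\!\int_{\mathbb R^d}a_n(t-t',x-x')\,W(dt',dx'),\qquad a_n(t,x)=\frac1{(2\pi)^d}\int_{B_n}\frac{e^{it|\xi|^2}}{(1+|\xi|^2)^{\alpha/2}}e^{i\langle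 x,\xi\rangle}\,d\xi .$$ **(Law.)** $(\Psi_n(t,x))_{n\in\mathbb N,\,t\in[0,T],\,x\in\mathbb R^d}$ is a centered complex Gaussian process such that, for all $n,m\in\mathbb N$, $r,t\in[0,T]$ and $x,y\in\mathbb R^d$, $$\mathbb E\big[\Psi_n(r,x)\overline{\Psi_m(t,y)}\big]=\frac{\min(r,t)}{(2\pi)^d}\int_{B_n\cap B_m}\frac{e^{i(r-t)|\xi|^2}}{(1+|\xi|^2)^{\alpha}}e^{-i\langle\xi,x-y\rangle}\,d\xi ,$$ $$\mathbb E\big[\Psi_n(r,x)\Psi_m(t,y)\big]=-\frac{1}{(2\pi)^d}\int_0^{\min(r,t)}\!\!\int_{B_n\cap B_m}\frac{e^{i(r+t-2t')|\xi|^2}}{(1+|\xi|^2)^{\alpha}}e^{-i\langle\xi,x-y\rangle}\,d\xi\,dt' .$$ **(Convergence.)** Let $(\Psi_n(t,x))$ be any centered complex Gaussian process on $\Omega$ with these covariances (a *regularized stochastic convolution*). Then it has a modification for which, almost surely, $(t,x)\mapsto\Psi_n(t,x)$ is continuous on $[0,T]\times\mathbb R^d$ for every $n$. For every such modification, almost surely,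 $\rho\Psi_n$ belongs to $\mathcal C([0,T];\mathcal W^{-s,p}(\mathbb R^d))$ for every $n\in\mathbb N$, and the sequence $(\rho\Psi_n)_{n\in\mathbb N}$ converges in this space; in particular its limit $\rho\Psi$ lies in $\mathcal C([0,T];\mathcal W^{-s,p}(\mathbb R^d))$. -/

import Mathlib

open MeasureTheory ProbabilityTheory Filter Topology Set
open scoped SchwartzMap ENNReal ComplexConjugate

noncomputable section

namespace SNLS

/-- The Euclidean space `ℝ^d`. -/
abbrev Space (d : ℕ) : Type := EuclideanSpace ℝ (Fin d)

/-! ### Bessel potential Sobolev spaces -/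

/-- The symbol of `(1 - Δ)^(σ/2)`, written in the frequency variable of Mathlib's Fourier transform
`𝓕 f ξ = ∫ f x exp (-2πi ⟨x, ξ⟩) dx`: the angular frequency is `2π ξ`. -/
def besselSymbol (d : ℕ) (σ : ℝ) (ξ : Space d) : ℝ :=
  (1 + ‖(2 * Real.pi) • ξ‖ ^ 2) ^ (σ / 2)

theorem besselSymbol_hasTemperateGrowth (d : ℕ) (σ : ℝ) :
    (fun ξ : Space d => (besselSymbol d σ ξ : ℂ)).HasTemperateGrowth := by
  have h1 := Function.hasTemperateGrowth_one_add_norm_sq_rpow (Space d) (σ / 2)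
  have h2 : (fun ξ : Space d => (2 * Real.pi) • ξ).HasTemperateGrowth :=
    ((2 * Real.pi) • ContinuousLinearMap.id ℝ (Space d)).hasTemperateGrowth
  have h3 := Function.HasTemperateGrowth.comp Function.Complex.hasTemperateGrowth_ofReal (h1.comp h2)
  exact h3

/-- The operator `(1 - Δ)^(σ/2)` on tempered distributions. -/
def besselOp (d : ℕ) (σ : ℝ) : 𝓢'(Space d, ℂ) →L[ℂ] 𝓢'(Space d, ℂ) :=
  TemperedDistribution.fourierMultiplierCLM ℂ (fun ξ : Space d => (besselSymbol d σ ξ : ℂ))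

theorem besselOp_neg_besselOp (d : ℕ) (σ : ℝ) (f : 𝓢'(Space d, ℂ)) :
    besselOp d (-σ) (besselOp d σ f) = f := by
  unfold besselOp
  rw [TemperedDistribution.fourierMultiplierCLM_fourierMultiplierCLM_apply
    (besselSymbol_hasTemperateGrowth d σ) (besselSymbol_hasTemperateGrowth d (-σ))]
  have : ((fun ξ : Space d => (besselSymbol d σ ξ : ℂ)) *
      fun ξ : Space d => (besselSymbol d (-σ) ξ : ℂ)) = fun _ => (1 : ℂ) := by
    funext ξ
    simp only [Pi.mul_apply, besselSymbol]
    norm_cast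
    rw [← Real.rpow_add (by positivity)]
    ring_nf
    simp
  rw [this]
  simp

theorem besselOp_injective (d : ℕ) (σ : ℝ) : Function.Injective (besselOp d σ) :=
  Function.LeftInverse.injective (besselOp_neg_besselOp d σ)

section Sobolev

variable (d : ℕ) (σ : ℝ) (p : ℝ≥0∞) [Fact (1 ≤ p)]

/-- The embedding of `L^p(ℝ^d)` into the tempered distributions. -/
def lpEmb : Lp ℂ p (volume : Measure (Space d)) →ₗ[ℂ] 𝓢'(Space d, ℂ) :=
  (Lp.toTemperedDistributionCLM ℂ (volume : Measure (Space d)) p).toLinearMap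

theorem lpEmb_injective : Function.Injective (lpEmb d p) :=
  LinearMap.ker_eq_bot.mp Lp.ker_toTemperedDistributionCLM_eq_bot

/-- The tempered distributions `f` with `(1 - Δ)^(σ/2) f ∈ L^p(ℝ^d)`. -/
def sobolevSubmodule : Submodule ℂ 𝓢'(Space d, ℂ) :=
  Submodule.comap (besselOp d σ).toLinearMap (LinearMap.range (lpEmb d p))

/-- The space `W^{σ,p}(ℝ^d)`. It is a separate type because it carries the topology of its norm,
and not the topology induced from the tempered distributions. -/
def SobolevSpace : Type := sobolevSubmodule d σ p

instance : AddCommGroup (SobolevSpace d σ p) :=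
  inferInstanceAs (AddCommGroup (sobolevSubmodule d σ p))

instance : Module ℂ (SobolevSpace d σ p) :=
  inferInstanceAs (Module ℂ (sobolevSubmodule d σ p))

/-- The inclusion of `W^{σ,p}(ℝ^d)` in the tempered distributions. -/
def SobolevSpace.toDistribution : SobolevSpace d σ p →ₗ[ℂ] 𝓢'(Space d, ℂ) :=
  (sobolevSubmodule d σ p).subtype

/-- The map `f ↦ (1 - Δ)^(σ/2) f` from `W^{σ,p}(ℝ^d)` to `L^p(ℝ^d)`. -/
def SobolevSpace.toLp : SobolevSpace d σ p →ₗ[ℂ] Lp ℂ p (volume : Measure (Space d)) :=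
  (LinearEquiv.ofInjective (lpEmb d p) (lpEmb_injective d p)).symm.toLinearMap ∘ₗ
    LinearMap.codRestrict (LinearMap.range (lpEmb d p))
      ((besselOp d σ).toLinearMap ∘ₗ (sobolevSubmodule d σ p).subtype) (fun f => f.2)

theorem SobolevSpace.lpEmb_toLp (f : SobolevSpace d σ p) :
    lpEmb d p (SobolevSpace.toLp d σ p f) =
      besselOp d σ (SobolevSpace.toDistribution d σ p f) := by
  have h := LinearEquiv.apply_symm_apply (LinearEquiv.ofInjective (lpEmb d p) (lpEmb_injective d p))
    (LinearMap.codRestrict (LinearMap.range (lpEmb d p))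
      ((besselOp d σ).toLinearMap ∘ₗ (sobolevSubmodule d σ p).subtype) (fun f => f.2) f)
  exact congrArg Subtype.val h

theorem SobolevSpace.toLp_injective : Function.Injective (SobolevSpace.toLp d σ p) := by
  intro f g h
  have h1 : besselOp d σ (SobolevSpace.toDistribution d σ p f) =
      besselOp d σ (SobolevSpace.toDistribution d σ p g) := by
    rw [← SobolevSpace.lpEmb_toLp, ← SobolevSpace.lpEmb_toLp, h]
  exact Subtype.ext (besselOp_injective d σ h1)

/-- The norm `‖f‖ = ‖(1 - Δ)^(σ/2) f‖_{L^p}` on `W^{σ,p}(ℝ^d)`. -/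
instance : NormedAddCommGroup (SobolevSpace d σ p) :=
  NormedAddCommGroup.induced _ _ (SobolevSpace.toLp d σ p) (SobolevSpace.toLp_injective d σ p)

end Sobolev

/-- The tempered distribution `F` is given by the function `f`. -/
def IsGivenBy {d : ℕ} (F : 𝓢'(Space d, ℂ)) (f : Space d → ℂ) : Prop :=
  ∀ φ : 𝓢(Space d, ℂ), Integrable (fun x => φ x * f x) ∧ F φ = ∫ x, φ x * f x

/-! ### White noise and the truncated stochastic convolutions -/

/-- The Lebesgue measure of `[0, T] × ℝ^d`. -/
def slabMeasure (d : ℕ) (T : ℝ) : Measure (ℝ × Space d) :=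
  volume.restrict (Icc (0 : ℝ) T ×ˢ univ)

/-- `W` is a real space-time white noise on `[0, T] × ℝ^d`, seen as the Gaussian random measure
`f ↦ ∫∫ f(t, x) W(dt, dx)`: it is linear on `L²([0, T] × ℝ^d)` up to null events, and `W f` is a
centered Gaussian variable of variance `‖f‖²`. The values at other functions are irrelevant. -/
structure IsWhiteNoise {d : ℕ} (T : ℝ) {Ω : Type*} [MeasurableSpace Ω]
    (W : (ℝ × Space d → ℝ) → Ω → ℝ) (P : Measure Ω) : Prop where
  hasLaw : ∀ f, MemLp f 2 (slabMeasure d T) →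
    HasLaw (W f) (gaussianReal 0 (∫ z, f z ^ 2 ∂(slabMeasure d T)).toNNReal) P
  linear : ∀ f g, MemLp f 2 (slabMeasure d T) → MemLp g 2 (slabMeasure d T) → ∀ a b : ℝ,
    W (a • f + b • g) =ᵐ[P] a • W f + b • W g

/-- The convolution kernel of `e^{-itΔ} ⟨∇⟩^{-α} χ_n(∇)`, with `χ_n` the indicator function of the
closed ball of radius `n`. -/
def convKernel (d : ℕ) (α : ℝ) (n : ℕ) (t : ℝ) (x : Space d) : ℂ :=
  1 / (2 * Real.pi : ℂ) ^ d * ∫ ξ in Metric.closedBall (0 : Space d) n,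
    Complex.exp (Complex.I * (t * ‖ξ‖ ^ 2 : ℝ)) / ((1 + ‖ξ‖ ^ 2) ^ (α / 2) : ℝ) *
      Complex.exp (Complex.I * (inner ℝ x ξ : ℝ))

/-- The integrand `(t', x') ↦ 1_{0 ≤ t' ≤ t} a_n(t - t', x - x')`, with `a_n` the kernel above. -/
def convIntegrand (d : ℕ) (α : ℝ) (n : ℕ) (t : ℝ) (x : Space d) : ℝ × Space d → ℂ :=
  indicator (Icc (0 : ℝ) t ×ˢ univ) fun z => convKernel d α n (t - z.1) (x - z.2)

/-- The truncated stochastic convolution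
`Ψ_n(t, x) = -i ∫_0^t ∫ a_n(t - t', x - x') W(dt', dx')`; the integral of a complex function with
respect to `W` is taken by real and imaginary parts. -/
def stochConv {d : ℕ} {T : ℝ} {Ω : Type*} (α : ℝ) (W : (ℝ × Space d → ℝ) → Ω → ℝ)
    (n : ℕ) (t : Icc (0 : ℝ) T) (x : Space d) (ω : Ω) : ℂ :=
  -Complex.I * (W (fun z => (convIntegrand d α n t x z).re) ω +
    Complex.I * W (fun z => (convIntegrand d α n t x z).im) ω)

/-- A regularized stochastic convolution: a centered complex Gaussian process
`Ψ_n(t, x)`, `n ∈ ℕ`, `0 ≤ t ≤ T`, `x ∈ ℝ^d`, with the covariances of the truncated stochastic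
convolutions. -/
structure IsRegularizedConvolution {d : ℕ} {T : ℝ} {Ω : Type*} [MeasurableSpace Ω] (α : ℝ)
    (Ψ : ℕ → Icc (0 : ℝ) T → Space d → Ω → ℂ) (P : Measure Ω) : Prop where
  gaussian : IsGaussianProcess
    (fun i : ℕ × Icc (0 : ℝ) T × Space d => Ψ i.1 i.2.1 i.2.2) P
  centered : ∀ n t x, ∫ ω, Ψ n t x ω ∂P = 0
  covariance : ∀ (n m : ℕ) (s t : Icc (0 : ℝ) T) (x y : Space d),
    ∫ ω, Ψ n s x ω * conj (Ψ m t y ω) ∂P =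
      (min (s : ℝ) t : ℝ) * (1 / (2 * Real.pi : ℂ) ^ d) *
        ∫ ξ in Metric.closedBall (0 : Space d) n ∩ Metric.closedBall 0 m,
          Complex.exp (Complex.I * (((s : ℝ) - t) * ‖ξ‖ ^ 2 : ℝ)) / ((1 + ‖ξ‖ ^ 2) ^ α : ℝ) *
            Complex.exp (-Complex.I * (inner ℝ ξ (x - y) : ℝ))
  relation : ∀ (n m : ℕ) (s t : Icc (0 : ℝ) T) (x y : Space d),
    ∫ ω, Ψ n s x ω * Ψ m t y ω ∂P =
      -(1 / (2 * Real.pi : ℂ) ^ d) * ∫ r in (0 : ℝ)..(min (s : ℝ) t),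
        ∫ ξ in Metric.closedBall (0 : Space d) n ∩ Metric.closedBall 0 m,
          Complex.exp (Complex.I * (((s : ℝ) + t - 2 * r) * ‖ξ‖ ^ 2 : ℝ)) /
              ((1 + ‖ξ‖ ^ 2) ^ α : ℝ) *
            Complex.exp (-Complex.I * (inner ℝ ξ (x - y) : ℝ))

/-- `Φ` is a modification of `Ψ` such that almost surely all the maps `(t, x) ↦ Φ_n(t, x)` are
continuous on `[0, T] × ℝ^d`. -/
def IsContinuousModification {d : ℕ} {T : ℝ} {Ω : Type*} [MeasurableSpace Ω]
    (Φ Ψ : ℕ → Icc (0 : ℝ) T → Space d → Ω → ℂ) (P : Measure Ω) : Prop :=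
  (∀ n t x, Φ n t x =ᵐ[P] Ψ n t x) ∧
    ∀ᵐ ω ∂P, ∀ n, Continuous fun z : Icc (0 : ℝ) T × Space d => Φ n z.1 z.2 ω

end SNLS

end

open SNLS

/-!
The law of the truncated stochastic convolutions is the Itô isometry of the white noise combined
with Plancherel's theorem in the space variable, since `x' ↦ a_n(s, x - x')` is the Fourier
transform of a bounded function with compact support (`fourier_waveProfile`,
`IsWhiteNoise.isRegularizedConvolution`).

The convergence only uses this law. The covariances are inner products in `L²([0, T] × ℝ^d)` of the
explicit functions `spectralKernel`, so the variance of a linear combination of values of the process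
is the squared `L²` norm of the same combination of these functions; as the combination is Gaussian,
this norm controls all its moments (`IsRegularizedConvolution.moment_sum_le`), and Fatou's lemma
extends the control to integrals in the space variable
(`IsRegularizedConvolution.moment_integral_sub_le`). A version of Kolmogorov's criterion for random
pseudo-distances (`kolmogorov_criterion`) then serves twice. For fixed `n`, applied to `|Ψ_n(t, x) -
Ψ_n(r, y)|` on bounded sets, it gives the continuous modification.

For the convergence in `C([0, T]; W^{-s,p})`, let `F(t, n, R)` be `(1 - Δ)^{-s/2}(ρ Ψ_n(t))` with the
frequencies larger than `R` removed from the Bessel operator (`regField`). The criterion is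
applied to the pseudo-distance `‖F(t, n, R) - F(r, m, S)‖_{L^p}` with the three real parameters `t`,
`1 / (n + 1)` and `1 / (R + 1)`: the almost sure uniform continuity in these parameters contains the
continuity in time, the convergence as `n → ∞`, and the convergence as `R → ∞`, which identifies
`(1 - Δ)^{-s/2}(ρ Ψ_n(t))` as an element of `L^p` (`exists_tendsto_sobolevSpace`).

The estimate behind it is a bound of the variance of `F(t, n, R)(y) - F(r, m, S)(y)`, uniform in `y`
and integrated in `y` (`exists_incrVariance_bound`). The operator `(1 - Δ)^{-s/2}` applied to the
localized plane wave `ρ e^{-i⟨ξ, ·⟩}` has size `⟨ξ⟩^{-s}`, because `ρ` is a Schwartz function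
(Peetre's inequality, `exists_modulatedMultiplier_bound`); hence the variance is at most a multiple
of `∫ ⟨ξ⟩^{-2α-2s} dξ`, which converges precisely because `s > d/2 - α`, and the room left in this
inequality is exchanged for a power `θ` of the distance of the parameters. Moments of high order of
the `L^p` norm follow from the Gaussian moments and Hölder's inequality
(`lintegral_rpow_lintegral_le`).
-/

noncomputable section

namespace SNLS

/-! ### A chaining criterion for uniform continuity -/

/-- A set whose image in `ℝ^ι` is bounded has `2^(-k)`-nets with `O(2^(k |ι|))` elements. -/
theorem exists_net {U ι : Type*} [Fintype ι] (e : U → ι → ℝ) {R : ℝ} (hR : ∀ u i, |e u i| ≤ R)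
    (hR0 : 0 ≤ R) (k : ℕ) :
    ∃ (S : Finset U) (π : U → U), (S.card : ℝ) ≤ ((2 * R + 2) * 2 ^ k) ^ Fintype.card ι ∧
      ∀ u, π u ∈ S ∧ dist (e u) (e (π u)) ≤ (1 / 2) ^ k := by
  classical
  -- the net picks one point in each nonempty cell of the grid of mesh `2^(-k)`
  let c : U → ι → ℤ := fun u i => ⌊2 ^ k * e u i⌋
  let G : Finset (ι → ℤ) := Fintype.piFinset fun _ => Finset.Icc ⌊-(2 ^ k * R)⌋ ⌊2 ^ k * R⌋
  have hcG : ∀ u, c u ∈ G := by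
    intro u
    simp only [G, Fintype.mem_piFinset, Finset.mem_Icc, c]
    intro i
    have h := abs_le.1 (hR u i)
    constructor <;> apply Int.floor_le_floor <;> nlinarith [pow_pos (two_pos (α := ℝ)) k]
  by_cases hU : Nonempty U
  swap
  · exact ⟨∅, id, by simp; positivity, fun u => (hU ⟨u⟩).elim⟩
  let r : (ι → ℤ) → U := Function.invFun c
  have hr : ∀ u, c (r (c u)) = c u := fun u => Function.invFun_eq ⟨u, rfl⟩
  refine ⟨G.image r, fun u => r (c u), ?_, fun u => ⟨Finset.mem_image_of_mem _ (hcG u), ?_⟩⟩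
  · calc ((G.image r).card : ℝ) ≤ G.card := by exact_mod_cast Finset.card_image_le
      _ = ((Finset.Icc ⌊-(2 ^ k * R)⌋ ⌊2 ^ k * R⌋).card : ℝ) ^ Fintype.card ι := by
        simp [G, Fintype.card_piFinset]
      _ ≤ _ := by
        gcongr
        rw [Int.card_Icc]
        have h1 : ⌊-(2 ^ k * R)⌋ ≤ ⌊2 ^ k * R⌋ := by
          apply Int.floor_le_floor
          have : 0 ≤ 2 ^ k * R := by positivity
          linarith
        have h2 : ((⌊2 ^ k * R⌋ + 1 - ⌊-(2 ^ k * R)⌋).toNat : ℝ) =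
            (⌊2 ^ k * R⌋ : ℝ) + 1 - ⌊-(2 ^ k * R)⌋ := by
          have : ((⌊2 ^ k * R⌋ + 1 - ⌊-(2 ^ k * R)⌋).toNat : ℤ) =
            ⌊2 ^ k * R⌋ + 1 - ⌊-(2 ^ k * R)⌋ := Int.toNat_of_nonneg (by linarith)
          exact_mod_cast congrArg (Int.cast (R := ℝ)) this
        rw [h2]
        have h3 := Int.floor_le (2 ^ k * R)
        have h4 := Int.lt_floor_add_one (-(2 ^ k * R))
        have h5 : (1 : ℝ) ≤ 2 ^ k := one_le_pow₀ (by norm_num)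
        linarith
  · rw [dist_pi_le_iff (by positivity)]
    intro i
    have h1 : ⌊2 ^ k * e u i⌋ = ⌊2 ^ k * e (r (c u)) i⌋ := (congrFun (hr u) i).symm
    have h2 := Int.abs_sub_lt_one_of_floor_eq_floor h1
    rw [← mul_sub, abs_mul, abs_of_pos (by positivity : (0 : ℝ) < 2 ^ k)] at h2
    rw [Real.dist_eq, div_pow, one_pow, le_div_iff₀ (by positivity), mul_comm]
    exact h2.le

/-- The telescoping step of chaining: a pseudo-distance which is geometrically small along
the successive approximations `π k u` of `u`, and small between close points at each scale, is
uniformly continuous. -/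
theorem chaining {U ι : Type*} [Fintype ι] (e : U → ι → ℝ) (δ : U → U → ℝ≥0∞)
    (hsymm : ∀ u v, δ u v = δ v u) (htri : ∀ u v w, δ u w ≤ δ u v + δ v w)
    (S : ℕ → Finset U) (π : ℕ → U → U)
    (hπ : ∀ k u, π k u ∈ S k ∧ dist (e u) (e (π k u)) ≤ (1 / 2) ^ k)
    {B r : ℝ≥0∞} (hB : B ≠ ∞) (hr : r < 1)
    (hδ : ∀ k, ∀ u ∈ S k, ∀ v, (v ∈ S k ∨ v ∈ S (k + 1)) →
      dist (e u) (e v) ≤ 3 * (1 / 2) ^ k → δ u v ≤ B * r ^ k)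
    (D : Set U) (hD : ∀ u ∈ D, Tendsto (fun k => δ (π k u) u) atTop (𝓝 0)) :
    ∀ ε > 0, ∃ η > 0, ∀ u ∈ D, ∀ v ∈ D, dist (e u) (e v) < η → δ u v ≤ ε := by
  have hstep : ∀ u k, δ (π k u) (π (k + 1) u) ≤ B * r ^ k := by
    intro u k
    refine hδ k _ (hπ k u).1 _ (Or.inr (hπ (k + 1) u).1) ?_
    have h1 := dist_triangle_left (e (π k u)) (e (π (k + 1) u)) (e u)
    have h2 := (hπ k u).2
    have h3 := (hπ (k + 1) u).2
    have h4 : ((1 : ℝ) / 2) ^ (k + 1) ≤ (1 / 2) ^ k :=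
      pow_le_pow_of_le_one (by norm_num) (by norm_num) (Nat.le_succ k)
    have h5 : (0 : ℝ) ≤ (1 / 2) ^ k := by positivity
    linarith
  have hchain : ∀ u k j, δ (π k u) (π (k + 1 + j) u) ≤
      ∑ i ∈ Finset.range (j + 1), B * r ^ (k + i) := by
    intro u k j
    induction j with
    | zero => simpa using hstep u k
    | succ j ih =>
      rw [Finset.sum_range_succ]
      refine (htri _ (π (k + 1 + j) u) _).trans (add_le_add ih ?_)
      have := hstep u (k + 1 + j)
      rwa [show k + (j + 1) = k + 1 + j by ring]
  have hgeo : ∀ k j, ∑ i ∈ Finset.range (j + 1), B * r ^ (k + i) ≤ B * r ^ k * (1 - r)⁻¹ := by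
    intro k j
    calc ∑ i ∈ Finset.range (j + 1), B * r ^ (k + i)
        = B * r ^ k * ∑ i ∈ Finset.range (j + 1), r ^ i := by
          rw [Finset.mul_sum]
          exact Finset.sum_congr rfl fun i _ => by rw [pow_add]; ring
      _ ≤ _ := by
        gcongr
        rw [← ENNReal.tsum_geometric]
        exact ENNReal.sum_le_tsum _
  have hlim : ∀ u ∈ D, ∀ k, δ (π k u) u ≤ B * r ^ k * (1 - r)⁻¹ := by
    intro u hu k
    have h1 : Tendsto (fun j => B * r ^ k * (1 - r)⁻¹ + δ (π (k + 1 + j) u) u) atTop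
        (𝓝 (B * r ^ k * (1 - r)⁻¹ + 0)) := by
      refine Tendsto.add tendsto_const_nhds ((hD u hu).comp ?_)
      exact tendsto_atTop_mono (fun j => Nat.le_add_left j (k + 1)) tendsto_id
    rw [add_zero] at h1
    refine ge_of_tendsto' h1 fun j => ?_
    exact (htri _ _ _).trans (add_le_add ((hchain u k j).trans (hgeo k j)) le_rfl)
  have hinv : (1 - r)⁻¹ ≠ ∞ := ENNReal.inv_ne_top.2 (tsub_pos_of_lt hr).ne'
  have htend : Tendsto (fun k => B * r ^ k * (1 - r)⁻¹ + (B * r ^ k + B * r ^ k * (1 - r)⁻¹))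
      atTop (𝓝 0) := by
    have h1 : Tendsto (fun k => B * r ^ k) atTop (𝓝 0) := by
      simpa using ENNReal.Tendsto.const_mul (ENNReal.tendsto_pow_atTop_nhds_zero_of_lt_one hr)
        (Or.inr hB)
    have h2 : Tendsto (fun k => B * r ^ k * (1 - r)⁻¹) atTop (𝓝 0) := by
      simpa using ENNReal.Tendsto.mul_const h1 (Or.inr hinv)
    simpa using h2.add (h1.add h2)
  intro ε hε
  obtain ⟨k, hk⟩ := (htend.eventually (gt_mem_nhds hε)).exists
  refine ⟨(1 / 2) ^ k, by positivity, fun u hu v hv huv => le_trans ?_ hk.le⟩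
  refine (htri u (π k u) v).trans (add_le_add ?_ ((htri _ (π k v) _).trans (add_le_add ?_ ?_)))
  · rw [hsymm]; exact hlim u hu k
  · refine hδ k _ (hπ k u).1 _ (Or.inl (hπ k v).1) ?_
    have h1 := dist_triangle4 (e (π k u)) (e u) (e v) (e (π k v))
    rw [dist_comm (e (π k u)) (e u)] at h1
    have h2 := (hπ k u).2
    have h3 := (hπ k v).2
    linarith
  · exact hlim v hv k

/-- **Kolmogorov's criterion.** A random pseudo-distance `δ` on a set with bounded image in `ℝ^ι`
such that `E[δ(u, v)^q] ≤ M |u - v|^β` with `β > 2 |ι|` is almost surely uniformly continuous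
on every given countable set. The factor `2` is the price of counting all pairs of points of the
nets; the moments of Gaussian processes leave room for it. -/
theorem kolmogorov_criterion {U ι Ω : Type*} [Fintype ι] [MeasurableSpace Ω] {P : Measure Ω}
    (e : U → ι → ℝ) {R : ℝ} (hR : ∀ u i, |e u i| ≤ R)
    (δ : U → U → Ω → ℝ≥0∞) (hsymm : ∀ u v ω, δ u v ω = δ v u ω)
    (htri : ∀ u v w ω, δ u w ω ≤ δ u v ω + δ v w ω)
    (hmeas : ∀ u v, AEMeasurable (δ u v) P) {q β : ℝ} (hq : 0 < q)
    (hβ : 2 * Fintype.card ι < β) {M : ℝ≥0∞} (hM : M ≠ ∞)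
    (h : ∀ u v, ∫⁻ ω, δ u v ω ^ q ∂P ≤ M * ENNReal.ofReal (dist (e u) (e v)) ^ β)
    {D : Set U} (hD : D.Countable) :
    ∀ᵐ ω ∂P, ∀ ε > 0, ∃ η > 0, ∀ u ∈ D, ∀ v ∈ D, dist (e u) (e v) < η → δ u v ω ≤ ε := by
  classical
  wlog hR0 : 0 ≤ R generalizing R
  · exact this (R := |R|) (fun u i => (hR u i).trans (le_abs_self R)) (abs_nonneg R)
  have hβ0 : 0 < β := lt_of_le_of_lt (by positivity) hβ
  set N := Fintype.card ι with hN
  choose S π hS hπ using exists_net e hR hR0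
  -- the close pairs at scale `2^(-k)`
  let T : ℕ → Finset (U × U) := fun k =>
    ((S k) ×ˢ (S k ∪ S (k + 1))).filter fun z => dist (e z.1) (e z.2) ≤ 3 * (1 / 2) ^ k
  let Z : ℕ → Ω → ℝ≥0∞ := fun k ω => ∑ z ∈ T k, δ z.1 z.2 ω ^ q
  have hZm : ∀ k, AEMeasurable (Z k) P := fun k =>
    Finset.aemeasurable_fun_sum _ fun z _ => (hmeas z.1 z.2).pow_const q
  -- `ρ ^ 2 = 4 ^ N * 2 ^ (-β)` is the ratio of the geometric bound on the moments
  set ρ : ℝ := 2 ^ (-(β - 2 * N) / 2) with hρ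
  have hρ0 : 0 < ρ := by positivity
  have hρ1 : ρ < 1 := Real.rpow_lt_one_of_one_lt_of_neg (by norm_num) (by linarith)
  have hρ2 : ρ * ρ = 4 ^ N * 2 ^ (-β) := by
    rw [hρ, ← Real.rpow_add (by norm_num), show (4 : ℝ) = 2 ^ (2 : ℝ) by norm_num,
      ← Real.rpow_natCast, ← Real.rpow_mul (by norm_num), ← Real.rpow_add (by norm_num)]
    ring_nf
  set C : ℝ := (2 * R + 2) ^ N * ((2 * R + 2) ^ N * (1 + 2 ^ N)) * 3 ^ β with hC
  have hcard : ∀ k, ((T k).card : ℝ) * (3 * (1 / 2) ^ k) ^ β ≤ C * (ρ * ρ) ^ k := by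
    intro k
    have h1 : ((T k).card : ℝ) ≤ ((2 * R + 2) * 2 ^ k) ^ N *
        (((2 * R + 2) * 2 ^ k) ^ N + ((2 * R + 2) * 2 ^ (k + 1)) ^ N) := by
      calc ((T k).card : ℝ) ≤ (S k).card * ((S k).card + (S (k + 1)).card) := by
            have h2 : (T k).card ≤ (S k).card * ((S k).card + (S (k + 1)).card) :=
              (Finset.card_filter_le _ _).trans ((Finset.card_product _ _).le.trans
                (Nat.mul_le_mul_left _ (Finset.card_union_le _ _)))
            exact_mod_cast h2
        _ ≤ _ := by gcongr <;> apply hS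
    have h2 : (3 * (1 / 2) ^ k : ℝ) ^ β = 3 ^ β * (2 ^ (-β)) ^ k := by
      rw [Real.mul_rpow (by norm_num) (by positivity), ← Real.rpow_natCast, ← Real.rpow_natCast,
        ← Real.rpow_mul (by norm_num), ← Real.rpow_mul (by norm_num), one_div,
        Real.inv_rpow (by norm_num), ← Real.rpow_neg (by norm_num)]
      ring_nf
    rw [h2, hρ2]
    refine (mul_le_mul_of_nonneg_right h1 (by positivity)).trans (le_of_eq ?_)
    have h4 : (4 : ℝ) ^ N = 2 ^ N * 2 ^ N := by rw [← mul_pow]; norm_num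
    rw [hC, h4]
    simp only [mul_pow, pow_succ]
    ring
  have hEZ : ∀ k, ∫⁻ ω, Z k ω ∂P ≤ M * ENNReal.ofReal (C * (ρ * ρ) ^ k) := by
    intro k
    calc ∫⁻ ω, Z k ω ∂P = ∑ z ∈ T k, ∫⁻ ω, δ z.1 z.2 ω ^ q ∂P :=
          lintegral_finsetSum' _ fun z _ => (hmeas z.1 z.2).pow_const q
      _ ≤ ∑ z ∈ T k, M * ENNReal.ofReal ((3 * (1 / 2) ^ k) ^ β) := by
          refine Finset.sum_le_sum fun z hz => (h _ _).trans ?_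
          rw [ENNReal.ofReal_rpow_of_nonneg dist_nonneg hβ0.le]
          have := (Finset.mem_filter.1 hz).2
          gcongr
      _ = M * ENNReal.ofReal ((T k).card * (3 * (1 / 2) ^ k) ^ β) := by
          rw [Finset.sum_const, ENNReal.ofReal_mul (by positivity), ENNReal.ofReal_natCast,
            nsmul_eq_mul]
          ring
      _ ≤ _ := mul_le_mul_right (ENNReal.ofReal_le_ofReal (hcard k)) _
  set ρ' : ℝ≥0∞ := ENNReal.ofReal ρ with hρ'
  have hρ'1 : ρ' < 1 := by rw [hρ', ← ENNReal.ofReal_one]; exact (ENNReal.ofReal_lt_ofReal_iff one_pos).2 hρ1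
  have hρ'0 : ρ' ≠ 0 := by simpa [hρ'] using hρ0
  have hρ't : ρ' ≠ ∞ := ENNReal.ofReal_ne_top
  have hC0 : 0 ≤ C := by positivity
  have hsum : ∀ᵐ ω ∂P, ∑' k, (ρ'⁻¹) ^ k * Z k ω < ∞ := by
    refine ae_lt_top' (AEMeasurable.tsum fun k => (hZm k).const_mul _) ?_
    rw [lintegral_tsum fun k => (hZm k).const_mul _]
    have h1 : ∀ k, ∫⁻ ω, (ρ'⁻¹) ^ k * Z k ω ∂P ≤ M * ENNReal.ofReal C * ρ' ^ k := by
      intro k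
      rw [lintegral_const_mul'' _ (hZm k)]
      calc (ρ'⁻¹) ^ k * ∫⁻ ω, Z k ω ∂P
          ≤ (ρ'⁻¹) ^ k * (M * ENNReal.ofReal (C * (ρ * ρ) ^ k)) := by gcongr; exact hEZ k
        _ = M * ENNReal.ofReal C * ((ρ'⁻¹) ^ k * ρ' ^ k) * ρ' ^ k := by
          rw [ENNReal.ofReal_mul hC0, mul_pow, ENNReal.ofReal_mul (p := ρ ^ k) (by positivity),
            ENNReal.ofReal_pow hρ0.le]
          ring
        _ = M * ENNReal.ofReal C * ρ' ^ k := by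
          rw [← mul_pow, ENNReal.inv_mul_cancel hρ'0 hρ't, one_pow, mul_one]
    refine ne_of_lt (lt_of_le_of_lt (ENNReal.tsum_le_tsum h1) ?_)
    rw [ENNReal.tsum_mul_left, ENNReal.tsum_geometric]
    exact ENNReal.mul_lt_top (ENNReal.mul_lt_top hM.lt_top ENNReal.ofReal_lt_top)
      (ENNReal.inv_lt_top.2 (tsub_pos_of_lt hρ'1))
  have hDlim : ∀ u ∈ D, ∀ᵐ ω ∂P, Tendsto (fun k => δ (π k u) u ω) atTop (𝓝 0) := by
    intro u _
    have h1 : ∀ᵐ ω ∂P, ∑' k, δ (π k u) u ω ^ q < ∞ := by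
      refine ae_lt_top' (AEMeasurable.tsum fun k => (hmeas _ _).pow_const q) ?_
      rw [lintegral_tsum fun k => (hmeas _ _).pow_const q]
      have h2 : ∀ k, ∫⁻ ω, δ (π k u) u ω ^ q ∂P ≤ M * ENNReal.ofReal ((1 / 2) ^ β) ^ k := by
        intro k
        refine (h _ _).trans ?_
        gcongr
        rw [ENNReal.ofReal_rpow_of_nonneg dist_nonneg hβ0.le, ← ENNReal.ofReal_pow (by positivity),
          ← Real.rpow_natCast, ← Real.rpow_mul (by norm_num), mul_comm β, Real.rpow_mul (by norm_num),
          Real.rpow_natCast, dist_comm]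
        have := (hπ k u).2
        gcongr
      refine ne_of_lt (lt_of_le_of_lt (ENNReal.tsum_le_tsum h2) ?_)
      rw [ENNReal.tsum_mul_left, ENNReal.tsum_geometric]
      refine ENNReal.mul_lt_top hM.lt_top (ENNReal.inv_lt_top.2 (tsub_pos_of_lt ?_))
      rw [← ENNReal.ofReal_one]
      exact (ENNReal.ofReal_lt_ofReal_iff one_pos).2
        (Real.rpow_lt_one (by norm_num) (by norm_num) hβ0)
    filter_upwards [h1] with ω hω
    have h2 := (ENNReal.tendsto_atTop_zero_of_tsum_ne_top hω.ne).ennrpow_const (1 / q)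
    rw [ENNReal.zero_rpow_of_pos (by positivity)] at h2
    refine h2.congr fun k => ?_
    rw [← ENNReal.rpow_mul, mul_one_div_cancel hq.ne', ENNReal.rpow_one]
  filter_upwards [hsum, (ae_ball_iff hD).2 hDlim] with ω hω hωD
  set A : ℝ≥0∞ := ∑' k, (ρ'⁻¹) ^ k * Z k ω with hA
  refine chaining e (fun u v => δ u v ω) (fun u v => hsymm u v ω) (fun u v w => htri u v w ω)
    S π hπ (B := A ^ (1 / q)) (r := ρ' ^ (1 / q)) (by finiteness)
    (ENNReal.rpow_lt_one hρ'1 (by positivity)) ?_ D hωD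
  intro k u hu v hv huv
  have h1 : δ u v ω ^ q ≤ A * ρ' ^ k := by
    have hz : (u, v) ∈ T k := by
      simp only [T, Finset.mem_filter, Finset.mem_product, Finset.mem_union]
      exact ⟨⟨hu, hv⟩, huv⟩
    have h2 : δ u v ω ^ q ≤ Z k ω :=
      Finset.single_le_sum (f := fun z : U × U => δ z.1 z.2 ω ^ q) (fun _ _ => zero_le) hz
    have h3 : (ρ'⁻¹) ^ k * Z k ω ≤ A := ENNReal.le_tsum k
    calc δ u v ω ^ q ≤ Z k ω := h2
      _ = (ρ'⁻¹) ^ k * Z k ω * ρ' ^ k := by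
        rw [mul_right_comm, ← mul_pow, ENNReal.inv_mul_cancel hρ'0 hρ't, one_pow, one_mul]
      _ ≤ _ := by gcongr
  calc δ u v ω = (δ u v ω ^ q) ^ (1 / q) := by
        rw [← ENNReal.rpow_mul, mul_one_div_cancel hq.ne', ENNReal.rpow_one]
    _ ≤ (A * ρ' ^ k) ^ (1 / q) := by gcongr
    _ = A ^ (1 / q) * (ρ' ^ (1 / q)) ^ k := by
      rw [ENNReal.mul_rpow_of_nonneg _ _ (by positivity), ← ENNReal.rpow_natCast,
        ← ENNReal.rpow_natCast, ← ENNReal.rpow_mul, ← ENNReal.rpow_mul, mul_comm (k : ℝ)]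

/-! ### Plancherel's theorem for integrable functions -/

section Plancherel

open FourierTransform

variable {d : ℕ}

/-- On `L¹ ∩ L²` the Fourier integral represents the Fourier transform of `L²`. -/
theorem fourier_toLp_ae_eq {f : Space d → ℂ} (hf1 : Integrable f) (hf2 : MemLp f 2) :
    ((𝓕 (hf2.toLp f) : Lp ℂ 2 (volume : Measure (Space d))) : Space d → ℂ) =ᵐ[volume] 𝓕 f := by
  have hcont : Continuous (𝓕 f) :=
    VectorFourier.fourierIntegral_continuous Real.continuous_fourierChar
      (by exact continuous_inner) hf1
  refine ae_eq_of_integral_contDiff_smul_eq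
    ((Lp.memLp _).locallyIntegrable (by norm_num)) hcont.locallyIntegrable ?_
  intro g hg hgc
  have hg₁ : HasCompactSupport (Complex.ofRealCLM ∘ g) := hgc.comp_left rfl
  have hg₂ : ContDiff ℝ (⊤ : ℕ∞) (Complex.ofRealCLM ∘ g) := by fun_prop
  set φ : 𝓢(Space d, ℂ) := hg₁.toSchwartzMap hg₂
  have hφ : ∀ x, φ x = (g x : ℂ) := fun x => rfl
  have h1 := congrArg (fun F : 𝓢'(Space d, ℂ) => F φ)
    (Lp.fourier_toTemperedDistribution_eq (hf2.toLp f))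
  simp only [TemperedDistribution.fourier_apply, Lp.toTemperedDistribution_apply] at h1
  have h2 : ∫ x, (𝓕 φ) x • (hf2.toLp f : Space d → ℂ) x =
      ∫ x, (𝓕 (φ : Space d → ℂ)) x • f x := by
    refine integral_congr_ae ?_
    filter_upwards [hf2.coeFn_toLp] with x hx
    rw [hx, SchwartzMap.fourier_coe]
  have h3 : ∫ x, (𝓕 (φ : Space d → ℂ)) x • f x = ∫ x, φ x • (𝓕 f) x :=
    (VectorFourier.integral_fourierIntegral_smul_eq_flip (L := innerₗ (Space d))
      Real.continuous_fourierChar (by exact continuous_inner) φ.integrable hf1).trans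
      (by rw [flip_innerₗ]; rfl)
  have h4 := h1.symm.trans (h2.trans h3)
  simpa only [hφ, Complex.coe_smul] using h4


theorem memLp_fourier {f : Space d → ℂ} (hf1 : Integrable f) (hf2 : MemLp f 2) :
    MemLp (𝓕 f) 2 :=
  (memLp_congr_ae (fourier_toLp_ae_eq hf1 hf2)).1 (Lp.memLp _)

theorem integral_conj_fourier_mul_fourier {f g : Space d → ℂ} (hf1 : Integrable f)
    (hf2 : MemLp f 2) (hg1 : Integrable g) (hg2 : MemLp g 2) :
    ∫ x, 𝓕 g x * conj (𝓕 f x) = ∫ x, g x * conj (f x) := by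
  have h := Lp.inner_fourier_eq (hf2.toLp f) (hg2.toLp g)
  rw [L2.inner_def, L2.inner_def] at h
  have e1 : ∫ x, 𝓕 g x * conj (𝓕 f x) = ∫ x, inner ℂ
      ((𝓕 (hf2.toLp f) : Lp ℂ 2 (volume : Measure (Space d))) x)
      ((𝓕 (hg2.toLp g) : Lp ℂ 2 (volume : Measure (Space d))) x) := by
    refine integral_congr_ae ?_
    filter_upwards [fourier_toLp_ae_eq hf1 hf2, fourier_toLp_ae_eq hg1 hg2] with x h1 h2
    rw [h1, h2]; rfl
  have e2 : ∫ x, g x * conj (f x) = ∫ x, inner ℂ (hf2.toLp f x) (hg2.toLp g x) := by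
    refine integral_congr_ae ?_
    filter_upwards [hf2.coeFn_toLp, hg2.coeFn_toLp] with x h1 h2
    rw [h1, h2]; rfl
  rw [e1, e2, h]

theorem lintegral_enorm_fourier_sq {f : Space d → ℂ} (hf1 : Integrable f) (hf2 : MemLp f 2) :
    ∫⁻ x, ‖𝓕 f x‖ₑ ^ 2 = ∫⁻ x, ‖f x‖ₑ ^ 2 := by
  have h := Lp.norm_fourier_eq (hf2.toLp f)
  rw [Lp.norm_def, Lp.norm_def, eLpNorm_congr_ae (fourier_toLp_ae_eq hf1 hf2),
    eLpNorm_congr_ae hf2.coeFn_toLp,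
    ENNReal.toReal_eq_toReal_iff' (memLp_fourier hf1 hf2).2.ne hf2.2.ne] at h
  have h2 : ∀ g : Space d → ℂ, ∫⁻ x, ‖g x‖ₑ ^ 2 = eLpNorm g 2 volume ^ 2 := by
    intro g
    have := eLpNorm_nnreal_pow_eq_lintegral (μ := (volume : Measure (Space d))) (f := g)
      (p := 2) (by norm_num)
    simpa using this.symm
  rw [h2, h2, h]

/-- Plancherel's theorem for the inverse Fourier integral. -/
theorem lintegral_enorm_fourierInv_sq {f : Space d → ℂ} (hf1 : Integrable f) (hf2 : MemLp f 2) :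
    ∫⁻ x, ‖𝓕⁻ f x‖ₑ ^ 2 = ∫⁻ x, ‖f x‖ₑ ^ 2 := by
  rw [← lintegral_enorm_fourier_sq hf1 hf2,
    ← lintegral_neg_eq_self (μ := (volume : Measure (Space d))) (fun x => ‖𝓕 f x‖ₑ ^ 2)]
  simp only [Real.fourierInv_eq_fourier_neg]

end Plancherel

/-! ### Moments of Gaussian variables -/

theorem lintegral_enorm_rpow_gaussianReal (r : ℝ) (hr : 0 < r) (v : NNReal) :
    ∫⁻ x, ‖x‖ₑ ^ r ∂(gaussianReal 0 v) =
      (∫⁻ x, ‖x‖ₑ ^ r ∂(gaussianReal 0 1)) * (v : ℝ≥0∞) ^ (r / 2) := by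
  have h1 : (gaussianReal 0 1).map (Real.sqrt v * ·) = gaussianReal 0 v := by
    rw [gaussianReal_map_const_mul]
    congr 1
    · simp
    · ext; simp
  rw [← h1, lintegral_map (by fun_prop) (by fun_prop)]
  have h2 : ∀ x : ℝ, ‖Real.sqrt v * x‖ₑ ^ r = (v : ℝ≥0∞) ^ (r / 2) * ‖x‖ₑ ^ r := by
    intro x
    have h3 : ‖Real.sqrt v‖ₑ = (v : ℝ≥0∞) ^ ((1 : ℝ) / 2) := by
      rw [Real.enorm_of_nonneg (Real.sqrt_nonneg _), Real.sqrt_eq_rpow,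
        ← ENNReal.ofReal_rpow_of_nonneg (NNReal.coe_nonneg v) (by norm_num),
        ENNReal.ofReal_coe_nnreal]
    rw [enorm_mul, ENNReal.mul_rpow_of_nonneg _ _ hr.le, h3, ← ENNReal.rpow_mul]
    ring_nf
  simp_rw [h2]
  rw [lintegral_const_mul _ (by fun_prop), mul_comm]

theorem lintegral_enorm_rpow_gaussianReal_lt_top (r : ℝ) (hr : 0 < r) :
    ∫⁻ x, ‖x‖ₑ ^ r ∂(gaussianReal 0 1) < ∞ := by
  have h := (memLp_id_gaussianReal (μ := 0) (v := 1) r.toNNReal).2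
  rw [eLpNorm_lt_top_iff_lintegral_rpow_enorm_lt_top (by simpa using hr) (by simp)] at h
  simpa [hr.le] using h

theorem lintegral_enorm_sq_gaussianReal :
    ∫⁻ x, ‖x‖ₑ ^ (2 : ℝ) ∂(gaussianReal 0 1) = 1 := by
  have h := variance_id_gaussianReal (μ := 0) (v := 1)
  have h2 := evariance_eq_lintegral_ofReal id (gaussianReal 0 1)
  have h3 : evariance id (gaussianReal 0 1) = 1 := by
    rw [← (memLp_id_gaussianReal (μ := 0) (v := 1) 2).ofReal_variance_eq, h]; simp
  rw [h3] at h2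
  rw [h2]
  refine lintegral_congr fun x => ?_
  rw [← ofReal_norm, ENNReal.ofReal_rpow_of_nonneg (norm_nonneg _) (by norm_num)]
  simp

/-- Hypercontractivity: all the moments of a centered complex Gaussian variable are controlled by
its second moment, with a constant which depends only on the order. -/
theorem exists_gaussian_moment_bound (r : ℝ) (hr : 0 < r) :
    ∃ C : ℝ≥0∞, C ≠ ∞ ∧ ∀ {Ω : Type*} [MeasurableSpace Ω] {P : Measure Ω}
      {Z : Ω → ℂ}, HasGaussianLaw Z P → ∫ ω, Z ω ∂P = 0 →
      ∫⁻ ω, ‖Z ω‖ₑ ^ r ∂P ≤ C * (∫⁻ ω, ‖Z ω‖ₑ ^ 2 ∂P) ^ (r / 2) := by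
  set A := ∫⁻ x, ‖x‖ₑ ^ r ∂(gaussianReal 0 1) with hA
  have hAt : A ≠ ∞ := (lintegral_enorm_rpow_gaussianReal_lt_top r hr).ne
  refine ⟨2 ^ r * (A + A), by finiteness, ?_⟩
  intro Ω _ P Z hZ hZ0
  have hP := hZ.isProbabilityMeasure
  have hreal : ∀ X : Ω → ℝ, HasGaussianLaw X P → ∫ ω, X ω ∂P = 0 →
      ∫⁻ ω, ‖X ω‖ₑ ^ r ∂P = A * (∫⁻ ω, ‖X ω‖ₑ ^ 2 ∂P) ^ (r / 2) := by
    intro X hX hX0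
    have hlaw := hX.map_eq_gaussianReal
    rw [hX0] at hlaw
    have key : ∀ q : ℝ, 0 < q → ∫⁻ ω, ‖X ω‖ₑ ^ q ∂P =
        (∫⁻ x, ‖x‖ₑ ^ q ∂(gaussianReal 0 1)) * ((Var[X; P]).toNNReal : ℝ≥0∞) ^ (q / 2) := by
      intro q hq
      rw [← lintegral_enorm_rpow_gaussianReal q hq, ← hlaw,
        lintegral_map' (by fun_prop) hX.aemeasurable]
    have h2 := key 2 (by norm_num)
    rw [lintegral_enorm_sq_gaussianReal, one_mul, div_self (by norm_num), ENNReal.rpow_one] at h2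
    simp only [ENNReal.rpow_two] at h2
    rw [key r hr, h2]
  have hre := hreal _ (hZ.map_fun Complex.reCLM) (by
    rw [ContinuousLinearMap.integral_comp_comm _ hZ.integrable, hZ0, map_zero])
  have him := hreal _ (hZ.map_fun Complex.imCLM) (by
    rw [ContinuousLinearMap.integral_comp_comm _ hZ.integrable, hZ0, map_zero])
  have hZm := hZ.aemeasurable
  have hle : ∀ L : ℂ →L[ℝ] ℝ, (∀ z, ‖L z‖ ≤ ‖z‖) →
      (∫⁻ ω, ‖L (Z ω)‖ₑ ^ 2 ∂P) ^ (r / 2) ≤ (∫⁻ ω, ‖Z ω‖ₑ ^ 2 ∂P) ^ (r / 2) := by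
    intro L hL
    gcongr with ω
    exact enorm_le_iff_norm_le.2 (hL _)
  calc ∫⁻ ω, ‖Z ω‖ₑ ^ r ∂P
      ≤ ∫⁻ ω, 2 ^ r * (‖Complex.reCLM (Z ω)‖ₑ ^ r + ‖Complex.imCLM (Z ω)‖ₑ ^ r) ∂P := by
        refine lintegral_mono fun ω => ?_
        have h1 : ‖Z ω‖ₑ ≤ ‖Complex.reCLM (Z ω)‖ₑ + ‖Complex.imCLM (Z ω)‖ₑ := by
          have := Complex.norm_le_abs_re_add_abs_im (Z ω)
          rw [← ofReal_norm, ← ofReal_norm, ← ofReal_norm,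
            ← ENNReal.ofReal_add (norm_nonneg _) (norm_nonneg _)]
          exact ENNReal.ofReal_le_ofReal this
        have h2 : ∀ a b : ℝ≥0∞, (a + b) ^ r ≤ 2 ^ r * (a ^ r + b ^ r) := by
          intro a b
          calc (a + b) ^ r ≤ (2 * max a b) ^ r := by
                gcongr
                rw [two_mul]
                exact add_le_add (le_max_left _ _) (le_max_right _ _)
            _ = 2 ^ r * (max a b) ^ r := ENNReal.mul_rpow_of_nonneg _ _ hr.le
            _ ≤ _ := by
              gcongr
              rcases max_cases a b with h | h <;> rw [h.1]
              · exact le_self_add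
              · exact le_add_self
        exact (ENNReal.rpow_le_rpow h1 hr.le).trans (h2 _ _)
    _ = 2 ^ r * (∫⁻ ω, ‖Complex.reCLM (Z ω)‖ₑ ^ r ∂P + ∫⁻ ω, ‖Complex.imCLM (Z ω)‖ₑ ^ r ∂P) := by
        rw [lintegral_const_mul' _ _ (by finiteness), lintegral_add_left' (by fun_prop)]
    _ ≤ 2 ^ r * (A * (∫⁻ ω, ‖Z ω‖ₑ ^ 2 ∂P) ^ (r / 2) +
          A * (∫⁻ ω, ‖Z ω‖ₑ ^ 2 ∂P) ^ (r / 2)) := by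
        rw [hre, him]
        gcongr 2 ^ r * (A * ?_ + A * ?_)
        · exact hle _ Complex.abs_re_le_norm
        · exact hle _ Complex.abs_im_le_norm
    _ = _ := by ring

/-! ### The spectral representation of the covariance -/

theorem lintegral_enorm_sum_sq {X J : Type*} [MeasurableSpace X] {μ : Measure X}
    {f : J → X → ℂ} (hf : ∀ j, MemLp (f j) 2 μ) (s : Finset J) (c : J → ℂ) :
    ∫⁻ x, ‖∑ j ∈ s, c j * f j x‖ₑ ^ 2 ∂μ =
      ENNReal.ofReal (∑ i ∈ s, ∑ j ∈ s, c i * conj (c j) * ∫ x, f i x * conj (f j x) ∂μ).re := by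
  have hprod : ∀ i j, Integrable (fun x => f i x * conj (f j x)) μ := fun i j =>
    (hf i).integrable_mul (hf j).star
  have hexp : ∀ x, (‖∑ j ∈ s, c j * f j x‖ ^ 2 : ℝ) =
      (∑ i ∈ s, ∑ j ∈ s, c i * conj (c j) * (f i x * conj (f j x))).re := by
    intro x
    rw [← Complex.normSq_eq_norm_sq, ← Complex.ofReal_re (Complex.normSq _), ← Complex.mul_conj,
      map_sum, Finset.sum_mul_sum]
    congr 1
    refine Finset.sum_congr rfl fun i _ => Finset.sum_congr rfl fun j _ => ?_
    rw [map_mul]; ring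
  have hint : Integrable (fun x => ∑ i ∈ s, ∑ j ∈ s, c i * conj (c j) * (f i x * conj (f j x))) μ :=
    integrable_finsetSum _ fun i _ => integrable_finsetSum _ fun j _ => (hprod i j).const_mul _
  have h1 : ∀ x, ‖∑ j ∈ s, c j * f j x‖ₑ ^ 2 = ENNReal.ofReal
      (Complex.reCLM (∑ i ∈ s, ∑ j ∈ s, c i * conj (c j) * (f i x * conj (f j x)))) := by
    intro x
    rw [Complex.reCLM_apply, ← hexp, ENNReal.ofReal_pow (norm_nonneg _), ofReal_norm]
  simp_rw [h1]
  rw [← ofReal_integral_eq_lintegral_ofReal (Complex.reCLM.integrable_comp hint)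
    (Eventually.of_forall fun x => by
      show 0 ≤ Complex.reCLM _
      rw [Complex.reCLM_apply, ← hexp]; positivity),
    ContinuousLinearMap.integral_comp_comm _ hint, integral_finsetSum _ fun i _ =>
      integrable_finsetSum _ fun j _ => (hprod i j).const_mul _]
  simp_rw [integral_finsetSum s fun j _ => (hprod _ j).const_mul _, integral_const_mul]
  rfl

/-- The amplitude of `Ψ_n(t, x)` on the noise at time `τ` and frequency `ξ`. In
`L²([0, T] × ℝ^d)` these functions have the covariances of a regularized convolution as inner
products. -/
def spectralKernel (d : ℕ) (α : ℝ) (n : ℕ) (t : ℝ) (x : Space d) : ℝ × Space d → ℂ :=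
  indicator (Icc (0 : ℝ) t ×ˢ Metric.closedBall (0 : Space d) n) fun z =>
    ((Real.sqrt ((2 * Real.pi) ^ d))⁻¹ : ℝ) *
      (Complex.exp (Complex.I * (t * ‖z.2‖ ^ 2 : ℝ)) / ((1 + ‖z.2‖ ^ 2) ^ (α / 2) : ℝ) *
        Complex.exp (-Complex.I * (inner ℝ z.2 x : ℝ)))

theorem one_add_sq_rpow_mul_self (a b : ℝ) :
    (1 + a ^ 2) ^ (b / 2) * (1 + a ^ 2) ^ (b / 2) = (1 + a ^ 2) ^ b := by
  rw [← Real.rpow_add (by positivity), add_halves]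

theorem continuous_one_add_norm_sq_rpow {E : Type*} [NormedAddCommGroup E] (b : ℝ) :
    Continuous fun ξ : E => (1 + ‖ξ‖ ^ 2) ^ b :=
  (by fun_prop : Continuous fun ξ : E => 1 + ‖ξ‖ ^ 2).rpow_const
    fun ξ => Or.inl (by positivity)

section

variable {d : ℕ} (α : ℝ)

theorem continuous_spectralKernel_aux (t : ℝ) (x : Space d) :
    Continuous fun z : ℝ × Space d =>
      ((Real.sqrt ((2 * Real.pi) ^ d))⁻¹ : ℝ) *
      (Complex.exp (Complex.I * (t * ‖z.2‖ ^ 2 : ℝ)) / ((1 + ‖z.2‖ ^ 2) ^ (α / 2) : ℝ) *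
        Complex.exp (-Complex.I * (inner ℝ z.2 x : ℝ))) := by
  have h1 : Continuous fun z : ℝ × Space d => (((1 + ‖z.2‖ ^ 2) ^ (α / 2) : ℝ) : ℂ) :=
    Complex.continuous_ofReal.comp
      ((continuous_one_add_norm_sq_rpow (α / 2)).comp continuous_snd)
  have h2 : ∀ z : ℝ × Space d, (((1 + ‖z.2‖ ^ 2) ^ (α / 2) : ℝ) : ℂ) ≠ 0 := fun z => by
    exact_mod_cast (Real.rpow_pos_of_pos (by positivity) _).ne'
  refine continuous_const.mul (Continuous.mul (Continuous.div ?_ h1 h2) ?_)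
  · fun_prop
  · exact Complex.continuous_exp.comp (continuous_const.mul
      (Complex.continuous_ofReal.comp (continuous_snd.inner continuous_const)))

theorem measurableSet_timeBall (n : ℕ) (t : ℝ) :
    MeasurableSet (Icc (0 : ℝ) t ×ˢ Metric.closedBall (0 : Space d) n) :=
  measurableSet_Icc.prod Metric.isClosed_closedBall.measurableSet

theorem memLp_spectralKernel (T : ℝ) (n : ℕ) (t : ℝ) (x : Space d) :
    MemLp (spectralKernel d α n t x) 2 (slabMeasure d T) := by
  refine MemLp.restrict _ ?_
  refine (memLp_indicator_iff_restrict (measurableSet_timeBall n t)).2 ?_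
  have hK : IsCompact (Icc (0 : ℝ) t ×ˢ Metric.closedBall (0 : Space d) n) :=
    isCompact_Icc.prod (isCompact_closedBall _ _)
  have : IsFiniteMeasure ((volume : Measure (ℝ × Space d)).restrict
      (Icc (0 : ℝ) t ×ˢ Metric.closedBall (0 : Space d) n)) := ⟨by simpa using hK.measure_lt_top⟩
  obtain ⟨C, hC⟩ := hK.exists_bound_of_continuousOn
    (continuous_spectralKernel_aux α t x).continuousOn
  refine MemLp.of_bound (continuous_spectralKernel_aux α t x).aestronglyMeasurable C ?_
  exact (ae_restrict_iff' (measurableSet_timeBall n t)).2 (Eventually.of_forall hC)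

theorem integral_spectralKernel_mul_conj {T : ℝ} (n m : ℕ) (r t : Icc (0 : ℝ) T)
    (x y : Space d) :
    ∫ z, spectralKernel d α n r x z * conj (spectralKernel d α m t y z) ∂(slabMeasure d T) =
      (min (r : ℝ) t : ℝ) * (1 / (2 * Real.pi : ℂ) ^ d) *
        ∫ ξ in Metric.closedBall (0 : Space d) n ∩ Metric.closedBall 0 m,
          Complex.exp (Complex.I * (((r : ℝ) - t) * ‖ξ‖ ^ 2 : ℝ)) / ((1 + ‖ξ‖ ^ 2) ^ α : ℝ) *
            Complex.exp (-Complex.I * (inner ℝ ξ (x - y) : ℝ)) := by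
  set A := Icc (0 : ℝ) (min (r : ℝ) t) with hA
  set B := Metric.closedBall (0 : Space d) n ∩ Metric.closedBall 0 m with hB
  set G : Space d → ℂ := fun ξ =>
    Complex.exp (Complex.I * (((r : ℝ) - t) * ‖ξ‖ ^ 2 : ℝ)) / ((1 + ‖ξ‖ ^ 2) ^ α : ℝ) *
            Complex.exp (-Complex.I * (inner ℝ ξ (x - y) : ℝ)) with hG
  have hBm : MeasurableSet B := (Metric.isClosed_closedBall.inter
    Metric.isClosed_closedBall).measurableSet
  have hAB : MeasurableSet (A ×ˢ B) := measurableSet_Icc.prod hBm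
  have hpt : ∀ z, spectralKernel d α n r x z * conj (spectralKernel d α m t y z) =
      indicator (A ×ˢ B) (fun z => 1 / (2 * Real.pi : ℂ) ^ d * G z.2) z := by
    intro z
    have hiff : z ∈ A ×ˢ B ↔ z ∈ Icc (0 : ℝ) r ×ˢ Metric.closedBall (0 : Space d) n ∧
        z ∈ Icc (0 : ℝ) t ×ˢ Metric.closedBall (0 : Space d) m := by
      simp only [hA, hB, mem_prod, mem_inter_iff, mem_Icc, le_min_iff]
      tauto
    unfold spectralKernel
    by_cases h1 : z ∈ Icc (0 : ℝ) r ×ˢ Metric.closedBall (0 : Space d) n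
    · by_cases h2 : z ∈ Icc (0 : ℝ) t ×ˢ Metric.closedBall (0 : Space d) m
      · rw [indicator_of_mem h1, indicator_of_mem h2, indicator_of_mem (hiff.2 ⟨h1, h2⟩)]
        have e1 : (1 / (2 * Real.pi : ℂ) ^ d) = ((Real.sqrt ((2 * Real.pi) ^ d))⁻¹ : ℝ) *
            ((Real.sqrt ((2 * Real.pi) ^ d))⁻¹ : ℝ) := by
          rw [← Complex.ofReal_mul, ← mul_inv, Real.mul_self_sqrt (by positivity)]
          push_cast
          rw [one_div]
        have e2 : (((1 + ‖z.2‖ ^ 2) ^ α : ℝ) : ℂ) =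
            ((1 + ‖z.2‖ ^ 2) ^ (α / 2) : ℝ) * ((1 + ‖z.2‖ ^ 2) ^ (α / 2) : ℝ) := by
          rw [← one_add_sq_rpow_mul_self, Complex.ofReal_mul]
        rw [e1, hG]
        simp only [map_mul, map_div₀, Complex.conj_ofReal, ← Complex.exp_conj, map_neg,
          Complex.conj_I, e2]
        have e3 : Complex.exp (Complex.I * (((r : ℝ) - t) * ‖z.2‖ ^ 2 : ℝ)) =
            Complex.exp (Complex.I * ((r : ℝ) * ‖z.2‖ ^ 2 : ℝ)) *
              Complex.exp (-Complex.I * ((t : ℝ) * ‖z.2‖ ^ 2 : ℝ)) := by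
          rw [← Complex.exp_add]; congr 1; push_cast; ring
        have e4 : Complex.exp (-Complex.I * (inner ℝ z.2 (x - y) : ℝ)) =
            Complex.exp (-Complex.I * (inner ℝ z.2 x : ℝ)) *
              Complex.exp (- -Complex.I * (inner ℝ z.2 y : ℝ)) := by
          rw [← Complex.exp_add, inner_sub_right]; congr 1; push_cast; ring
        rw [e3, e4]
        ring
      · rw [indicator_of_notMem h2, indicator_of_notMem fun h => h2 (hiff.1 h).2]; simp
    · rw [indicator_of_notMem h1, indicator_of_notMem fun h => h1 (hiff.1 h).1]; simp
  simp_rw [hpt]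
  have hsub : A ×ˢ B ⊆ Icc (0 : ℝ) T ×ˢ univ := by
    refine prod_mono (Icc_subset_Icc_right ?_) (subset_univ _)
    exact (min_le_left _ _).trans r.2.2
  rw [slabMeasure, integral_indicator hAB, Measure.restrict_restrict hAB,
    inter_eq_left.2 hsub, Measure.volume_eq_prod, ← Measure.prod_restrict,
    integral_fun_snd (f := fun ξ => 1 / (2 * Real.pi : ℂ) ^ d * G ξ), integral_const_mul]
  have hmin : 0 ≤ min (r : ℝ) t := le_min r.2.1 t.2.1
  have hvol : ((volume : Measure ℝ).restrict A).real univ = min (r : ℝ) t := by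
    rw [measureReal_restrict_apply_univ, hA, Real.volume_real_Icc_of_le hmin, sub_zero]
  rw [hvol, Complex.real_smul]
  ring

end

/-- Isometry: the variance of a linear combination of the process is the squared `L²` norm of the
same combination of the spectral kernels. -/
theorem IsRegularizedConvolution.lintegral_enorm_sum_sq {d : ℕ} {T α : ℝ} {Ω : Type*}
    [MeasurableSpace Ω] {P : Measure Ω} {Ψ : ℕ → Icc (0 : ℝ) T → Space d → Ω → ℂ}
    (hΨ : IsRegularizedConvolution α Ψ P) {J : Type*} (s : Finset J) (c : J → ℂ)
    (n : J → ℕ) (t : J → Icc (0 : ℝ) T) (x : J → Space d) :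
    ∫⁻ ω, ‖∑ j ∈ s, c j * Ψ (n j) (t j) (x j) ω‖ₑ ^ 2 ∂P =
      ∫⁻ z, ‖∑ j ∈ s, c j * spectralKernel d α (n j) (t j) (x j) z‖ₑ ^ 2 ∂(slabMeasure d T) := by
  rw [SNLS.lintegral_enorm_sum_sq (f := fun j => Ψ (n j) (t j) (x j))
    fun j => (hΨ.gaussian.hasGaussianLaw_eval (n j, t j, x j)).memLp_two,
    SNLS.lintegral_enorm_sum_sq (f := fun j => spectralKernel d α (n j) (t j) (x j))
      fun j => memLp_spectralKernel α T _ _ _]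
  simp_rw [hΨ.covariance, integral_spectralKernel_mul_conj]

theorem IsRegularizedConvolution.moment_sum_le {d : ℕ} {T α : ℝ} {Ω : Type*}
    [MeasurableSpace Ω] {P : Measure Ω} {Ψ : ℕ → Icc (0 : ℝ) T → Space d → Ω → ℂ}
    (hΨ : IsRegularizedConvolution α Ψ P) {r : ℝ} {C : ℝ≥0∞}
    (hC : ∀ {Z : Ω → ℂ}, HasGaussianLaw Z P → ∫ ω, Z ω ∂P = 0 →
      ∫⁻ ω, ‖Z ω‖ₑ ^ r ∂P ≤ C * (∫⁻ ω, ‖Z ω‖ₑ ^ 2 ∂P) ^ (r / 2))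
    {J : Type*} (s : Finset J) (c : J → ℂ)
    (n : J → ℕ) (t : J → Icc (0 : ℝ) T) (x : J → Space d) :
    ∫⁻ ω, ‖∑ j ∈ s, c j * Ψ (n j) (t j) (x j) ω‖ₑ ^ r ∂P ≤
      C * (∫⁻ z, ‖∑ j ∈ s, c j * spectralKernel d α (n j) (t j) (x j) z‖ₑ ^ 2
        ∂(slabMeasure d T)) ^ (r / 2) := by
  rw [← hΨ.lintegral_enorm_sum_sq]
  refine hC ?_ ?_
  · have h1 := (hΨ.gaussian.comp_right fun j => (n j, t j, x j)).comp_left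
      fun j => (c j • ContinuousLinearMap.id ℝ ℂ : ℂ →L[ℝ] ℂ)
    exact h1.hasGaussianLaw_fun_sum (I := s)
  · rw [integral_finsetSum _ fun j _ =>
      ((hΨ.gaussian.hasGaussianLaw_eval (n j, t j, x j)).integrable.const_mul _)]
    simp_rw [integral_const_mul, hΨ.centered, mul_zero, Finset.sum_const_zero]

/-! ### Time increments of the spectral kernels -/

theorem ennreal_add_sq_le (a b : ℝ≥0∞) : (a + b) ^ 2 ≤ 2 * a ^ 2 + 2 * b ^ 2 := by
  have := ENNReal.rpow_add_le_mul_rpow_add_rpow a b (p := 2) (by norm_num)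
  norm_num at this
  rwa [← mul_add]

theorem norm_cexp_I_mul_sub_le (a b : ℝ) :
    ‖Complex.exp (Complex.I * a) - Complex.exp (Complex.I * b)‖ ≤ |a - b| := by
  have h : Complex.exp (Complex.I * a) - Complex.exp (Complex.I * b) =
      Complex.exp (Complex.I * b) * (Complex.exp (Complex.I * (a - b : ℝ)) - 1) := by
    rw [mul_sub, ← Complex.exp_add, mul_one]
    congr 2; push_cast; ring
  rw [h, norm_mul, Complex.norm_exp_I_mul_ofReal, one_mul]
  exact Real.norm_exp_I_mul_ofReal_sub_one_le

theorem norm_cexp_I_mul_sub_le_two (a b : ℝ) :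
    ‖Complex.exp (Complex.I * a) - Complex.exp (Complex.I * b)‖ ≤ 2 := by
  refine (norm_sub_le _ _).trans (le_of_eq ?_)
  rw [Complex.norm_exp_I_mul_ofReal, Complex.norm_exp_I_mul_ofReal]; norm_num

theorem norm_cexp_I_mul_sub_sq_le {θ : ℝ} (hθ0 : 0 ≤ θ) (hθ : θ ≤ 1) (a b : ℝ) :
    ‖Complex.exp (Complex.I * a) - Complex.exp (Complex.I * b)‖ ^ 2 ≤ 4 * |a - b| ^ θ := by
  have h1 := norm_cexp_I_mul_sub_le a b
  have h2 := norm_cexp_I_mul_sub_le_two a b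
  rcases le_total |a - b| 1 with h | h
  · have h3 : |a - b| ≤ |a - b| ^ θ := by
      conv_lhs => rw [← Real.rpow_one |a - b|]
      exact Real.rpow_le_rpow_of_exponent_ge_of_imp (abs_nonneg _) h hθ (by norm_num)
    have h4 := norm_nonneg (Complex.exp (Complex.I * a) - Complex.exp (Complex.I * b))
    have h5 := abs_nonneg (a - b)
    nlinarith
  · have h3 : 1 ≤ |a - b| ^ θ := Real.one_le_rpow h hθ0
    have h4 := norm_nonneg (Complex.exp (Complex.I * a) - Complex.exp (Complex.I * b))
    nlinarith

/-- The contribution `1_{0 ≤ τ ≤ t} e^{i t a}` of the noise at time `τ` to a mode of time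
frequency `a`. -/
def timeWave (t a τ : ℝ) : ℂ := indicator (Icc 0 t) (fun _ => Complex.exp (Complex.I * (t * a : ℝ))) τ

theorem norm_timeWave_le (t a τ : ℝ) : ‖timeWave t a τ‖ ≤ 1 := by
  refine (norm_indicator_le_norm_self _ _).trans ?_
  rw [Complex.norm_exp_I_mul_ofReal]

theorem measurable_timeWave (t : ℝ) : Measurable fun z : ℝ × ℝ => timeWave t z.1 z.2 := by
  have h : (fun z : ℝ × ℝ => timeWave t z.1 z.2) = indicator (univ ×ˢ Icc 0 t)
      (fun z : ℝ × ℝ => Complex.exp (Complex.I * (t * z.1 : ℝ))) := by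
    ext z
    unfold timeWave
    by_cases hz : z.2 ∈ Icc 0 t
    · rw [indicator_of_mem hz, indicator_of_mem (by simpa using hz)]
    · rw [indicator_of_notMem hz, indicator_of_notMem (by simpa using hz)]
  rw [h]
  exact Measurable.indicator (by fun_prop) (MeasurableSet.univ.prod measurableSet_Icc)

theorem lintegral_timeWave_sub_sq_le {T θ : ℝ} (hT : 0 < T) (hθ0 : 0 ≤ θ) (hθ : θ ≤ 1)
    (r t : Icc (0 : ℝ) T) {a : ℝ} (ha : 0 ≤ a) :
    ∫⁻ τ in Icc 0 T, ‖timeWave t a τ - timeWave r a τ‖ₑ ^ 2 ≤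
      ENNReal.ofReal ((T ^ (1 - θ) + 4 * T) * |(t : ℝ) - r| ^ θ * (1 + a) ^ θ) := by
  wlog hrt : (r : ℝ) ≤ t generalizing r t
  · have := this t r (le_of_not_ge hrt)
    rw [abs_sub_comm]
    refine le_trans (le_of_eq ?_) this
    refine lintegral_congr fun τ => ?_
    rw [← enorm_neg, neg_sub]
  set E := ‖Complex.exp (Complex.I * (t * a : ℝ)) - Complex.exp (Complex.I * (r * a : ℝ))‖ with hE
  have hpt : ∀ τ, ‖timeWave t a τ - timeWave r a τ‖ₑ ^ 2 ≤
      indicator (Ioc (r : ℝ) t) (fun _ => 1) τ + ENNReal.ofReal (E ^ 2) := by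
    intro τ
    unfold timeWave
    by_cases h1 : τ ∈ Icc (0 : ℝ) r
    · have h2 : τ ∈ Icc (0 : ℝ) t := ⟨h1.1, h1.2.trans hrt⟩
      rw [indicator_of_mem h1, indicator_of_mem h2, ENNReal.ofReal_pow (norm_nonneg _),
        ofReal_norm]
      exact le_add_self
    · rw [indicator_of_notMem h1, sub_zero]
      by_cases h2 : τ ∈ Icc (0 : ℝ) t
      · have h3 : τ ∈ Ioc (r : ℝ) t := by
          refine ⟨?_, h2.2⟩
          by_contra h
          exact h1 ⟨h2.1, not_lt.1 h⟩
        rw [indicator_of_mem h2, indicator_of_mem h3, ← ofReal_norm, Complex.norm_exp_I_mul_ofReal]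
        simp
      · rw [indicator_of_notMem h2]; simp
  have hd : |(t : ℝ) - r| = t - r := abs_of_nonneg (by linarith)
  have hd0 : 0 ≤ |(t : ℝ) - r| := abs_nonneg _
  have hdT : |(t : ℝ) - r| ≤ T := by rw [hd]; linarith [r.2.1, t.2.2]
  have h1 : |(t : ℝ) - r| ≤ T ^ (1 - θ) * |(t : ℝ) - r| ^ θ := by
    calc |(t : ℝ) - r| = |(t : ℝ) - r| ^ (1 - θ) * |(t : ℝ) - r| ^ θ := by
          rw [← Real.rpow_add' hd0 (by simp), sub_add_cancel, Real.rpow_one]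
      _ ≤ _ := by gcongr
  have h2 : E ^ 2 ≤ 4 * (|(t : ℝ) - r| ^ θ * (1 + a) ^ θ) := by
    refine (norm_cexp_I_mul_sub_sq_le hθ0 hθ _ _).trans ?_
    rw [← Real.mul_rpow hd0 (by positivity), ← sub_mul, abs_mul, abs_of_nonneg ha]
    gcongr
    linarith
  have h3 : 1 ≤ (1 + a) ^ θ := Real.one_le_rpow (by linarith) hθ0
  calc ∫⁻ τ in Icc 0 T, ‖timeWave t a τ - timeWave r a τ‖ₑ ^ 2
      ≤ ∫⁻ τ in Icc 0 T, (indicator (Ioc (r : ℝ) t) (fun _ => 1) τ + ENNReal.ofReal (E ^ 2)) :=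
        lintegral_mono hpt
    _ ≤ ENNReal.ofReal (t - r) + ENNReal.ofReal (E ^ 2) * ENNReal.ofReal T := by
        rw [lintegral_add_right _ measurable_const, lintegral_const]
        gcongr
        · refine (setLIntegral_le_lintegral _ _).trans ?_
          rw [lintegral_indicator measurableSet_Ioc]
          simp
        · simp
    _ = ENNReal.ofReal (t - r + E ^ 2 * T) := by
        rw [← ENNReal.ofReal_mul (by positivity), ← ENNReal.ofReal_add (by linarith) (by positivity)]
    _ ≤ _ := by
        apply ENNReal.ofReal_le_ofReal
        rw [show (t : ℝ) - r + E ^ 2 * T = |(t : ℝ) - r| + E ^ 2 * T by rw [hd]]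
        have h4 : 0 ≤ |(t : ℝ) - r| ^ θ := by positivity
        have h5 : 0 ≤ T ^ (1 - θ) * |(t : ℝ) - r| ^ θ := by positivity
        nlinarith [mul_le_mul_of_nonneg_right h2 hT.le, mul_le_mul_of_nonneg_left h3 h5]

/-- The increments in `L²([0, T] × ℝ^d)` of the space-time profiles
`(τ, ξ) ↦ 1_{0 ≤ τ ≤ t} e^{i t |ξ|²} G(ξ)`. -/
theorem lintegral_timeWave_mul_sub_sq_le {d : ℕ} {T θ : ℝ} (hT : 0 < T) (hθ0 : 0 ≤ θ)
    (hθ : θ ≤ 1) (r t : Icc (0 : ℝ) T) {G₁ G₂ : Space d → ℂ} (hG₁ : Measurable G₁)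
    (hG₂ : Measurable G₂) :
    ∫⁻ z, ‖timeWave t (‖z.2‖ ^ 2) z.1 * G₁ z.2 - timeWave r (‖z.2‖ ^ 2) z.1 * G₂ z.2‖ₑ ^ 2
        ∂(slabMeasure d T) ≤
      2 * ENNReal.ofReal T * (∫⁻ ξ, ‖G₁ ξ - G₂ ξ‖ₑ ^ 2) +
      2 * ENNReal.ofReal ((T ^ (1 - θ) + 4 * T) * |(t : ℝ) - r| ^ θ) *
        ∫⁻ ξ, ENNReal.ofReal ((1 + ‖ξ‖ ^ 2) ^ θ) * ‖G₂ ξ‖ₑ ^ 2 := by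
  have hw : ∀ t : ℝ, Measurable fun z : ℝ × Space d => timeWave t (‖z.2‖ ^ 2) z.1 := fun t =>
    (measurable_timeWave t).comp (by fun_prop : Measurable fun z : ℝ × Space d => (‖z.2‖ ^ 2, z.1))
  have hmeas : slabMeasure d T = ((volume : Measure ℝ).restrict (Icc 0 T)).prod volume := by
    rw [slabMeasure, Measure.volume_eq_prod, ← Measure.prod_restrict, Measure.restrict_univ]
  calc ∫⁻ z, ‖timeWave t (‖z.2‖ ^ 2) z.1 * G₁ z.2 - timeWave r (‖z.2‖ ^ 2) z.1 * G₂ z.2‖ₑ ^ 2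
        ∂(slabMeasure d T)
      ≤ ∫⁻ z, (2 * ‖G₁ z.2 - G₂ z.2‖ₑ ^ 2 +
          2 * (‖timeWave t (‖z.2‖ ^ 2) z.1 - timeWave r (‖z.2‖ ^ 2) z.1‖ₑ ^ 2 * ‖G₂ z.2‖ₑ ^ 2))
        ∂(slabMeasure d T) := by
        refine lintegral_mono fun z => ?_
        have h1 : timeWave t (‖z.2‖ ^ 2) z.1 * G₁ z.2 - timeWave r (‖z.2‖ ^ 2) z.1 * G₂ z.2 =
            timeWave t (‖z.2‖ ^ 2) z.1 * (G₁ z.2 - G₂ z.2) +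
            (timeWave t (‖z.2‖ ^ 2) z.1 - timeWave r (‖z.2‖ ^ 2) z.1) * G₂ z.2 := by ring
        rw [h1]
        refine (pow_le_pow_left' (enorm_add_le _ _) 2).trans ((ennreal_add_sq_le _ _).trans ?_)
        rw [enorm_mul, enorm_mul, mul_pow, mul_pow]
        gcongr
        have h2 : ‖timeWave t (‖z.2‖ ^ 2) z.1‖ₑ ≤ 1 := by
          rw [← ofReal_norm, ← ENNReal.ofReal_one]
          exact ENNReal.ofReal_le_ofReal (norm_timeWave_le _ _ _)
        calc _ ≤ 1 ^ 2 * ‖G₁ z.2 - G₂ z.2‖ₑ ^ 2 := by gcongr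
          _ = _ := by simp
    _ = 2 * (∫⁻ z, ‖G₁ z.2 - G₂ z.2‖ₑ ^ 2 ∂(slabMeasure d T)) +
        2 * ∫⁻ z, ‖timeWave t (‖z.2‖ ^ 2) z.1 - timeWave r (‖z.2‖ ^ 2) z.1‖ₑ ^ 2 * ‖G₂ z.2‖ₑ ^ 2
          ∂(slabMeasure d T) := by
        rw [lintegral_add_left (by fun_prop), lintegral_const_mul _ (by fun_prop),
          lintegral_const_mul]
        exact (((hw t).sub (hw r)).enorm.pow_const 2).mul (by fun_prop)
    _ ≤ 2 * (ENNReal.ofReal T * ∫⁻ ξ, ‖G₁ ξ - G₂ ξ‖ₑ ^ 2) +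
        2 * ∫⁻ ξ, ENNReal.ofReal ((T ^ (1 - θ) + 4 * T) * |(t : ℝ) - r| ^ θ) *
          (ENNReal.ofReal ((1 + ‖ξ‖ ^ 2) ^ θ) * ‖G₂ ξ‖ₑ ^ 2) := by
        gcongr ?_ + ?_
        · rw [hmeas, lintegral_prod _ (by fun_prop)]
          simp [mul_comm]
        · gcongr 2 * ?_
          rw [hmeas, lintegral_prod_symm]
          swap
          · exact ((((hw t).sub (hw r)).enorm.pow_const 2).mul (by fun_prop)).aemeasurable
          refine lintegral_mono fun ξ => ?_
          dsimp only
          rw [lintegral_mul_const' _ _ (by finiteness), ← mul_assoc,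
            ← ENNReal.ofReal_mul (by positivity)]
          gcongr
          exact lintegral_timeWave_sub_sq_le hT hθ0 hθ r t (by positivity)
    _ = _ := by
        rw [lintegral_const_mul' _ _ ENNReal.ofReal_ne_top]
        ring

theorem two_mul_ofReal_mul_ofReal {a b : ℝ} (ha : 0 ≤ a) :
    2 * ENNReal.ofReal a * ENNReal.ofReal b = ENNReal.ofReal (2 * a * b) := by
  rw [ENNReal.ofReal_mul (by positivity), ENNReal.ofReal_mul (by norm_num), ENNReal.ofReal_ofNat]

/-- The frequency profile `(2π)^(-d/2) 1_{|ξ| ≤ n} ⟨ξ⟩^(-α)`. -/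
def freqProfile (d : ℕ) (α : ℝ) (n : ℕ) (ξ : Space d) : ℝ :=
  indicator (Metric.closedBall (0 : Space d) n) (fun ξ =>
    (Real.sqrt ((2 * Real.pi) ^ d))⁻¹ * (1 + ‖ξ‖ ^ 2) ^ (-(α / 2))) ξ

section

variable {d : ℕ} {α : ℝ}

theorem spectralKernel_eq (n : ℕ) (t : ℝ) (x : Space d) (z : ℝ × Space d) :
    spectralKernel d α n t x z = timeWave t (‖z.2‖ ^ 2) z.1 *
      (freqProfile d α n z.2 * Complex.exp (-Complex.I * (inner ℝ z.2 x : ℝ))) := by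
  unfold spectralKernel timeWave freqProfile
  by_cases h1 : z.1 ∈ Icc 0 t
  · by_cases h2 : z.2 ∈ Metric.closedBall (0 : Space d) n
    · rw [indicator_of_mem h1, indicator_of_mem h2, indicator_of_mem (mk_mem_prod h1 h2),
        Real.rpow_neg (by positivity)]
      push_cast
      ring
    · rw [indicator_of_notMem h2, indicator_of_notMem fun h => h2 h.2]; simp
  · rw [indicator_of_notMem h1, indicator_of_notMem fun h => h1 h.1]; simp

theorem measurable_freqProfile (n : ℕ) : Measurable (freqProfile d α n) :=
  ((continuous_one_add_norm_sq_rpow _).measurable.const_mul _).indicator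
    Metric.isClosed_closedBall.measurableSet

theorem freqProfile_nonneg (n : ℕ) (ξ : Space d) : 0 ≤ freqProfile d α n ξ :=
  indicator_nonneg (fun _ _ => by positivity) _

theorem freqProfile_le (n : ℕ) (ξ : Space d) : freqProfile d α n ξ ≤
    (Real.sqrt ((2 * Real.pi) ^ d))⁻¹ * (1 + ‖ξ‖ ^ 2) ^ (-(α / 2)) :=
  indicator_le_self' (fun _ _ => by positivity) _

/-- For fixed `n`, the field `Ψ_n` is `1/2`-Hölder continuous in time and Lipschitz
continuous in space, in `L²`. -/
theorem lintegral_spectralKernel_sub_sq_le {T : ℝ} (hT : 0 < T) (hα : 0 < α) (n : ℕ) :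
    ∃ K : ℝ, 0 ≤ K ∧ ∀ (t r : Icc (0 : ℝ) T) (x y : Space d),
      ∫⁻ z, ‖spectralKernel d α n t x z - spectralKernel d α n r y z‖ₑ ^ 2 ∂(slabMeasure d T) ≤
        ENNReal.ofReal (K * (|(t : ℝ) - r| + ‖x - y‖ ^ 2)) := by
  set c := (Real.sqrt ((2 * Real.pi) ^ d))⁻¹ with hc
  have hc0 : 0 ≤ c := by positivity
  set v := (volume : Measure (Space d)).real (Metric.closedBall (0 : Space d) n) with hv
  have hv' : volume (Metric.closedBall (0 : Space d) n) = ENNReal.ofReal v := by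
    rw [hv, Measure.real, ENNReal.ofReal_toReal (measure_closedBall_lt_top).ne]
  have hprof : ∀ ξ : Space d, freqProfile d α n ξ ≤ c := by
    intro ξ
    refine (freqProfile_le n ξ).trans (mul_le_of_le_one_right hc0 ?_)
    exact Real.rpow_le_one_of_one_le_of_nonpos (by nlinarith [norm_nonneg ξ]) (by linarith)
  have hball : ∀ {f : Space d → ℝ≥0∞} {A : ℝ}, (∀ ξ, ‖ξ‖ ≤ n → f ξ ≤ ENNReal.ofReal A) →
      (∀ ξ, ¬ ‖ξ‖ ≤ n → f ξ = 0) → 0 ≤ A → ∫⁻ ξ, f ξ ≤ ENNReal.ofReal (A * v) := by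
    intro f A h1 h2 hA
    calc ∫⁻ ξ, f ξ ≤ ∫⁻ ξ, indicator (Metric.closedBall (0 : Space d) n)
            (fun _ => ENNReal.ofReal A) ξ := by
          refine lintegral_mono fun ξ => ?_
          by_cases h : ‖ξ‖ ≤ n
          · rw [indicator_of_mem (by simpa using h)]; exact h1 ξ h
          · rw [indicator_of_notMem (by simpa using h), h2 ξ h]
      _ = _ := by
          rw [lintegral_indicator Metric.isClosed_closedBall.measurableSet, setLIntegral_const, hv',
            ENNReal.ofReal_mul hA]
  have hzero : ∀ ξ : Space d, ¬ ‖ξ‖ ≤ n → freqProfile d α n ξ = 0 := fun ξ h =>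
    indicator_of_notMem (by simpa using h) _
  have hGm : ∀ x : Space d, Measurable fun ξ : Space d =>
      (freqProfile d α n ξ : ℂ) * Complex.exp (-Complex.I * (inner ℝ ξ x : ℝ)) := fun x =>
    (Complex.measurable_ofReal.comp (measurable_freqProfile n)).mul
      (by fun_prop : Continuous fun ξ : Space d =>
        Complex.exp (-Complex.I * (inner ℝ ξ x : ℝ))).measurable
  refine ⟨2 * T * (c ^ 2 * n ^ 2 * v) + 2 * (1 + 4 * T) * ((1 + n ^ 2) * c ^ 2 * v),
    by positivity, fun t r x y => ?_⟩
  simp_rw [spectralKernel_eq]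
  refine (lintegral_timeWave_mul_sub_sq_le hT zero_le_one le_rfl r t (hGm x) (hGm y)).trans ?_
  have e1 : ∫⁻ ξ, ‖(freqProfile d α n ξ : ℂ) * Complex.exp (-Complex.I * (inner ℝ ξ x : ℝ)) -
      (freqProfile d α n ξ : ℂ) * Complex.exp (-Complex.I * (inner ℝ ξ y : ℝ))‖ₑ ^ 2 ≤
      ENNReal.ofReal ((c * (n * ‖x - y‖)) ^ 2 * v) := by
    refine hball (fun ξ hξ => ?_) (fun ξ hξ => by rw [hzero ξ hξ]; simp) (by positivity)
    rw [← ofReal_norm, ← ENNReal.ofReal_pow (norm_nonneg _), ← mul_sub, norm_mul,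
      Complex.norm_real, Real.norm_of_nonneg (freqProfile_nonneg n ξ)]
    have h1 : ‖Complex.exp (-Complex.I * (inner ℝ ξ x : ℝ)) -
        Complex.exp (-Complex.I * (inner ℝ ξ y : ℝ))‖ ≤ n * ‖x - y‖ := by
      have := norm_cexp_I_mul_sub_le (-inner ℝ ξ x) (-inner ℝ ξ y)
      push_cast at this
      simp only [mul_neg, ← neg_mul] at this
      refine this.trans ?_
      rw [neg_sub_neg, ← inner_sub_right, norm_sub_rev]
      exact (abs_real_inner_le_norm _ _).trans (by gcongr)
    exact ENNReal.ofReal_le_ofReal (pow_le_pow_left₀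
      (mul_nonneg (freqProfile_nonneg n ξ) (norm_nonneg _))
      (mul_le_mul (hprof ξ) h1 (norm_nonneg _) hc0) 2)
  have e2 : ∫⁻ ξ, ENNReal.ofReal ((1 + ‖ξ‖ ^ 2) ^ (1 : ℝ)) *
      ‖(freqProfile d α n ξ : ℂ) * Complex.exp (-Complex.I * (inner ℝ ξ y : ℝ))‖ₑ ^ 2 ≤
      ENNReal.ofReal ((1 + n ^ 2) * c ^ 2 * v) := by
    refine hball (fun ξ hξ => ?_) (fun ξ hξ => by rw [hzero ξ hξ]; simp) (by positivity)
    have h1 : ‖Complex.exp (-Complex.I * (inner ℝ ξ y : ℝ))‖ = 1 := by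
      have := Complex.norm_exp_I_mul_ofReal (-inner ℝ ξ y)
      push_cast at this
      simpa only [mul_neg, ← neg_mul] using this
    rw [← ofReal_norm, ← ENNReal.ofReal_pow (norm_nonneg _), norm_mul, h1, mul_one,
      Complex.norm_real, Real.norm_of_nonneg (freqProfile_nonneg n ξ),
      ← ENNReal.ofReal_mul (by positivity), Real.rpow_one]
    gcongr
    · exact freqProfile_nonneg n ξ
    · exact hprof ξ
  calc _ ≤ 2 * ENNReal.ofReal T * ENNReal.ofReal ((c * (n * ‖x - y‖)) ^ 2 * v) +
        2 * ENNReal.ofReal ((T ^ (1 - 1 : ℝ) + 4 * T) * |(t : ℝ) - r| ^ (1 : ℝ)) *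
          ENNReal.ofReal ((1 + n ^ 2) * c ^ 2 * v) := by gcongr
    _ = ENNReal.ofReal (2 * T * ((c * (n * ‖x - y‖)) ^ 2 * v) +
          2 * ((1 + 4 * T) * |(t : ℝ) - r|) * ((1 + n ^ 2) * c ^ 2 * v)) := by
        rw [sub_self, Real.rpow_zero, Real.rpow_one, ENNReal.ofReal_add (by positivity)
          (by positivity), two_mul_ofReal_mul_ofReal hT.le,
          two_mul_ofReal_mul_ofReal (by positivity)]
    _ ≤ _ := by
        apply ENNReal.ofReal_le_ofReal
        have h1 : 0 ≤ 2 * T * (c ^ 2 * n ^ 2 * v) * |(t : ℝ) - r| := by positivity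
        have h2 : 0 ≤ 2 * (1 + 4 * T) * ((1 + n ^ 2) * c ^ 2 * v) * ‖x - y‖ ^ 2 := by positivity
        nlinarith

end

/-! ### Continuous modifications -/

section

variable {d : ℕ} {T α : ℝ} {Ω : Type*} [MeasurableSpace Ω] {P : Measure Ω}
  {Ψ : ℕ → Icc (0 : ℝ) T → Space d → Ω → ℂ}

/-- The coordinates of a point of `[0, T] × ℝ^d`. -/
def coords (z : Icc (0 : ℝ) T × Space d) : Option (Fin d) → ℝ := fun i => i.elim (z.1 : ℝ) fun j => z.2 j

theorem continuous_coords : Continuous (coords (d := d) (T := T)) := by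
  refine continuous_pi fun i => ?_
  cases i with
  | none => exact continuous_subtype_val.comp continuous_fst
  | some j => exact (EuclideanSpace.proj (𝕜 := ℝ) j).continuous.comp continuous_snd

theorem abs_sub_le_dist_coords (u v : Icc (0 : ℝ) T × Space d) :
    |(u.1 : ℝ) - v.1| ≤ dist (coords u) (coords v) :=
  dist_le_pi_dist (coords u) (coords v) none

theorem norm_sub_sq_le_dist_coords (u v : Icc (0 : ℝ) T × Space d) :
    ‖u.2 - v.2‖ ^ 2 ≤ d * dist (coords u) (coords v) ^ 2 := by
  rw [EuclideanSpace.norm_sq_eq]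
  calc ∑ i, ‖(u.2 - v.2) i‖ ^ 2 ≤ ∑ _i : Fin d, dist (coords u) (coords v) ^ 2 := by
        refine Finset.sum_le_sum fun i _ => ?_
        exact pow_le_pow_left₀ (norm_nonneg _) (dist_le_pi_dist (coords u) (coords v) (some i)) 2
    _ = _ := by simp

/-- On bounded sets, a regularized stochastic convolution is almost surely uniformly continuous
along any countable set. -/
theorem IsRegularizedConvolution.uniformly_continuous_on_countable (hT : 0 < T) (hα : 0 < α)
    (hΨ : IsRegularizedConvolution α Ψ P) (n R : ℕ)
    {D : Set (Icc (0 : ℝ) T × Space d)} (hD : D.Countable) :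
    ∀ᵐ ω ∂P, ∀ ε > 0, ∃ η > 0, ∀ u ∈ D, ∀ v ∈ D, ‖u.2‖ ≤ R → ‖v.2‖ ≤ R →
      dist (coords u) (coords v) < η → edist (Ψ n u.1 u.2 ω) (Ψ n v.1 v.2 ω) ≤ ε := by
  obtain ⟨K, hK0, hK⟩ := lintegral_spectralKernel_sub_sq_le (d := d) hT hα n
  set N := Fintype.card (Option (Fin d)) with hN
  set q : ℝ := 4 * (N + 1) with hq
  have hq0 : 0 < q := by positivity
  obtain ⟨C, hCt, hC⟩ := exists_gaussian_moment_bound q hq0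
  let U := {z : Icc (0 : ℝ) T × Space d // ‖z.2‖ ≤ R}
  let e : U → Option (Fin d) → ℝ := fun u => coords u.1
  have he : ∀ u i, |e u i| ≤ T + R := by
    intro u i
    cases i with
    | none =>
      have h := u.1.1.2
      show |(u.1.1 : ℝ)| ≤ T + R
      rw [abs_of_nonneg h.1]
      linarith [h.2, Nat.cast_nonneg (α := ℝ) R]
    | some j =>
      have h : ‖u.1.2 j‖ ≤ ‖u.1.2‖ := PiLp.norm_apply_le _ _
      show ‖u.1.2 j‖ ≤ T + R
      linarith [u.2]
  have hdist : ∀ u v : U, dist (e u) (e v) ≤ 2 * (T + R) := by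
    intro u v
    refine (dist_pi_le_iff (by positivity)).2 fun i => ?_
    rw [Real.dist_eq]
    have h1 := abs_le.1 (he u i)
    have h2 := abs_le.1 (he v i)
    rw [abs_le]; constructor <;> linarith
  set K' := K * (1 + d * (2 * (T + R))) with hK'
  have hmom : ∀ u v : U, ∫⁻ ω, edist (Ψ n u.1.1 u.1.2 ω) (Ψ n v.1.1 v.1.2 ω) ^ q ∂P ≤
      (C * ENNReal.ofReal K' ^ (q / 2)) * ENNReal.ofReal (dist (e u) (e v)) ^ (q / 2) := by
    intro u v
    have h1 := hΨ.moment_sum_le (fun hZ hZ0 => hC hZ hZ0) (Finset.univ : Finset Bool)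
      (fun b => if b then 1 else -1) (fun _ => n) (fun b => if b then u.1.1 else v.1.1)
      (fun b => if b then u.1.2 else v.1.2)
    simp only [Fintype.sum_bool, if_true, Bool.false_eq_true, if_false, one_mul, neg_one_mul,
      ← sub_eq_add_neg] at h1
    simp only [edist_eq_enorm_sub]
    refine h1.trans ?_
    rw [mul_assoc, ← ENNReal.mul_rpow_of_nonneg _ _ (by positivity),
      ← ENNReal.ofReal_mul (by positivity)]
    gcongr
    refine (hK _ _ _ _).trans (ENNReal.ofReal_le_ofReal ?_)
    have h2 := abs_sub_le_dist_coords u.1 v.1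
    have h3 := norm_sub_sq_le_dist_coords u.1 v.1
    have h4 : dist (coords u.1) (coords v.1) ≤ 2 * (T + R) := hdist u v
    have h5 : (0 : ℝ) ≤ dist (coords u.1) (coords v.1) := dist_nonneg
    rw [hK', mul_assoc]
    refine mul_le_mul_of_nonneg_left ?_ hK0
    calc _ ≤ dist (coords u.1) (coords v.1) + d * dist (coords u.1) (coords v.1) ^ 2 :=
          add_le_add h2 h3
      _ ≤ dist (coords u.1) (coords v.1) +
          d * (2 * (T + R) * dist (coords u.1) (coords v.1)) := by
          gcongr
          rw [sq]
          gcongr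
      _ = (1 + d * (2 * (T + R))) * dist (coords u.1) (coords v.1) := by ring
  have hmain := kolmogorov_criterion (P := P) e he
    (fun u v ω => edist (Ψ n u.1.1 u.1.2 ω) (Ψ n v.1.1 v.1.2 ω))
    (fun _ _ _ => edist_comm _ _) (fun _ _ _ _ => edist_triangle _ _ _)
    (fun u v => (hΨ.gaussian.aemeasurable (n, u.1.1, u.1.2)).edist
      (hΨ.gaussian.aemeasurable (n, v.1.1, v.1.2))) hq0
    (β := q / 2) (by rw [← hN, hq]; linarith) (M := C * ENNReal.ofReal K' ^ (q / 2))
    (by finiteness) hmom (D := Subtype.val ⁻¹' D) (hD.preimage Subtype.val_injective)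
  filter_upwards [hmain] with ω hω ε hε
  obtain ⟨η, hη, h⟩ := hω ε hε
  exact ⟨η, hη, fun u hu v hv huR hvR huv => h ⟨u, huR⟩ hu ⟨v, hvR⟩ hv huv⟩

theorem eventually_norm_le_and_dist_lt (z : Icc (0 : ℝ) T × Space d) {R : ℕ} (hR : ‖z.2‖ + 1 ≤ R)
    {η : ℝ} (hη : 0 < η) :
    ∀ᶠ u in 𝓝 z, ‖u.2‖ ≤ R ∧ dist (coords u) (coords z) < η := by
  have h1 : ∀ᶠ u in 𝓝 z, ‖u.2‖ < ‖z.2‖ + 1 :=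
    (continuous_norm.comp continuous_snd).continuousAt.eventually (gt_mem_nhds (by simp))
  have h2 : ∀ᶠ u in 𝓝 z, dist (coords u) (coords z) < η :=
    continuous_coords.continuousAt.eventually (Metric.ball_mem_nhds _ hη)
  filter_upwards [h1, h2] with u hu1 hu2
  exact ⟨by linarith, hu2⟩

/-- The continuous modification is the extension by continuity from a countable dense set. -/
theorem IsRegularizedConvolution.exists_continuousModification (hT : 0 < T) (hα : 0 < α)
    (hΨ : IsRegularizedConvolution α Ψ P) : ∃ Φ, IsContinuousModification Φ Ψ P := by
  obtain ⟨D, hDc, hDd⟩ := TopologicalSpace.exists_countable_dense (Icc (0 : ℝ) T × Space d)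
  refine ⟨fun n t x ω => extendFrom D (fun u => Ψ n u.1 u.2 ω) (t, x), fun n t x => ?_, ?_⟩
  · obtain ⟨R, hR⟩ := exists_nat_ge (‖x‖ + 1)
    filter_upwards [hΨ.uniformly_continuous_on_countable hT hα n R
      (hDc.insert (t, x))] with ω hω
    refine extendFrom_eq (hDd _) ?_
    rw [EMetric.tendsto_nhds]
    intro ε hε
    obtain ⟨ε', hε', hεε'⟩ := exists_between hε
    obtain ⟨η, hη, h⟩ := hω ε' hε'
    filter_upwards [nhdsWithin_le_nhds (eventually_norm_le_and_dist_lt (t, x) hR hη),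
      self_mem_nhdsWithin] with u hu huD
    exact lt_of_le_of_lt (h u (mem_insert_of_mem _ huD) (t, x) (mem_insert _ _) hu.1
      (by dsimp only; linarith) hu.2) hεε'
  · have h := ae_all_iff.2 fun n => ae_all_iff.2 fun R =>
      hΨ.uniformly_continuous_on_countable hT hα n R hDc
    filter_upwards [h] with ω hω n
    refine continuous_extendFrom hDd fun z => ?_
    obtain ⟨R, hR⟩ := exists_nat_ge (‖z.2‖ + 1)
    have : (𝓝[D] z).NeBot := mem_closure_iff_nhdsWithin_neBot.1 (hDd z)
    refine cauchy_map_iff_exists_tendsto.1 (EMetric.cauchy_iff.2 ⟨NeBot.ne inferInstance, fun ε hε => ?_⟩)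
    obtain ⟨ε', hε', hεε'⟩ := exists_between hε
    obtain ⟨η, hη, h⟩ := hω n R ε' hε'
    have hev := nhdsWithin_le_nhds (s := D)
      (eventually_norm_le_and_dist_lt z hR (half_pos hη))
    refine ⟨_, image_mem_map (inter_mem hev self_mem_nhdsWithin), ?_⟩
    rintro _ ⟨u, ⟨⟨huR, hu⟩, huD⟩, rfl⟩ _ ⟨v, ⟨⟨hvR, hv⟩, hvD⟩, rfl⟩
    refine lt_of_le_of_lt (h u huD v hvD huR hvR ?_) hεε'
    linarith [dist_triangle_right (coords u) (coords v) (coords z)]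

/-- A modification with almost surely continuous paths coincides almost surely with a process all
of whose paths are continuous and all of whose values are measurable. -/
theorem IsContinuousModification.exists_continuous_measurable
    (hΨ : ∀ n t x, AEMeasurable (Ψ n t x) P)
    {Φ : ℕ → Icc (0 : ℝ) T → Space d → Ω → ℂ} (hΦ : IsContinuousModification Φ Ψ P) :
    ∃ Φ' : ℕ → Icc (0 : ℝ) T → Space d → Ω → ℂ,
      (∀ᵐ ω ∂P, ∀ n t x, Φ' n t x ω = Φ n t x ω) ∧
      (∀ n ω, Continuous fun z : Icc (0 : ℝ) T × Space d => Φ' n z.1 z.2 ω) ∧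
      (∀ n t x, Measurable (Φ' n t x)) := by
  classical
  obtain ⟨D, hDc, hDd⟩ := TopologicalSpace.exists_countable_dense (Icc (0 : ℝ) T × Space d)
  have hm : ∀ n t x, AEMeasurable (Φ n t x) P := fun n t x => (hΨ n t x).congr (hΦ.1 n t x).symm
  have h1 : ∀ᵐ ω ∂P, ∀ n, ∀ z ∈ D, Φ n z.1 z.2 ω = (hm n z.1 z.2).mk _ ω :=
    ae_all_iff.2 fun n => (ae_ball_iff hDc).2 fun z _ => (hm n z.1 z.2).ae_eq_mk
  obtain ⟨A, hA, hAm, hA1⟩ := (hΦ.2.and h1).exists_measurable_mem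
  have hcont : ∀ n ω, Continuous fun z : Icc (0 : ℝ) T × Space d =>
      if ω ∈ A then Φ n z.1 z.2 ω else 0 := by
    intro n ω
    by_cases hω : ω ∈ A
    · simpa only [if_pos hω] using (hA1 ω hω).1 n
    · simpa only [if_neg hω] using continuous_const
  refine ⟨fun n t x ω => if ω ∈ A then Φ n t x ω else 0, ?_, hcont, ?_⟩
  · filter_upwards [hA] with ω hω n t x
    rw [if_pos hω]
  · intro n t x
    have hD : ∀ z ∈ D, Measurable fun ω => if ω ∈ A then Φ n z.1 z.2 ω else 0 := by
      intro z hz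
      have h2 : (fun ω => if ω ∈ A then Φ n z.1 z.2 ω else 0) =
          fun ω => if ω ∈ A then (hm n z.1 z.2).mk _ ω else 0 := by
        ext ω
        by_cases hω : ω ∈ A
        · rw [if_pos hω, if_pos hω, (hA1 ω hω).2 n z hz]
        · rw [if_neg hω, if_neg hω]
      rw [h2]
      exact Measurable.ite hAm (hm n z.1 z.2).measurable_mk measurable_const
    obtain ⟨w, hwD, hw⟩ := mem_closure_iff_seq_limit.1 (hDd (t, x))
    refine measurable_of_tendsto_metrizable (fun k => hD (w k) (hwD k)) ?_
    rw [tendsto_pi_nhds]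
    exact fun ω => ((hcont n ω).tendsto (t, x)).comp hw

end

/-! ### Moments of integrals of the process -/

theorem integral_mul_simpleFunc {X Y : Type*} [MeasurableSpace X] {μ : Measure X}
    {k : X → ℂ} (hk : Integrable k μ) (a : SimpleFunc X Y) (G : Y → ℂ) :
    ∫ x, k x * G (a x) ∂μ = ∑ v ∈ a.range, (∫ x in a ⁻¹' {v}, k x ∂μ) * G v := by
  classical
  have h1 : ∀ x, k x * G (a x) = ∑ v ∈ a.range, indicator (a ⁻¹' {v}) k x * G v := by
    intro x
    rw [Finset.sum_eq_single (a x)]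
    · rw [indicator_of_mem (by simp)]
    · intro v _ hv
      rw [indicator_of_notMem (by simpa using hv.symm), zero_mul]
    · intro h
      exact (h (a.mem_range_self x)).elim
  simp_rw [h1]
  rw [integral_finsetSum _ fun v _ => (hk.indicator (a.measurableSet_fiber v)).mul_const _]
  refine Finset.sum_congr rfl fun v _ => ?_
  rw [integral_mul_const, integral_indicator (a.measurableSet_fiber v)]

theorem tendsto_integral_mul_approxOn {d : ℕ} {K : Set (Space d)} (hK : IsCompact K)
    {y₀ : Space d} (hy₀ : y₀ ∈ K) {k : Space d → ℂ} (hk : Integrable k)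
    (hk0 : ∀ x ∉ K, k x = 0) {G : Space d → ℂ} (hG : Continuous G) :
    Tendsto (fun N => ∫ x, k x * G (SimpleFunc.approxOn id measurable_id K y₀ hy₀ N x)) atTop
      (𝓝 (∫ x, k x * G x)) := by
  obtain ⟨C, hC⟩ := hK.exists_bound_of_continuousOn hG.continuousOn
  refine tendsto_integral_of_dominated_convergence (fun x => ‖k x‖ * C) (fun N => ?_)
    (hk.norm.mul_const C) (fun N => Eventually.of_forall fun x => ?_)
    (Eventually.of_forall fun x => ?_)
  · exact hk.aestronglyMeasurable.mul
      (hG.measurable.comp (SimpleFunc.measurable _)).aestronglyMeasurable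
  · rw [norm_mul]
    exact mul_le_mul_of_nonneg_left (hC _ (SimpleFunc.approxOn_mem _ hy₀ N x)) (norm_nonneg _)
  · by_cases hx : x ∈ K
    · have h := SimpleFunc.tendsto_approxOn measurable_id hy₀ (x := x) (subset_closure hx)
      exact ((hG.tendsto x).comp h).const_mul _
    · simp only [hk0 x hx, zero_mul]
      exact tendsto_const_nhds

section

variable {d : ℕ} {T α : ℝ} {Ω : Type*} [MeasurableSpace Ω] {P : Measure Ω}
  {Ψ : ℕ → Icc (0 : ℝ) T → Space d → Ω → ℂ}

theorem IsRegularizedConvolution.congr (hΨ : IsRegularizedConvolution α Ψ P)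
    {Φ : ℕ → Icc (0 : ℝ) T → Space d → Ω → ℂ} (h : ∀ n t x, Φ n t x =ᵐ[P] Ψ n t x) :
    IsRegularizedConvolution α Φ P where
  gaussian := hΨ.gaussian.congr fun i => (h i.1 i.2.1 i.2.2).symm
  centered n t x := by rw [integral_congr_ae (h n t x), hΨ.centered]
  covariance n m s t x y := by
    rw [← hΨ.covariance]
    refine integral_congr_ae ?_
    filter_upwards [h n s x, h m t y] with ω h1 h2
    rw [h1, h2]
  relation n m s t x y := by
    rw [← hΨ.relation]
    refine integral_congr_ae ?_
    filter_upwards [h n s x, h m t y] with ω h1 h2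
    rw [h1, h2]

theorem continuous_spectralKernel (n : ℕ) (t : ℝ) (z : ℝ × Space d) :
    Continuous fun x => spectralKernel d α n t x z := by
  simp_rw [spectralKernel_eq]
  fun_prop

theorem norm_spectralKernel (n : ℕ) (t : ℝ) (x : Space d) (z : ℝ × Space d) :
    ‖spectralKernel d α n t x z‖ = ‖spectralKernel d α n t 0 z‖ := by
  have h1 : ∀ a : ℝ, ‖Complex.exp (-Complex.I * (a : ℝ))‖ = 1 := by
    intro a
    have := Complex.norm_exp_I_mul_ofReal (-a)
    push_cast at this
    simpa only [mul_neg, ← neg_mul] using this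
  rw [spectralKernel_eq, spectralKernel_eq, norm_mul, norm_mul, norm_mul, norm_mul, h1, h1]

theorem measurable_spectralKernel (n : ℕ) (t : ℝ) (x : Space d) :
    Measurable (spectralKernel d α n t x) :=
  (continuous_spectralKernel_aux α t x).measurable.indicator (measurableSet_timeBall n t)

theorem enorm_integral_mul_spectralKernel_le (n : ℕ) (t : ℝ) (z : ℝ × Space d)
    (k : Space d → ℂ) (a : Space d → Space d) :
    ‖∫ x, k x * spectralKernel d α n t (a x) z‖ₑ ≤
      (∫⁻ x, ‖k x‖ₑ) * ‖spectralKernel d α n t 0 z‖ₑ := by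
  refine (enorm_integral_le_lintegral_enorm _).trans ?_
  rw [← lintegral_mul_const' _ _ enorm_ne_top]
  refine lintegral_mono fun x => ?_
  rw [enorm_mul, ← ofReal_norm (spectralKernel d α n t (a x) z), norm_spectralKernel, ofReal_norm]

/-- The moments of a difference of integrals of the process are controlled by the `L²` norm of the
same combination of the spectral kernels: the bound passes from finite sums to integrals by
Fatou's lemma. -/
theorem IsRegularizedConvolution.moment_integral_sub_le (hΨ : IsRegularizedConvolution α Ψ P)
    (hcont : ∀ n ω, Continuous fun z : Icc (0 : ℝ) T × Space d => Ψ n z.1 z.2 ω)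
    (hmeas : ∀ n t x, Measurable (Ψ n t x)) {q : ℝ} (hq : 0 < q) {C : ℝ≥0∞} (hCt : C ≠ ∞)
    (hC : ∀ {Z : Ω → ℂ}, HasGaussianLaw Z P → ∫ ω, Z ω ∂P = 0 →
      ∫⁻ ω, ‖Z ω‖ₑ ^ q ∂P ≤ C * (∫⁻ ω, ‖Z ω‖ₑ ^ 2 ∂P) ^ (q / 2))
    {K : Set (Space d)} (hK : IsCompact K) {k₁ k₂ : Space d → ℂ} (hk₁ : Integrable k₁)
    (hk₂ : Integrable k₂) (hk₁0 : ∀ x ∉ K, k₁ x = 0) (hk₂0 : ∀ x ∉ K, k₂ x = 0)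
    (n m : ℕ) (t r : Icc (0 : ℝ) T) :
    ∫⁻ ω, ‖(∫ x, k₁ x * Ψ n t x ω) - ∫ x, k₂ x * Ψ m r x ω‖ₑ ^ q ∂P ≤
      C * (∫⁻ z, ‖(∫ x, k₁ x * spectralKernel d α n t x z) -
        ∫ x, k₂ x * spectralKernel d α m r x z‖ₑ ^ 2 ∂(slabMeasure d T)) ^ (q / 2) := by
  classical
  rcases K.eq_empty_or_nonempty with hKe | ⟨y₀, hy₀⟩
  · have h1 : k₁ = 0 := funext fun x => hk₁0 x (by simp [hKe])
    have h2 : k₂ = 0 := funext fun x => hk₂0 x (by simp [hKe])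
    simp [h1, h2, hq]
  let a : ℕ → SimpleFunc (Space d) (Space d) := SimpleFunc.approxOn id measurable_id K y₀ hy₀
  let Z : ℕ → Ω → ℂ := fun N ω =>
    (∫ x, k₁ x * Ψ n t (a N x) ω) - ∫ x, k₂ x * Ψ m r (a N x) ω
  let H : ℕ → ℝ × Space d → ℂ := fun N z =>
    (∫ x, k₁ x * spectralKernel d α n t (a N x) z) -
      ∫ x, k₂ x * spectralKernel d α m r (a N x) z
  -- the approximations are finite sums
  have hsum : ∀ N, ∀ G₁ G₂ : Space d → ℂ,
      (∫ x, k₁ x * G₁ (a N x)) - ∫ x, k₂ x * G₂ (a N x) =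
        ∑ j ∈ (a N).range ×ˢ (Finset.univ : Finset Bool),
          (if j.2 then ∫ x in a N ⁻¹' {j.1}, k₁ x else -∫ x in a N ⁻¹' {j.1}, k₂ x) *
            (if j.2 then G₁ j.1 else G₂ j.1) := by
    intro N G₁ G₂
    rw [integral_mul_simpleFunc hk₁, integral_mul_simpleFunc hk₂, Finset.sum_product,
      ← Finset.sum_sub_distrib]
    refine Finset.sum_congr rfl fun v _ => ?_
    simp [sub_eq_add_neg]
  have hZ : ∀ N ω, Z N ω = ∑ j ∈ (a N).range ×ˢ (Finset.univ : Finset Bool),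
      (if j.2 then ∫ x in a N ⁻¹' {j.1}, k₁ x else -∫ x in a N ⁻¹' {j.1}, k₂ x) *
        Ψ (if j.2 then n else m) (if j.2 then t else r) j.1 ω := by
    intro N ω
    refine (hsum N (fun x => Ψ n t x ω) (fun x => Ψ m r x ω)).trans ?_
    refine Finset.sum_congr rfl fun j _ => ?_
    rcases j with ⟨v, b⟩
    cases b <;> rfl
  have hH : ∀ N z, H N z = ∑ j ∈ (a N).range ×ˢ (Finset.univ : Finset Bool),
      (if j.2 then ∫ x in a N ⁻¹' {j.1}, k₁ x else -∫ x in a N ⁻¹' {j.1}, k₂ x) *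
        spectralKernel d α (if j.2 then n else m) ((if j.2 then t else r : Icc (0 : ℝ) T) : ℝ)
          j.1 z := by
    intro N z
    refine (hsum N (fun x => spectralKernel d α n t x z)
      (fun x => spectralKernel d α m r x z)).trans ?_
    refine Finset.sum_congr rfl fun j _ => ?_
    rcases j with ⟨v, b⟩
    cases b <;> rfl
  have hmom : ∀ N, ∫⁻ ω, ‖Z N ω‖ₑ ^ q ∂P ≤
      C * (∫⁻ z, ‖H N z‖ₑ ^ 2 ∂(slabMeasure d T)) ^ (q / 2) := by
    intro N
    simp_rw [hZ, hH]
    exact hΨ.moment_sum_le hC _ _ (fun j : Space d × Bool => if j.2 then n else m)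
      (fun j => if j.2 then t else r) (fun j => j.1)
  have hZm : ∀ N, Measurable fun ω => ‖Z N ω‖ₑ ^ q := by
    intro N
    simp_rw [hZ]
    exact ((Finset.measurable_fun_sum _ fun j _ => (hmeas _ _ _).const_mul _).enorm).pow_const q
  have hHm : ∀ N, Measurable (H N) := by
    intro N
    have h := funext (hH N)
    rw [h]
    exact Finset.measurable_fun_sum _ fun j _ => (measurable_spectralKernel _ _ _).const_mul _
  have hZlim : ∀ ω, Tendsto (fun N => ‖Z N ω‖ₑ ^ q) atTop
      (𝓝 (‖(∫ x, k₁ x * Ψ n t x ω) - ∫ x, k₂ x * Ψ m r x ω‖ₑ ^ q)) := by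
    intro ω
    have hc : ∀ n t, Continuous fun x => Ψ n t x ω := fun n t =>
      (hcont n ω).comp (Continuous.prodMk_right t)
    exact (((tendsto_integral_mul_approxOn hK hy₀ hk₁ hk₁0 (hc n t)).sub
      (tendsto_integral_mul_approxOn hK hy₀ hk₂ hk₂0 (hc m r))).enorm).ennrpow_const q
  -- a square integrable majorant of the approximations of the kernels
  let b : ℝ × Space d → ℝ≥0∞ := fun z =>
    2 * ((∫⁻ x, ‖k₁ x‖ₑ) ^ 2 * ‖spectralKernel d α n t 0 z‖ₑ ^ 2) +
      2 * ((∫⁻ x, ‖k₂ x‖ₑ) ^ 2 * ‖spectralKernel d α m r 0 z‖ₑ ^ 2)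
  have hL2 : ∀ n t, ∫⁻ z, ‖spectralKernel d α n t 0 z‖ₑ ^ 2 ∂(slabMeasure d T) ≠ ∞ := by
    intro n t
    have h := (memLp_spectralKernel (d := d) α T n t 0).2
    rw [eLpNorm_lt_top_iff_lintegral_rpow_enorm_lt_top (by norm_num) (by norm_num)] at h
    simpa using h.ne
  have hk₁t : ∫⁻ x, ‖k₁ x‖ₑ ≠ ∞ := hk₁.2.ne
  have hk₂t : ∫⁻ x, ‖k₂ x‖ₑ ≠ ∞ := hk₂.2.ne
  have hbint : ∫⁻ z, b z ∂(slabMeasure d T) ≠ ∞ := by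
    have hm := measurable_spectralKernel (d := d) (α := α)
    have hm2 : ∀ n t, Measurable fun z => ‖spectralKernel d α n t 0 z‖ₑ ^ 2 := fun n t =>
      (hm n t 0).enorm.pow_const 2
    rw [lintegral_add_left (((hm2 _ _).const_mul _).const_mul _), lintegral_const_mul' _ _ (by simp),
      lintegral_const_mul' _ _ (by finiteness), lintegral_const_mul' _ _ (by simp),
      lintegral_const_mul' _ _ (by finiteness)]
    have h1 := hL2 n t
    have h2 := hL2 m r
    finiteness
  have hHlim : Tendsto (fun N => ∫⁻ z, ‖H N z‖ₑ ^ 2 ∂(slabMeasure d T)) atTop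
      (𝓝 (∫⁻ z, ‖(∫ x, k₁ x * spectralKernel d α n t x z) -
        ∫ x, k₂ x * spectralKernel d α m r x z‖ₑ ^ 2 ∂(slabMeasure d T))) := by
    refine tendsto_lintegral_of_dominated_convergence b (fun N => (hHm N).enorm.pow_const 2)
      (fun N => Eventually.of_forall fun z => ?_) hbint (Eventually.of_forall fun z => ?_)
    · refine (pow_le_pow_left' ((enorm_sub_le).trans (add_le_add
        (enorm_integral_mul_spectralKernel_le n t z k₁ (a N))
        (enorm_integral_mul_spectralKernel_le m r z k₂ (a N)))) 2).trans ((ennreal_add_sq_le _ _).trans ?_)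
      rw [mul_pow, mul_pow]
    · have h := ((tendsto_integral_mul_approxOn hK hy₀ hk₁ hk₁0
          (continuous_spectralKernel (α := α) n t z)).sub
        (tendsto_integral_mul_approxOn hK hy₀ hk₂ hk₂0
          (continuous_spectralKernel (α := α) m r z))).enorm
      exact ((ENNReal.continuous_pow 2).tendsto _).comp h
  calc ∫⁻ ω, ‖(∫ x, k₁ x * Ψ n t x ω) - ∫ x, k₂ x * Ψ m r x ω‖ₑ ^ q ∂P
      = ∫⁻ ω, liminf (fun N => ‖Z N ω‖ₑ ^ q) atTop ∂P :=
        lintegral_congr fun ω => (hZlim ω).liminf_eq.symm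
    _ ≤ liminf (fun N => ∫⁻ ω, ‖Z N ω‖ₑ ^ q ∂P) atTop := lintegral_liminf_le hZm
    _ ≤ liminf (fun N => C * (∫⁻ z, ‖H N z‖ₑ ^ 2 ∂(slabMeasure d T)) ^ (q / 2)) atTop :=
        liminf_le_liminf (Eventually.of_forall hmom)
    _ = _ := (ENNReal.Tendsto.const_mul (hHlim.ennrpow_const _) (Or.inr hCt)).liminf_eq

theorem integral_mul_spectralKernel (n : ℕ) (t : ℝ) (k : Space d → ℂ) (z : ℝ × Space d) :
    ∫ x, k x * spectralKernel d α n t x z = timeWave t (‖z.2‖ ^ 2) z.1 *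
      (freqProfile d α n z.2 * ∫ x, k x * Complex.exp (-Complex.I * (inner ℝ z.2 x : ℝ))) := by
  simp_rw [spectralKernel_eq]
  rw [← integral_const_mul, ← integral_const_mul]
  congr 1
  ext x
  ring

end

/-! ### The Bessel operator applied to a localized plane wave -/

section

open FourierTransform

variable {d : ℕ}

theorem besselSymbol_pos (σ : ℝ) (η : Space d) : 0 < besselSymbol d σ η :=
  Real.rpow_pos_of_pos (by positivity) _

theorem continuous_besselSymbol (σ : ℝ) : Continuous (besselSymbol d σ) :=
  (continuous_one_add_norm_sq_rpow (σ / 2)).comp (continuous_const_smul (2 * Real.pi))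

/-- **Peetre's inequality** for the weights `(1 + |u|²)^(κ/2)`. -/
theorem peetre {E : Type*} [NormedAddCommGroup E] (κ : ℝ) (u v : E) :
    (1 + ‖u‖ ^ 2) ^ (κ / 2) ≤
      2 ^ (|κ| / 2) * (1 + ‖v‖ ^ 2) ^ (κ / 2) * (1 + ‖u + v‖ ^ 2) ^ (|κ| / 2) := by
  have key : ∀ u v : E, 1 + ‖u‖ ^ 2 ≤ 2 * (1 + ‖v‖ ^ 2) * (1 + ‖u + v‖ ^ 2) := by
    intro u v
    have h1 : ‖u‖ ≤ ‖u + v‖ + ‖v‖ := by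
      simpa using norm_sub_le (u + v) v
    have h2 := norm_nonneg u
    have h3 : ‖u‖ ^ 2 ≤ 2 * ‖u + v‖ ^ 2 + 2 * ‖v‖ ^ 2 := by
      nlinarith [sq_nonneg (‖u + v‖ - ‖v‖)]
    nlinarith [mul_nonneg (sq_nonneg ‖v‖) (sq_nonneg ‖u + v‖)]
  rcases le_total 0 κ with h | h
  · rw [abs_of_nonneg h, ← Real.mul_rpow (by norm_num) (by positivity),
      ← Real.mul_rpow (by positivity) (by positivity)]
    exact Real.rpow_le_rpow (by positivity) (key u v) (by linarith)
  · have h1 : (1 + ‖v‖ ^ 2) ^ (-κ / 2) ≤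
        2 ^ (-κ / 2) * (1 + ‖u‖ ^ 2) ^ (-κ / 2) * (1 + ‖u + v‖ ^ 2) ^ (-κ / 2) := by
      rw [← Real.mul_rpow (by norm_num) (by positivity),
        ← Real.mul_rpow (by positivity) (by positivity), add_comm u v]
      exact Real.rpow_le_rpow (by positivity) (key v u) (by linarith)
    have hinv : ∀ w : E, (1 + ‖w‖ ^ 2) ^ (κ / 2) = ((1 + ‖w‖ ^ 2) ^ (-κ / 2))⁻¹ := by
      intro w
      rw [← Real.rpow_neg (by positivity)]
      congr 1; ring
    rw [abs_of_nonpos h, hinv u, hinv v]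
    have hu : 0 < (1 + ‖u‖ ^ 2) ^ (-κ / 2) := by positivity
    have hv : 0 < (1 + ‖v‖ ^ 2) ^ (-κ / 2) := by positivity
    rw [mul_right_comm, ← div_eq_mul_inv, le_div_iff₀ hv, inv_mul_le_iff₀ hu]
    linarith

theorem besselSymbol_le (κ : ℝ) (ξ η : Space d) :
    besselSymbol d κ η ≤ 2 ^ (|κ| / 2) * (1 + ‖ξ‖ ^ 2) ^ (κ / 2) *
      besselSymbol d |κ| (η + (2 * Real.pi)⁻¹ • ξ) := by
  have h : (2 * Real.pi) • (η + (2 * Real.pi)⁻¹ • ξ) = (2 * Real.pi) • η + ξ := by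
    rw [smul_add, smul_smul, mul_inv_cancel₀ (by positivity), one_smul]
  unfold besselSymbol
  rw [h]
  exact peetre κ _ ξ

/-- The integrals `∫ a(η) φ(η + ξ/2π) e^{2πi⟨η, y⟩} dη`. When `φ` is the Fourier transform of `ρ`,
this is the function `a(D) (ρ e^{-i⟨·, ξ⟩})`. -/
def modulatedMultiplier (φ : 𝓢(Space d, ℂ)) (a : Space d → ℂ) (ξ y : Space d) : ℂ :=
  ∫ η, Complex.exp (Complex.I * (2 * Real.pi * inner ℝ η y : ℝ)) *
    (a η * φ (η + (2 * Real.pi)⁻¹ • ξ))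

theorem fourierInv_eq_integral_exp (f : Space d → ℂ) (y : Space d) :
    𝓕⁻ f y = ∫ η, Complex.exp (Complex.I * (2 * Real.pi * inner ℝ η y : ℝ)) * f η := by
  rw [Real.fourierInv_eq']
  refine integral_congr_ae (Eventually.of_forall fun η => ?_)
  dsimp only
  rw [smul_eq_mul, mul_comm Complex.I]

theorem modulatedMultiplier_integrable (φ : 𝓢(Space d, ℂ)) {κ L : ℝ} {a : Space d → ℂ}
    (ha : Measurable a) (haL : ∀ η, ‖a η‖ ≤ L * besselSymbol d κ η) (hL : 0 ≤ L) (ξ : Space d) :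
    Integrable (fun η => a η * φ (η + (2 * Real.pi)⁻¹ • ξ)) ∧
      MemLp (fun η => a η * φ (η + (2 * Real.pi)⁻¹ • ξ)) 2 ∧
      ∀ η, ‖a η * φ (η + (2 * Real.pi)⁻¹ • ξ)‖ ≤
        (L * 2 ^ (|κ| / 2) * (1 + ‖ξ‖ ^ 2) ^ (κ / 2)) *
        ‖SchwartzMap.smulLeftCLM ℂ (fun η => (besselSymbol d |κ| η : ℂ)) φ
          (η + (2 * Real.pi)⁻¹ • ξ)‖ := by
  set ψ := SchwartzMap.smulLeftCLM ℂ (fun η => (besselSymbol d |κ| η : ℂ)) φ with hψ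
  have hψn : ∀ ζ, ‖ψ ζ‖ = besselSymbol d |κ| ζ * ‖φ ζ‖ := by
    intro ζ
    rw [hψ, SchwartzMap.smulLeftCLM_apply_apply (besselSymbol_hasTemperateGrowth d _), norm_smul,
      Complex.norm_real, Real.norm_of_nonneg (besselSymbol_pos _ _).le]
  have hb : ∀ η, ‖a η * φ (η + (2 * Real.pi)⁻¹ • ξ)‖ ≤
      (L * 2 ^ (|κ| / 2) * (1 + ‖ξ‖ ^ 2) ^ (κ / 2)) * ‖ψ (η + (2 * Real.pi)⁻¹ • ξ)‖ := by
    intro η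
    rw [norm_mul, hψn, ← mul_assoc]
    refine mul_le_mul_of_nonneg_right ((haL η).trans ?_) (norm_nonneg _)
    have := mul_le_mul_of_nonneg_left (besselSymbol_le κ ξ η) hL
    linarith
  have hmeas : AEStronglyMeasurable (fun η => a η * φ (η + (2 * Real.pi)⁻¹ • ξ)) :=
    (ha.mul (φ.continuous.measurable.comp (measurable_add_const _))).aestronglyMeasurable
  refine ⟨?_, ?_, hb⟩
  · exact Integrable.mono' (((ψ.integrable (μ := volume)).comp_add_right
      ((2 * Real.pi)⁻¹ • ξ)).norm.const_mul _) hmeas (Eventually.of_forall hb)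
  · have h1 : MemLp (fun η => ψ (η + (2 * Real.pi)⁻¹ • ξ)) 2 :=
      (ψ.memLp 2).comp_measurePreserving (measurePreserving_add_right volume _)
    exact MemLp.of_le_mul h1 hmeas (Eventually.of_forall hb)

theorem measurable_modulatedMultiplier (φ : 𝓢(Space d, ℂ)) {a : Space d → ℂ} (ha : Measurable a) :
    Measurable fun z : Space d × Space d => modulatedMultiplier φ a z.1 z.2 := by
  have h : StronglyMeasurable (Function.uncurry fun (z : Space d × Space d) (η : Space d) =>
      Complex.exp (Complex.I * (2 * Real.pi * inner ℝ η z.2 : ℝ)) *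
        (a η * φ (η + (2 * Real.pi)⁻¹ • z.1))) := by
    refine Measurable.stronglyMeasurable ?_
    refine Measurable.mul ?_ (Measurable.mul (ha.comp measurable_snd) ?_)
    · have h1 : Continuous fun z : (Space d × Space d) × Space d => inner ℝ z.2 z.1.2 :=
        continuous_snd.inner (continuous_snd.comp continuous_fst)
      exact (by fun_prop : Continuous fun z : (Space d × Space d) × Space d =>
        Complex.exp (Complex.I * (2 * Real.pi * inner ℝ z.2 z.1.2 : ℝ))).measurable
    · exact (φ.continuous.comp (by fun_prop : Continuous fun z : (Space d × Space d) × Space d =>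
        z.2 + (2 * Real.pi)⁻¹ • z.1.1)).measurable
  exact h.integral_prod_right.measurable

/-- The size of the Bessel operator on localized plane waves of frequency `ξ`, uniformly in space
and on average in space: it acts like the number `⟨ξ⟩^κ`. -/
theorem exists_modulatedMultiplier_bound (φ : 𝓢(Space d, ℂ)) (κ : ℝ) :
    ∃ C : ℝ, 0 ≤ C ∧ ∀ (a : Space d → ℂ) (L : ℝ), Measurable a → 0 ≤ L →
      (∀ η, ‖a η‖ ≤ L * besselSymbol d κ η) → ∀ (μ : Measure (Space d)),
      (μ = volume ∨ ∃ y, μ = Measure.dirac y) → ∀ ξ,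
      ∫⁻ y, ‖modulatedMultiplier φ a ξ y‖ₑ ^ 2 ∂μ ≤
        ENNReal.ofReal (C * L ^ 2 * (1 + ‖ξ‖ ^ 2) ^ κ) := by
  obtain ⟨ψ, hψ⟩ : ∃ ψ, ψ = SchwartzMap.smulLeftCLM ℂ (fun η => (besselSymbol d |κ| η : ℂ)) φ :=
    ⟨_, rfl⟩
  set A := ∫ η, ‖ψ η‖ with hA
  set B := ∫ η, ‖ψ η‖ ^ 2 with hB
  have hA0 : 0 ≤ A := integral_nonneg fun _ => norm_nonneg _
  have hB0 : 0 ≤ B := integral_nonneg fun _ => by positivity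
  refine ⟨(2 ^ (|κ| / 2)) ^ 2 * (A ^ 2 + B), by positivity, ?_⟩
  intro a L ha hL haL μ hμ ξ
  obtain ⟨h1, h2, h3⟩ := modulatedMultiplier_integrable φ ha haL hL ξ
  rw [← hψ] at h3
  set M := L * 2 ^ (|κ| / 2) * (1 + ‖ξ‖ ^ 2) ^ (κ / 2) with hM
  have hM0 : 0 ≤ M := by positivity
  have hM2 : M ^ 2 = L ^ 2 * (2 ^ (|κ| / 2)) ^ 2 * (1 + ‖ξ‖ ^ 2) ^ κ := by
    rw [hM, mul_pow, mul_pow, sq ((1 + ‖ξ‖ ^ 2) ^ (κ / 2)), one_add_sq_rpow_mul_self]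
  have hE : 0 ≤ (1 + ‖ξ‖ ^ 2) ^ κ := by positivity
  rcases hμ with rfl | ⟨y, rfl⟩
  · simp only [modulatedMultiplier, ← fourierInv_eq_integral_exp]
    rw [lintegral_enorm_fourierInv_sq h1 h2]
    calc ∫⁻ η, ‖a η * φ (η + (2 * Real.pi)⁻¹ • ξ)‖ₑ ^ 2
        ≤ ∫⁻ η, ENNReal.ofReal (M ^ 2 * ‖ψ (η + (2 * Real.pi)⁻¹ • ξ)‖ ^ 2) := by
          refine lintegral_mono fun η => ?_
          rw [← ofReal_norm, ← ENNReal.ofReal_pow (norm_nonneg _), ← mul_pow]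
          exact ENNReal.ofReal_le_ofReal (pow_le_pow_left₀ (norm_nonneg _) (h3 η) 2)
      _ = ∫⁻ η, ENNReal.ofReal (M ^ 2 * ‖ψ η‖ ^ 2) :=
          lintegral_add_right_eq_self (fun η => ENNReal.ofReal (M ^ 2 * ‖ψ η‖ ^ 2)) _
      _ = ENNReal.ofReal (M ^ 2 * B) := by
          rw [← ofReal_integral_eq_lintegral_ofReal, integral_const_mul]
          · exact ((ψ.memLp 2).integrable_norm_pow (by norm_num)).const_mul _
          · exact Eventually.of_forall fun _ => by positivity
      _ ≤ _ := by
          apply ENNReal.ofReal_le_ofReal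
          rw [hM2]
          have : 0 ≤ (2 ^ (|κ| / 2)) ^ 2 * A ^ 2 * L ^ 2 * (1 + ‖ξ‖ ^ 2) ^ κ := by positivity
          linarith
  · have hmm : Measurable fun y => ‖modulatedMultiplier φ a ξ y‖ₑ ^ 2 :=
      (((measurable_modulatedMultiplier φ ha).comp measurable_prodMk_left).enorm).pow_const 2
    rw [lintegral_dirac' _ hmm]
    have h4 : ‖modulatedMultiplier φ a ξ y‖ ≤ M * A := by
      unfold modulatedMultiplier
      refine (norm_integral_le_integral_norm _).trans ?_
      calc ∫ η, ‖Complex.exp (Complex.I * (2 * Real.pi * inner ℝ η y : ℝ)) *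
          (a η * φ (η + (2 * Real.pi)⁻¹ • ξ))‖
          ≤ ∫ η, M * ‖ψ (η + (2 * Real.pi)⁻¹ • ξ)‖ := by
            refine integral_mono_of_nonneg (Eventually.of_forall fun _ => norm_nonneg _)
              (((ψ.integrable (μ := volume)).comp_add_right
                ((2 * Real.pi)⁻¹ • ξ)).norm.const_mul _) (Eventually.of_forall fun η => ?_)
            dsimp only
            rw [norm_mul, Complex.norm_exp_I_mul_ofReal, one_mul]
            exact h3 η
        _ = M * A := by
          rw [integral_const_mul, integral_add_right_eq_self (fun η => ‖ψ η‖)]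
    rw [← ofReal_norm, ← ENNReal.ofReal_pow (norm_nonneg _)]
    apply ENNReal.ofReal_le_ofReal
    refine (pow_le_pow_left₀ (norm_nonneg _) h4 2).trans ?_
    rw [mul_pow, hM2]
    have : 0 ≤ (2 ^ (|κ| / 2)) ^ 2 * B * L ^ 2 * (1 + ‖ξ‖ ^ 2) ^ κ := by positivity
    linarith

theorem integrable_exp_mul {f : Space d → ℂ} (hf : Integrable f) (y : Space d) :
    Integrable fun η => Complex.exp (Complex.I * (2 * Real.pi * inner ℝ η y : ℝ)) * f η := by
  refine hf.bdd_mul (c := 1) ?_ (Eventually.of_forall fun η => ?_)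
  · exact (by fun_prop : Continuous fun η : Space d =>
      Complex.exp (Complex.I * (2 * Real.pi * inner ℝ η y : ℝ))).aestronglyMeasurable
  · rw [Complex.norm_exp_I_mul_ofReal]

theorem modulatedMultiplier_sub (φ : 𝓢(Space d, ℂ)) {κ L : ℝ} {a b : Space d → ℂ}
    (ha : Measurable a) (hb : Measurable b) (hL : 0 ≤ L)
    (haL : ∀ η, ‖a η‖ ≤ L * besselSymbol d κ η) (hbL : ∀ η, ‖b η‖ ≤ L * besselSymbol d κ η)
    (ξ y : Space d) :
    modulatedMultiplier φ a ξ y - modulatedMultiplier φ b ξ y =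
      modulatedMultiplier φ (a - b) ξ y := by
  have h1 := (modulatedMultiplier_integrable φ ha haL hL ξ).1
  have h2 := (modulatedMultiplier_integrable φ hb hbL hL ξ).1
  unfold modulatedMultiplier
  rw [← integral_sub (integrable_exp_mul h1 y) (integrable_exp_mul h2 y)]
  simp only [Pi.sub_apply, sub_mul, mul_sub]

end

/-! ### Variance of the increments of the localized, regularized field -/

section

variable {d : ℕ}

/-- Frequencies which are cut at level `n` but not at level `m` are large in terms of the distance
between `1 / (n + 1)` and `1 / (m + 1)`. -/
theorem one_le_of_lt_of_le {n m : ℕ} {x Δ : ℝ} (hn : (n : ℝ) < x) (hm : x ≤ m)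
    (hΔ : |1 / ((n : ℝ) + 1) - 1 / ((m : ℝ) + 1)| ≤ Δ) : 1 ≤ 4 * Δ * (1 + x ^ 2) := by
  have hnm : (n : ℝ) + 1 ≤ m := by exact_mod_cast (Nat.cast_lt.1 (hn.trans_le hm) : n < m)
  have hn0 : (0 : ℝ) ≤ n := n.cast_nonneg
  have h1 : 1 / ((n : ℝ) + 1) - 1 / ((n : ℝ) + 2) ≤ Δ := by
    refine le_trans ?_ ((le_abs_self _).trans hΔ)
    have : 1 / ((m : ℝ) + 1) ≤ 1 / ((n : ℝ) + 2) :=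
      one_div_le_one_div_of_le (by linarith) (by linarith)
    linarith
  have h2 : 1 / ((n : ℝ) + 1) - 1 / ((n : ℝ) + 2) = 1 / (((n : ℝ) + 1) * (n + 2)) := by
    field_simp
    ring
  rw [h2, div_le_iff₀ (by positivity)] at h1
  have h3 : 0 ≤ Δ := (abs_nonneg _).trans hΔ
  have h4 : ((n : ℝ) + 1) * (n + 2) ≤ 4 * (1 + x ^ 2) := by
    have h5 := pow_le_pow_left₀ hn0 hn.le 2
    nlinarith [sq_nonneg ((n : ℝ) - 1 / 2)]
  have h6 := mul_le_mul_of_nonneg_left h4 h3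
  linarith

theorem norm_indicator_closedBall_sub_le {E F : Type*} [SeminormedAddCommGroup E]
    [NormedAddCommGroup F] (g : E → F) {n m : ℕ} {Δ θ : ℝ} (hθ : 0 ≤ θ)
    (hΔ : |1 / ((n : ℝ) + 1) - 1 / ((m : ℝ) + 1)| ≤ Δ) (ξ : E) :
    ‖indicator (Metric.closedBall 0 n) g ξ - indicator (Metric.closedBall 0 m) g ξ‖ ≤
      (4 * Δ * (1 + ‖ξ‖ ^ 2)) ^ θ * ‖g ξ‖ := by
  have hΔ0 : 0 ≤ Δ := (abs_nonneg _).trans hΔ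
  have hpos : 0 ≤ (4 * Δ * (1 + ‖ξ‖ ^ 2)) ^ θ * ‖g ξ‖ := by positivity
  have hone : 1 ≤ 4 * Δ * (1 + ‖ξ‖ ^ 2) → ‖g ξ‖ ≤ (4 * Δ * (1 + ‖ξ‖ ^ 2)) ^ θ * ‖g ξ‖ := fun h =>
    le_mul_of_one_le_left (norm_nonneg _) (Real.one_le_rpow h hθ)
  by_cases hn : ‖ξ‖ ≤ n <;> by_cases hm : ‖ξ‖ ≤ m
  · rw [indicator_of_mem (by simpa using hn), indicator_of_mem (by simpa using hm)]
    simpa using hpos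
  · rw [indicator_of_mem (by simpa using hn), indicator_of_notMem (by simpa using hm), sub_zero]
    exact hone (one_le_of_lt_of_le (not_le.1 hm) hn (by rwa [abs_sub_comm]))
  · rw [indicator_of_notMem (by simpa using hn), indicator_of_mem (by simpa using hm), zero_sub,
      norm_neg]
    exact hone (one_le_of_lt_of_le (not_le.1 hn) hm hΔ)
  · rw [indicator_of_notMem (by simpa using hn), indicator_of_notMem (by simpa using hm)]
    simpa using hpos

/-- The symbol of `(1 - Δ)^(σ/2)` cut off outside of the ball of radius `R`, in the
frequency variable `η` of `𝓕`. -/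
def cutSymbol (d : ℕ) (σ : ℝ) (R : ℕ) : Space d → ℂ :=
  indicator (Metric.closedBall 0 R) fun η => (besselSymbol d σ η : ℂ)

theorem measurable_cutSymbol (σ : ℝ) (R : ℕ) : Measurable (cutSymbol d σ R) :=
  (Complex.measurable_ofReal.comp (continuous_besselSymbol σ).measurable).indicator
    Metric.isClosed_closedBall.measurableSet

theorem norm_cutSymbol_le (σ : ℝ) (R : ℕ) (η : Space d) :
    ‖cutSymbol d σ R η‖ ≤ 1 * besselSymbol d σ η := by
  unfold cutSymbol
  rw [norm_indicator_eq_indicator_norm, one_mul]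
  refine (indicator_le_self' (fun _ _ => norm_nonneg _) η).trans ?_
  rw [Complex.norm_real, Real.norm_of_nonneg (besselSymbol_pos _ _).le]

theorem norm_cutSymbol_sub_le (σ : ℝ) {R S : ℕ} {Δ θ : ℝ} (hθ : 0 ≤ θ)
    (hΔ : |1 / ((R : ℝ) + 1) - 1 / ((S : ℝ) + 1)| ≤ Δ) (η : Space d) :
    ‖(cutSymbol d σ R - cutSymbol d σ S) η‖ ≤
      (4 * Δ) ^ (θ / 2) * besselSymbol d (σ + θ) η := by
  have hΔ0 : 0 ≤ Δ := (abs_nonneg _).trans hΔ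
  refine (norm_indicator_closedBall_sub_le (fun η : Space d => (besselSymbol d σ η : ℂ))
    (by positivity : 0 ≤ θ / 2) hΔ η).trans ?_
  rw [Complex.norm_real, Real.norm_of_nonneg (besselSymbol_pos _ _).le,
    Real.mul_rpow (by positivity) (by positivity), mul_assoc]
  refine mul_le_mul_of_nonneg_left ?_ (by positivity)
  unfold besselSymbol
  rw [add_comm σ θ, add_div, Real.rpow_add (by positivity)]
  refine mul_le_mul_of_nonneg_right (Real.rpow_le_rpow (by positivity) ?_ (by positivity))
    (by positivity)
  have h1 : ‖η‖ ≤ ‖(2 * Real.pi) • η‖ := by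
    rw [norm_smul, Real.norm_of_nonneg (by positivity)]
    have := Real.two_le_pi
    nlinarith [norm_nonneg η]
  have := pow_le_pow_left₀ (norm_nonneg η) h1 2
  linarith

/-- The variance at the point `y` of the increment of `(1 - Δ)^(-s/2) (ρ Ψ)`, the Bessel operator
being truncated at the frequencies `R`, `S`; here `φ` is the Fourier transform of `ρ`. -/
def incrVariance (α s T : ℝ) (φ : 𝓢(Space d, ℂ)) (t r : Icc (0 : ℝ) T) (n m R S : ℕ)
    (y : Space d) : ℝ≥0∞ :=
  ∫⁻ z, ‖timeWave t (‖z.2‖ ^ 2) z.1 *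
      ((freqProfile d α n z.2 : ℂ) * modulatedMultiplier φ (cutSymbol d (-s) R) z.2 y) -
    timeWave r (‖z.2‖ ^ 2) z.1 *
      ((freqProfile d α m z.2 : ℂ) * modulatedMultiplier φ (cutSymbol d (-s) S) z.2 y)‖ₑ ^ 2
    ∂(slabMeasure d T)

theorem enorm_freqProfile_sq_le (α : ℝ) (n : ℕ) (ξ : Space d) :
    ‖(freqProfile d α n ξ : ℂ)‖ₑ ^ 2 ≤ ENNReal.ofReal ((1 + ‖ξ‖ ^ 2) ^ (-α)) := by
  rw [← ofReal_norm, ← ENNReal.ofReal_pow (norm_nonneg _), Complex.norm_real,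
    Real.norm_of_nonneg (freqProfile_nonneg n ξ)]
  apply ENNReal.ofReal_le_ofReal
  have h1 : (Real.sqrt ((2 * Real.pi) ^ d))⁻¹ ≤ 1 := by
    apply inv_le_one_of_one_le₀
    rw [Real.one_le_sqrt]
    exact one_le_pow₀ (by linarith [Real.two_le_pi])
  have h2 : freqProfile d α n ξ ≤ (1 + ‖ξ‖ ^ 2) ^ (-(α / 2)) :=
    (freqProfile_le n ξ).trans (mul_le_of_le_one_left (by positivity) h1)
  refine (pow_le_pow_left₀ (freqProfile_nonneg n ξ) h2 2).trans (le_of_eq ?_)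
  rw [← neg_div, sq, one_add_sq_rpow_mul_self]

theorem enorm_freqProfile_sub_sq_le (α : ℝ) {n m : ℕ} {Δ θ : ℝ} (hθ : 0 ≤ θ)
    (hΔ : |1 / ((n : ℝ) + 1) - 1 / ((m : ℝ) + 1)| ≤ Δ) (ξ : Space d) :
    ‖(freqProfile d α n ξ : ℂ) - freqProfile d α m ξ‖ₑ ^ 2 ≤
      ENNReal.ofReal ((4 * Δ) ^ θ * (1 + ‖ξ‖ ^ 2) ^ (θ - α)) := by
  have hΔ0 : 0 ≤ Δ := (abs_nonneg _).trans hΔ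
  have h1 : (Real.sqrt ((2 * Real.pi) ^ d))⁻¹ ≤ 1 := by
    apply inv_le_one_of_one_le₀
    rw [Real.one_le_sqrt]
    exact one_le_pow₀ (by linarith [Real.two_le_pi])
  have h2 := norm_indicator_closedBall_sub_le (fun ξ : Space d =>
    (Real.sqrt ((2 * Real.pi) ^ d))⁻¹ * (1 + ‖ξ‖ ^ 2) ^ (-(α / 2))) (by positivity : 0 ≤ θ / 2) hΔ ξ
  rw [Real.norm_of_nonneg (r := (Real.sqrt ((2 * Real.pi) ^ d))⁻¹ * _) (by positivity)] at h2
  have h3 : ‖(freqProfile d α n ξ : ℂ) - freqProfile d α m ξ‖ ≤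
      (4 * Δ * (1 + ‖ξ‖ ^ 2)) ^ (θ / 2) * (1 + ‖ξ‖ ^ 2) ^ (-(α / 2)) := by
    rw [← Complex.ofReal_sub, Complex.norm_real]
    exact h2.trans (mul_le_mul_of_nonneg_left (mul_le_of_le_one_left (by positivity) h1)
      (by positivity))
  rw [← ofReal_norm, ← ENNReal.ofReal_pow (norm_nonneg _)]
  apply ENNReal.ofReal_le_ofReal
  refine (pow_le_pow_left₀ (norm_nonneg _) h3 2).trans (le_of_eq ?_)
  rw [mul_pow, ← neg_div, sq (_ ^ (-α / 2)), one_add_sq_rpow_mul_self, ← Real.rpow_natCast,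
    ← Real.rpow_mul (by positivity)]
  norm_num
  rw [Real.mul_rpow (by positivity) (by positivity), mul_assoc, ← Real.rpow_add (by positivity)]
  rfl

set_option maxHeartbeats 400000 in
/-- Hölder bound for the variance of the increments, uniformly in the space variable and on average
in the space variable. It is here that `s > d/2 - α` is needed. -/
theorem exists_incrVariance_bound {T : ℝ} (hT : 0 < T) {α s θ : ℝ} (hθ0 : 0 < θ) (hθ1 : θ ≤ 1)
    (hθ : (d : ℝ) / 2 < α + s - θ) (φ : 𝓢(Space d, ℂ)) :
    ∃ B : ℝ, 0 ≤ B ∧ ∀ (t r : Icc (0 : ℝ) T) (n m R S : ℕ) (Δ : ℝ), |(t : ℝ) - r| ≤ Δ →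
      |1 / ((n : ℝ) + 1) - 1 / ((m : ℝ) + 1)| ≤ Δ → |1 / ((R : ℝ) + 1) - 1 / ((S : ℝ) + 1)| ≤ Δ →
      ∀ μ : Measure (Space d), (μ = volume ∨ ∃ y, μ = Measure.dirac y) →
      ∫⁻ y, incrVariance α s T φ t r n m R S y ∂μ ≤ ENNReal.ofReal (B * Δ ^ θ) := by
  obtain ⟨C₀, hC₀, hC₀b⟩ := exists_modulatedMultiplier_bound φ (-s)
  obtain ⟨C₁, hC₁, hC₁b⟩ := exists_modulatedMultiplier_bound φ (-s + θ)
  have hint : Integrable fun ξ : Space d => (1 + ‖ξ‖ ^ 2) ^ (θ - α - s) := by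
    have := integrable_rpow_neg_one_add_norm_sq (E := Space d) (μ := volume)
      (r := 2 * (α + s - θ)) (by rw [finrank_euclideanSpace_fin]; linarith)
    convert this using 3
    ring
  set I := ∫ ξ : Space d, (1 + ‖ξ‖ ^ 2) ^ (θ - α - s) with hI
  have hI0 : 0 ≤ I := integral_nonneg fun _ => by positivity
  have hIl : ∀ c : ℝ, 0 ≤ c → ∫⁻ ξ : Space d, ENNReal.ofReal (c * (1 + ‖ξ‖ ^ 2) ^ (θ - α - s)) =
      ENNReal.ofReal (c * I) := by
    intro c hc
    rw [← ofReal_integral_eq_lintegral_ofReal (hint.const_mul c)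
      (Eventually.of_forall fun _ => by positivity), integral_const_mul]
  refine ⟨2 * T * ((2 * 4 ^ θ * C₀ + 2 * C₁ * 4 ^ θ) * I) +
    2 * (T ^ (1 - θ) + 4 * T) * (C₀ * I), by positivity, ?_⟩
  intro t r n m R S Δ ht hn hR μ hμ
  have hΔ0 : 0 ≤ Δ := (abs_nonneg _).trans ht
  have : SFinite μ := by
    rcases hμ with rfl | ⟨y, rfl⟩ <;> infer_instance
  obtain ⟨γ, hγ⟩ : ∃ γ : ℕ → Space d → Space d → ℂ,
      γ = fun R ξ y => modulatedMultiplier φ (cutSymbol d (-s) R) ξ y := ⟨_, rfl⟩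
  have hγm : ∀ R, Measurable fun z : Space d × Space d => γ R z.1 z.2 := fun R => by
    rw [hγ]
    exact measurable_modulatedMultiplier φ (measurable_cutSymbol _ R)
  have hfm : ∀ n, Measurable fun ξ : Space d => (freqProfile d α n ξ : ℂ) := fun n =>
    Complex.measurable_ofReal.comp (measurable_freqProfile n)
  have hγ1 : ∀ R ξ, ∫⁻ y, ‖γ R ξ y‖ₑ ^ 2 ∂μ ≤ ENNReal.ofReal (C₀ * (1 + ‖ξ‖ ^ 2) ^ (-s)) := by
    intro R ξ
    have := hC₀b _ 1 (measurable_cutSymbol (-s) R) zero_le_one (norm_cutSymbol_le _ R) μ hμ ξ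
    simpa only [hγ, one_pow, mul_one] using this
  have hγ2 : ∀ ξ, ∫⁻ y, ‖γ R ξ y - γ S ξ y‖ₑ ^ 2 ∂μ ≤
      ENNReal.ofReal (C₁ * (4 * Δ) ^ θ * (1 + ‖ξ‖ ^ 2) ^ (-s + θ)) := by
    intro ξ
    simp only [hγ, modulatedMultiplier_sub φ (measurable_cutSymbol (-s) R)
      (measurable_cutSymbol (-s) S) zero_le_one (norm_cutSymbol_le _ R) (norm_cutSymbol_le _ S)]
    have := hC₁b (cutSymbol d (-s) R - cutSymbol d (-s) S) ((4 * Δ) ^ (θ / 2))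
      ((measurable_cutSymbol (-s) R).sub (measurable_cutSymbol (-s) S)) (by positivity)
      (norm_cutSymbol_sub_le _ hθ0.le hR) μ hμ ξ
    rwa [← Real.rpow_natCast, ← Real.rpow_mul (by positivity), Nat.cast_ofNat,
      div_mul_cancel₀ _ (two_ne_zero)] at this
  -- integrate the bound of the time increments in space, and exchange the integrals
  have hγy : ∀ R y, Measurable fun ξ => γ R ξ y := fun R y =>
    (hγm R).comp measurable_prodMk_right
  have step1 : ∀ y, incrVariance α s T φ t r n m R S y ≤
      2 * ENNReal.ofReal T * (∫⁻ ξ, ‖(freqProfile d α n ξ : ℂ) * γ R ξ y -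
        (freqProfile d α m ξ : ℂ) * γ S ξ y‖ₑ ^ 2) +
      2 * ENNReal.ofReal ((T ^ (1 - θ) + 4 * T) * |(t : ℝ) - r| ^ θ) *
        ∫⁻ ξ, ENNReal.ofReal ((1 + ‖ξ‖ ^ 2) ^ θ) * ‖(freqProfile d α m ξ : ℂ) * γ S ξ y‖ₑ ^ 2 :=
    fun y => by
      have h := lintegral_timeWave_mul_sub_sq_le hT hθ0.le hθ1 r t ((hfm n).mul (hγy R y))
        ((hfm m).mul (hγy S y))
      simp only [hγ] at h ⊢
      exact h
  have hm1 : Measurable fun z : Space d × Space d => ‖(freqProfile d α n z.2 : ℂ) * γ R z.2 z.1 -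
      (freqProfile d α m z.2 : ℂ) * γ S z.2 z.1‖ₑ ^ 2 :=
    (((((hfm n).comp measurable_snd).mul ((hγm R).comp measurable_swap)).sub
      (((hfm m).comp measurable_snd).mul ((hγm S).comp measurable_swap))).enorm).pow_const 2
  have hm2 : Measurable fun z : Space d × Space d => ENNReal.ofReal ((1 + ‖z.2‖ ^ 2) ^ θ) *
      ‖(freqProfile d α m z.2 : ℂ) * γ S z.2 z.1‖ₑ ^ 2 :=
    (((continuous_one_add_norm_sq_rpow θ).measurable.comp measurable_snd).ennreal_ofReal).mul
      ((((hfm m).comp measurable_snd).mul ((hγm S).comp measurable_swap)).enorm.pow_const 2)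
  have step2 : ∫⁻ y, (∫⁻ ξ, ‖(freqProfile d α n ξ : ℂ) * γ R ξ y -
        (freqProfile d α m ξ : ℂ) * γ S ξ y‖ₑ ^ 2) ∂μ ≤
      ENNReal.ofReal ((2 * 4 ^ θ * C₀ + 2 * C₁ * 4 ^ θ) * Δ ^ θ * I) := by
    rw [lintegral_lintegral_swap hm1.aemeasurable, ← hIl _ (by positivity)]
    refine lintegral_mono fun ξ => ?_
    dsimp only
    have hγξ : ∀ R, Measurable fun y => γ R ξ y := fun R => (hγm R).comp measurable_prodMk_left
    calc ∫⁻ y, ‖(freqProfile d α n ξ : ℂ) * γ R ξ y - (freqProfile d α m ξ : ℂ) * γ S ξ y‖ₑ ^ 2 ∂μ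
        ≤ ∫⁻ y, (2 * ‖(freqProfile d α n ξ : ℂ) - freqProfile d α m ξ‖ₑ ^ 2 * ‖γ R ξ y‖ₑ ^ 2 +
            2 * ‖(freqProfile d α m ξ : ℂ)‖ₑ ^ 2 * ‖γ R ξ y - γ S ξ y‖ₑ ^ 2) ∂μ := by
          refine lintegral_mono fun y => ?_
          have e : (freqProfile d α n ξ : ℂ) * γ R ξ y - (freqProfile d α m ξ : ℂ) * γ S ξ y =
              ((freqProfile d α n ξ : ℂ) - freqProfile d α m ξ) * γ R ξ y +
                (freqProfile d α m ξ : ℂ) * (γ R ξ y - γ S ξ y) := by ring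
          rw [e]
          refine ((pow_le_pow_left' (enorm_add_le _ _) 2).trans
            (ennreal_add_sq_le _ _)).trans (le_of_eq ?_)
          rw [enorm_mul, enorm_mul, mul_pow, mul_pow, mul_assoc, mul_assoc]
      _ = 2 * ‖(freqProfile d α n ξ : ℂ) - freqProfile d α m ξ‖ₑ ^ 2 * ∫⁻ y, ‖γ R ξ y‖ₑ ^ 2 ∂μ +
            2 * ‖(freqProfile d α m ξ : ℂ)‖ₑ ^ 2 * ∫⁻ y, ‖γ R ξ y - γ S ξ y‖ₑ ^ 2 ∂μ := by
          rw [lintegral_add_left (((hγξ R).enorm.pow_const 2).const_mul _),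
            lintegral_const_mul' _ _ (by finiteness), lintegral_const_mul' _ _ (by finiteness)]
      _ ≤ 2 * ENNReal.ofReal ((4 * Δ) ^ θ * (1 + ‖ξ‖ ^ 2) ^ (θ - α)) *
            ENNReal.ofReal (C₀ * (1 + ‖ξ‖ ^ 2) ^ (-s)) +
            2 * ENNReal.ofReal ((1 + ‖ξ‖ ^ 2) ^ (-α)) *
            ENNReal.ofReal (C₁ * (4 * Δ) ^ θ * (1 + ‖ξ‖ ^ 2) ^ (-s + θ)) := by
          refine add_le_add ?_ ?_
          · exact mul_le_mul' (mul_le_mul_right (enorm_freqProfile_sub_sq_le α hθ0.le hn ξ) 2) (hγ1 R ξ)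
          · exact mul_le_mul' (mul_le_mul_right (enorm_freqProfile_sq_le α m ξ) 2) (hγ2 ξ)
      _ = _ := by
          rw [two_mul_ofReal_mul_ofReal (by positivity), two_mul_ofReal_mul_ofReal (by positivity),
            ← ENNReal.ofReal_add (by positivity) (by positivity)]
          congr 1
          rw [Real.mul_rpow (by norm_num) hΔ0]
          have h1 : (1 + ‖ξ‖ ^ 2) ^ (θ - α - s) =
              (1 + ‖ξ‖ ^ 2) ^ (θ - α) * (1 + ‖ξ‖ ^ 2) ^ (-s) := by
            rw [← Real.rpow_add (by positivity)]; rfl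
          have h2 : (1 + ‖ξ‖ ^ 2) ^ (θ - α) * (1 + ‖ξ‖ ^ 2) ^ (-s) =
              (1 + ‖ξ‖ ^ 2) ^ (-α) * (1 + ‖ξ‖ ^ 2) ^ (-s + θ) := by
            rw [← Real.rpow_add (by positivity), ← Real.rpow_add (by positivity)]
            congr 1; ring
          have h3 : 2 * (1 + ‖ξ‖ ^ 2) ^ (-α) * (C₁ * (4 ^ θ * Δ ^ θ) * (1 + ‖ξ‖ ^ 2) ^ (-s + θ)) =
              2 * C₁ * 4 ^ θ * Δ ^ θ * ((1 + ‖ξ‖ ^ 2) ^ (-α) * (1 + ‖ξ‖ ^ 2) ^ (-s + θ)) := by ring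
          rw [h3, ← h2, h1]
          ring
  have step3 : ∫⁻ y, (∫⁻ ξ, ENNReal.ofReal ((1 + ‖ξ‖ ^ 2) ^ θ) *
      ‖(freqProfile d α m ξ : ℂ) * γ S ξ y‖ₑ ^ 2) ∂μ ≤ ENNReal.ofReal (C₀ * I) := by
    rw [lintegral_lintegral_swap hm2.aemeasurable, ← hIl _ (by positivity)]
    refine lintegral_mono fun ξ => ?_
    dsimp only
    have hγξ : ∀ R, Measurable fun y => γ R ξ y := fun R => (hγm R).comp measurable_prodMk_left
    calc ∫⁻ y, ENNReal.ofReal ((1 + ‖ξ‖ ^ 2) ^ θ) * ‖(freqProfile d α m ξ : ℂ) * γ S ξ y‖ₑ ^ 2 ∂μ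
        = ENNReal.ofReal ((1 + ‖ξ‖ ^ 2) ^ θ) * (‖(freqProfile d α m ξ : ℂ)‖ₑ ^ 2 *
            ∫⁻ y, ‖γ S ξ y‖ₑ ^ 2 ∂μ) := by
          simp_rw [enorm_mul, mul_pow]
          rw [lintegral_const_mul' _ _ (by finiteness), lintegral_const_mul' _ _ (by finiteness)]
      _ ≤ ENNReal.ofReal ((1 + ‖ξ‖ ^ 2) ^ θ) * (ENNReal.ofReal ((1 + ‖ξ‖ ^ 2) ^ (-α)) *
            ENNReal.ofReal (C₀ * (1 + ‖ξ‖ ^ 2) ^ (-s))) :=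
          mul_le_mul_right (mul_le_mul' (enorm_freqProfile_sq_le α m ξ) (hγ1 S ξ)) _
      _ = _ := by
          rw [← ENNReal.ofReal_mul (by positivity), ← ENNReal.ofReal_mul (by positivity)]
          congr 1
          have h1 : (1 + ‖ξ‖ ^ 2) ^ (θ - α - s) =
              (1 + ‖ξ‖ ^ 2) ^ θ * (1 + ‖ξ‖ ^ 2) ^ (-α) * (1 + ‖ξ‖ ^ 2) ^ (-s) := by
            rw [← Real.rpow_add (by positivity), ← Real.rpow_add (by positivity)]; rfl
          rw [h1]
          ring
  calc ∫⁻ y, incrVariance α s T φ t r n m R S y ∂μ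
      ≤ ∫⁻ y, (2 * ENNReal.ofReal T * (∫⁻ ξ, ‖(freqProfile d α n ξ : ℂ) * γ R ξ y -
        (freqProfile d α m ξ : ℂ) * γ S ξ y‖ₑ ^ 2) +
      2 * ENNReal.ofReal ((T ^ (1 - θ) + 4 * T) * |(t : ℝ) - r| ^ θ) *
        ∫⁻ ξ, ENNReal.ofReal ((1 + ‖ξ‖ ^ 2) ^ θ) *
          ‖(freqProfile d α m ξ : ℂ) * γ S ξ y‖ₑ ^ 2) ∂μ := lintegral_mono step1
    _ = 2 * ENNReal.ofReal T * (∫⁻ y, (∫⁻ ξ, ‖(freqProfile d α n ξ : ℂ) * γ R ξ y -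
        (freqProfile d α m ξ : ℂ) * γ S ξ y‖ₑ ^ 2) ∂μ) +
      2 * ENNReal.ofReal ((T ^ (1 - θ) + 4 * T) * |(t : ℝ) - r| ^ θ) *
        ∫⁻ y, (∫⁻ ξ, ENNReal.ofReal ((1 + ‖ξ‖ ^ 2) ^ θ) *
          ‖(freqProfile d α m ξ : ℂ) * γ S ξ y‖ₑ ^ 2) ∂μ := by
        rw [lintegral_add_left (hm1.lintegral_prod_right'.const_mul _),
          lintegral_const_mul' _ _ (by finiteness), lintegral_const_mul' _ _ (by finiteness)]
    _ ≤ 2 * ENNReal.ofReal T *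
          ENNReal.ofReal ((2 * 4 ^ θ * C₀ + 2 * C₁ * 4 ^ θ) * Δ ^ θ * I) +
        2 * ENNReal.ofReal ((T ^ (1 - θ) + 4 * T) * Δ ^ θ) * ENNReal.ofReal (C₀ * I) := by
        refine add_le_add (mul_le_mul_right step2 _) (mul_le_mul' (mul_le_mul_right ?_ _) step3)
        exact ENNReal.ofReal_le_ofReal (mul_le_mul_of_nonneg_left
          (Real.rpow_le_rpow (abs_nonneg _) ht hθ0.le) (by positivity))
    _ = _ := by
        rw [two_mul_ofReal_mul_ofReal hT.le, two_mul_ofReal_mul_ofReal (by positivity),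
          ← ENNReal.ofReal_add (by positivity) (by positivity)]
        congr 1
        ring

end

/-! ### Moments of the `L^p` norm of the regularized field -/

/-- Moments of an integral over a parameter. This is the consequence of Minkowski's integral
inequality for `y ↦ (E[g(y)^k])^(1/k) ≤ C^(1/k) W(y)`; it is obtained from Hölder's inequality with
the weight `W`. -/
theorem lintegral_rpow_lintegral_le {Y Ω : Type*} [MeasurableSpace Y] [MeasurableSpace Ω]
    {μ : Measure Y} {P : Measure Ω} [SFinite μ] [SFinite P] {g : Y → Ω → ℝ≥0∞}
    (hg : Measurable (Function.uncurry g)) {W : Y → ℝ≥0∞} (hW : Measurable W)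
    (hWt : ∫⁻ y, W y ∂μ ≠ ∞) {k : ℝ} (hk : 1 < k) {C : ℝ≥0∞} (hCt : C ≠ ∞)
    (h : ∀ y, ∫⁻ ω, g y ω ^ k ∂P ≤ C * W y ^ k) :
    ∫⁻ ω, (∫⁻ y, g y ω ∂μ) ^ k ∂P ≤ C * (∫⁻ y, W y ∂μ) ^ k := by
  have hk0 : 0 < k := by linarith
  have hgy : ∀ y, Measurable (g y) := fun y => hg.comp measurable_prodMk_left
  have hgω : ∀ ω, Measurable fun y => g y ω := fun ω => hg.comp measurable_prodMk_right
  have hae : ∀ᵐ ω ∂P, ∀ᵐ y ∂μ, g y ω ≤ g y ω * W y ^ (-((k - 1) / k)) * W y ^ ((k - 1) / k) := by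
    have hset : MeasurableSet {z : Ω × Y |
        g z.2 z.1 ≤ g z.2 z.1 * W z.2 ^ (-((k - 1) / k)) * W z.2 ^ ((k - 1) / k)} := by
      have h1 : Measurable fun z : Ω × Y => g z.2 z.1 := hg.comp measurable_swap
      have h2 : Measurable fun z : Ω × Y => W z.2 := hW.comp measurable_snd
      exact measurableSet_le h1 ((h1.mul (h2.pow_const _)).mul (h2.pow_const _))
    refine (Measure.ae_ae_comm (μ := P) (ν := μ) hset).2 ?_
    filter_upwards [ae_lt_top hW hWt] with y hy
    rcases eq_or_ne (W y) 0 with h0 | h0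
    · -- where the weight vanishes, so does `g`
      have h1 : ∫⁻ ω, g y ω ^ k ∂P = 0 := by
        have := h y
        rwa [h0, ENNReal.zero_rpow_of_pos hk0, mul_zero, nonpos_iff_eq_zero] at this
      rw [lintegral_eq_zero_iff ((hgy y).pow_const k)] at h1
      filter_upwards [h1] with ω hω
      have : g y ω = 0 := by
        simpa [hk0, hk0.not_gt] using hω
      simp [this]
    · refine Eventually.of_forall fun ω => ?_
      rw [mul_assoc, ← ENNReal.rpow_add _ _ h0 hy.ne, neg_add_cancel, ENNReal.rpow_zero, mul_one]
  have hconj : k.HolderConjugate (k / (k - 1)) := Real.HolderConjugate.conjExponent hk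
  have hexp : (k - 1) / k * (k / (k - 1)) = 1 := by
    have : k - 1 ≠ 0 := by linarith
    field_simp
  have hω : ∀ᵐ ω ∂P, (∫⁻ y, g y ω ∂μ) ^ k ≤
      (∫⁻ y, g y ω ^ k * W y ^ (1 - k) ∂μ) * (∫⁻ y, W y ∂μ) ^ (k - 1) := by
    filter_upwards [hae] with ω hω
    have h1 := ENNReal.lintegral_mul_le_Lp_mul_Lq μ hconj
      ((hgω ω).mul (hW.pow_const (-((k - 1) / k)))).aemeasurable
      (hW.pow_const ((k - 1) / k)).aemeasurable
    have h2 := (lintegral_mono_ae hω).trans h1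
    refine (ENNReal.rpow_le_rpow h2 hk0.le).trans (le_of_eq ?_)
    rw [ENNReal.mul_rpow_of_nonneg _ _ hk0.le, ← ENNReal.rpow_mul, ← ENNReal.rpow_mul,
      one_div_mul_cancel hk0.ne', ENNReal.rpow_one]
    congr 1
    · refine lintegral_congr fun y => ?_
      simp only [Pi.mul_apply]
      rw [ENNReal.mul_rpow_of_nonneg _ _ hk0.le, ← ENNReal.rpow_mul]
      congr 2
      field_simp
      ring
    · have e1 : 1 / (k / (k - 1)) * k = k - 1 := by field_simp
      rw [e1]
      congr 1
      refine lintegral_congr fun y => ?_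
      rw [← ENNReal.rpow_mul, hexp, ENNReal.rpow_one]
  have hWk : (∫⁻ y, W y ∂μ) ^ (k - 1) ≠ ∞ := ENNReal.rpow_ne_top_of_nonneg (by linarith) hWt
  calc ∫⁻ ω, (∫⁻ y, g y ω ∂μ) ^ k ∂P
      ≤ ∫⁻ ω, (∫⁻ y, g y ω ^ k * W y ^ (1 - k) ∂μ) * (∫⁻ y, W y ∂μ) ^ (k - 1) ∂P :=
        lintegral_mono_ae hω
    _ = (∫⁻ y, (∫⁻ ω, g y ω ^ k * W y ^ (1 - k) ∂P) ∂μ) * (∫⁻ y, W y ∂μ) ^ (k - 1) := by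
        rw [lintegral_mul_const' _ _ hWk, lintegral_lintegral_swap]
        have h1 : Measurable fun z : Ω × Y => g z.2 z.1 := hg.comp measurable_swap
        have h2 : Measurable fun z : Ω × Y => W z.2 := hW.comp measurable_snd
        exact ((h1.pow_const k).mul (h2.pow_const _)).aemeasurable
    _ ≤ (∫⁻ y, C * W y ∂μ) * (∫⁻ y, W y ∂μ) ^ (k - 1) := by
        refine mul_le_mul_left (lintegral_mono fun y => ?_) _
        dsimp only
        rw [lintegral_mul_const _ ((hgy y).pow_const k)]
        refine (mul_le_mul_left (h y) _).trans ?_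
        rw [mul_assoc]
        refine mul_le_mul_right ?_ _
        rcases eq_or_ne (W y) 0 with h0 | h0
        · simp [h0, hk0]
        rcases eq_or_ne (W y) ∞ with h1 | h1
        · simp [h1]
        rw [← ENNReal.rpow_add _ _ h0 h1, add_sub_cancel, ENNReal.rpow_one]
    _ = C * (∫⁻ y, W y ∂μ) ^ k := by
        rw [lintegral_const_mul' _ _ hCt, mul_assoc]
        congr 1
        rcases eq_or_ne (∫⁻ y, W y ∂μ) 0 with h0 | h0
        · simp [h0, hk0]
        conv_lhs => rw [← ENNReal.rpow_one (∫⁻ y, W y ∂μ), ← ENNReal.rpow_mul, one_mul]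
        rw [← ENNReal.rpow_add _ _ h0 hWt, add_sub_cancel]

section

open FourierTransform

variable {d : ℕ} {T α s : ℝ} {Ω : Type*} [MeasurableSpace Ω] {P : Measure Ω}
  {Ψ : ℕ → Icc (0 : ℝ) T → Space d → Ω → ℂ}

theorem integrable_cutSymbol (σ : ℝ) (R : ℕ) : Integrable (cutSymbol d σ R) := by
  have h : Continuous fun η : Space d => (besselSymbol d σ η : ℂ) :=
    Complex.continuous_ofReal.comp (continuous_besselSymbol σ)
  exact (integrable_indicator_iff Metric.isClosed_closedBall.measurableSet).2
    (h.continuousOn.integrableOn_compact (isCompact_closedBall 0 (R : ℝ)))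

/-- The kernel of the truncated Bessel operator composed with the multiplication by `r`. -/
def cutKernel (σ : ℝ) (r : 𝓢(Space d, ℂ)) (R : ℕ) (y x : Space d) : ℂ :=
  (∫ η, Complex.exp (Complex.I * (2 * Real.pi * inner ℝ η (y - x) : ℝ)) * cutSymbol d σ R η) * r x

theorem cutKernel_eq (σ : ℝ) (r : 𝓢(Space d, ℂ)) (R : ℕ) (y x : Space d) :
    cutKernel σ r R y x = 𝓕⁻ (cutSymbol d σ R) (y - x) * r x := by
  rw [fourierInv_eq_integral_exp]
  rfl

theorem continuous_cutKernel (σ : ℝ) (r : 𝓢(Space d, ℂ)) (R : ℕ) :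
    Continuous fun z : Space d × Space d => cutKernel σ r R z.1 z.2 := by
  have h : Continuous (𝓕⁻ (cutSymbol d σ R)) := by
    have h1 : Continuous (𝓕 (cutSymbol d σ R)) :=
      VectorFourier.fourierIntegral_continuous Real.continuous_fourierChar
        (by exact continuous_inner) (integrable_cutSymbol σ R)
    have h2 : 𝓕⁻ (cutSymbol d σ R) = fun x => 𝓕 (cutSymbol d σ R) (-x) := by
      funext x
      rw [Real.fourierInv_eq_fourier_neg]
    rw [h2]
    exact h1.comp continuous_neg
  simp_rw [cutKernel_eq]
  exact (h.comp (continuous_fst.sub continuous_snd)).mul (r.continuous.comp continuous_snd)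

theorem integrable_cutKernel (σ : ℝ) (r : 𝓢(Space d, ℂ)) (R : ℕ) (y : Space d) :
    Integrable (cutKernel σ r R y) := by
  refine ((r.integrable (μ := volume)).norm.const_mul (∫ η, ‖cutSymbol d σ R η‖)).mono'
    ((continuous_cutKernel σ r R).comp (Continuous.prodMk_right y)).aestronglyMeasurable
    (Eventually.of_forall fun x => ?_)
  unfold cutKernel
  rw [norm_mul]
  refine mul_le_mul_of_nonneg_right ((norm_integral_le_integral_norm _).trans (le_of_eq ?_))
    (norm_nonneg _)
  refine integral_congr_ae (Eventually.of_forall fun η => ?_)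
  dsimp only
  rw [norm_mul, Complex.norm_exp_I_mul_ofReal, one_mul]

theorem integral_cutKernel_mul_exp (σ : ℝ) (r φ : 𝓢(Space d, ℂ))
    (hφ : ∀ η, φ η = ∫ x, Complex.exp (Complex.I * (-(2 * Real.pi * inner ℝ x η) : ℝ)) * r x)
    (R : ℕ) (y ξ : Space d) :
    ∫ x, cutKernel σ r R y x * Complex.exp (-Complex.I * (inner ℝ ξ x : ℝ)) =
      modulatedMultiplier φ (cutSymbol d σ R) ξ y := by
  unfold cutKernel modulatedMultiplier
  simp_rw [hφ, ← integral_mul_const, ← integral_const_mul]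
  rw [integral_integral_swap]
  · refine integral_congr_ae (Eventually.of_forall fun η => ?_)
    refine integral_congr_ae (Eventually.of_forall fun x => ?_)
    have h1 : Complex.exp (Complex.I * (2 * Real.pi * inner ℝ η (y - x) : ℝ)) *
        Complex.exp (-Complex.I * (inner ℝ ξ x : ℝ)) =
        Complex.exp (Complex.I * (2 * Real.pi * inner ℝ η y : ℝ)) *
        Complex.exp (Complex.I *
          (-(2 * Real.pi * inner ℝ x (η + (2 * Real.pi)⁻¹ • ξ)) : ℝ)) := by
      rw [← Complex.exp_add, ← Complex.exp_add, inner_sub_right, inner_add_right, inner_smul_right,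
        real_inner_comm x η, real_inner_comm x ξ]
      congr 1
      have : (Real.pi : ℂ) ≠ 0 := by exact_mod_cast Real.pi_ne_zero
      push_cast
      field_simp
      ring
    linear_combination (cutSymbol d σ R η * r x) * h1
  · have h1 : Integrable (fun z : Space d × Space d => r z.1 * cutSymbol d σ R z.2)
        (volume.prod volume) :=
      (r.integrable (μ := volume)).mul_prod (integrable_cutSymbol σ R)
    refine h1.mono ?_ (Eventually.of_forall fun z => ?_)
    · have h2 : AEStronglyMeasurable (fun z : Space d × Space d => cutSymbol d σ R z.2)
          (volume.prod volume) :=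
        ((measurable_cutSymbol σ R).comp measurable_snd).aestronglyMeasurable
      have h3 : Continuous fun z : Space d × Space d =>
          Complex.exp (Complex.I * (2 * Real.pi * inner ℝ z.2 (y - z.1) : ℝ)) := by fun_prop
      have h4 : Continuous fun z : Space d × Space d =>
          Complex.exp (-Complex.I * (inner ℝ ξ z.1 : ℝ)) := by fun_prop
      exact ((h3.aestronglyMeasurable.mul h2).mul
        (r.continuous.comp continuous_fst).aestronglyMeasurable).mul h4.aestronglyMeasurable
    · have h5 : ‖Complex.exp (-Complex.I * (inner ℝ ξ z.1 : ℝ))‖ = 1 := by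
        have := Complex.norm_exp_I_mul_ofReal (-inner ℝ ξ z.1)
        push_cast at this
        simpa only [mul_neg, ← neg_mul] using this
      simp only [Function.uncurry]
      rw [norm_mul, norm_mul, norm_mul, norm_mul, h5, Complex.norm_exp_I_mul_ofReal]
      linarith

/-- The field `(1 - Δ)^(σ/2) (r Ψ_n(t))`, the Bessel operator being truncated by
`cutSymbol` to the frequencies `‖η‖ ≤ R` of `𝓕`. -/
def regField (σ : ℝ) (r : 𝓢(Space d, ℂ)) (Ψ : ℕ → Icc (0 : ℝ) T → Space d → Ω → ℂ)
    (u : Icc (0 : ℝ) T × ℕ × ℕ) (ω : Ω) (y : Space d) : ℂ :=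
  ∫ x, cutKernel σ r u.2.2 y x * Ψ u.2.1 u.1 x ω

theorem measurable_regField (σ : ℝ) (r : 𝓢(Space d, ℂ))
    (hcont : ∀ n ω, Continuous fun z : Icc (0 : ℝ) T × Space d => Ψ n z.1 z.2 ω)
    (hmeas : ∀ n t x, Measurable (Ψ n t x)) (u : Icc (0 : ℝ) T × ℕ × ℕ) :
    Measurable fun z : Space d × Ω => regField σ r Ψ u z.2 z.1 := by
  have h1 : Measurable fun z : Space d × Ω => Ψ u.2.1 u.1 z.1 z.2 :=
    measurable_uncurry_of_continuous_of_measurable (u := fun x ω => Ψ u.2.1 u.1 x ω)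
      (fun ω => (hcont u.2.1 ω).comp (Continuous.prodMk_right u.1)) (hmeas u.2.1 u.1)
  have h2 : Measurable fun z : (Space d × Ω) × Space d =>
      cutKernel σ r u.2.2 z.1.1 z.2 * Ψ u.2.1 u.1 z.2 z.1.2 :=
    ((continuous_cutKernel σ r u.2.2).measurable.comp
      ((measurable_fst.comp measurable_fst).prodMk measurable_snd)).mul
      (h1.comp (measurable_snd.prodMk (measurable_snd.comp measurable_fst)))
  exact (h2.stronglyMeasurable.integral_prod_right
    (f := fun (z : Space d × Ω) x => cutKernel σ r u.2.2 z.1 x * Ψ u.2.1 u.1 x z.2)).measurable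

theorem IsRegularizedConvolution.moment_regField_sub_le (hΨ : IsRegularizedConvolution α Ψ P)
    (hcont : ∀ n ω, Continuous fun z : Icc (0 : ℝ) T × Space d => Ψ n z.1 z.2 ω)
    (hmeas : ∀ n t x, Measurable (Ψ n t x)) {q : ℝ} (hq : 0 < q) {C : ℝ≥0∞} (hCt : C ≠ ∞)
    (hC : ∀ {Z : Ω → ℂ}, HasGaussianLaw Z P → ∫ ω, Z ω ∂P = 0 →
      ∫⁻ ω, ‖Z ω‖ₑ ^ q ∂P ≤ C * (∫⁻ ω, ‖Z ω‖ₑ ^ 2 ∂P) ^ (q / 2))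
    {r φ : 𝓢(Space d, ℂ)} (hr : HasCompactSupport r)
    (hφ : ∀ η, φ η = ∫ x, Complex.exp (Complex.I * (-(2 * Real.pi * inner ℝ x η) : ℝ)) * r x)
    (u v : Icc (0 : ℝ) T × ℕ × ℕ) (y : Space d) :
    ∫⁻ ω, ‖regField (-s) r Ψ u ω y - regField (-s) r Ψ v ω y‖ₑ ^ q ∂P ≤
      C * incrVariance α s T φ u.1 v.1 u.2.1 v.2.1 u.2.2 v.2.2 y ^ (q / 2) := by
  have hz : ∀ R, ∀ x ∉ tsupport r, cutKernel (-s) r R y x = 0 := fun R x hx => by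
    rw [cutKernel, image_eq_zero_of_notMem_tsupport hx, mul_zero]
  have h := hΨ.moment_integral_sub_le hcont hmeas hq hCt hC hr
    (integrable_cutKernel (-s) r u.2.2 y) (integrable_cutKernel (-s) r v.2.2 y)
    (hz _) (hz _) u.2.1 v.2.1 u.1 v.1
  refine h.trans (le_of_eq ?_)
  congr 2
  refine lintegral_congr fun z => ?_
  rw [integral_mul_spectralKernel, integral_mul_spectralKernel,
    integral_cutKernel_mul_exp _ _ _ hφ, integral_cutKernel_mul_exp _ _ _ hφ]

/-- The parameters `(t, n, R)` as a point of `ℝ³`, with `n = ∞` and `R = ∞` at finite distance. -/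
def paramEmb (u : Icc (0 : ℝ) T × ℕ × ℕ) : Fin 3 → ℝ :=
  ![u.1, 1 / ((u.2.1 : ℝ) + 1), 1 / ((u.2.2 : ℝ) + 1)]

theorem measurable_incrVariance (φ : 𝓢(Space d, ℂ)) (t r : Icc (0 : ℝ) T) (n m R S : ℕ) :
    Measurable (incrVariance α s T φ t r n m R S) := by
  have hm : ∀ (t : ℝ) (n R : ℕ), Measurable fun z : Space d × ℝ × Space d =>
      timeWave t (‖z.2.2‖ ^ 2) z.2.1 * ((freqProfile d α n z.2.2 : ℂ) *
        modulatedMultiplier φ (cutSymbol d (-s) R) z.2.2 z.1) := by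
    intro t n R
    refine Measurable.mul ?_ (Measurable.mul ?_ ?_)
    · have h : Measurable fun z : Space d × ℝ × Space d => (‖z.2.2‖ ^ 2, z.2.1) := by fun_prop
      exact (measurable_timeWave t).comp h
    · have h : Measurable fun z : Space d × ℝ × Space d => z.2.2 := by fun_prop
      exact Complex.measurable_ofReal.comp ((measurable_freqProfile n).comp h)
    · have h : Measurable fun z : Space d × ℝ × Space d => (z.2.2, z.1) := by fun_prop
      have h1 := (measurable_modulatedMultiplier φ (measurable_cutSymbol (d := d) (-s) R)).comp h
      exact h1
  have : SFinite (slabMeasure d T) := by unfold slabMeasure; infer_instance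
  exact Measurable.lintegral_prod_right' (((hm t n R).sub (hm r m S)).enorm.pow_const 2)

/-- Moments of the `L^p` norm of the increments of the regularized field. -/
theorem IsRegularizedConvolution.moment_eLpNorm_regField_sub_le [IsProbabilityMeasure P]
    (hΨ : IsRegularizedConvolution α Ψ P) (hT : 0 < T)
    (hcont : ∀ n ω, Continuous fun z : Icc (0 : ℝ) T × Space d => Ψ n z.1 z.2 ω)
    (hmeas : ∀ n t x, Measurable (Ψ n t x)) {θ : ℝ} (hθ0 : 0 < θ) (hθ1 : θ ≤ 1)
    (hθ : (d : ℝ) / 2 < α + s - θ) {p : ℝ≥0∞} (hp : 2 ≤ p) (hp' : p < ∞) {k : ℝ} (hk : 1 < k)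
    {r φ : 𝓢(Space d, ℂ)} (hr : HasCompactSupport r)
    (hφ : ∀ η, φ η = ∫ x, Complex.exp (Complex.I * (-(2 * Real.pi * inner ℝ x η) : ℝ)) * r x) :
    ∃ M : ℝ≥0∞, M ≠ ∞ ∧ ∀ u v : Icc (0 : ℝ) T × ℕ × ℕ,
      ∫⁻ ω, eLpNorm (fun y => regField (-s) r Ψ u ω y - regField (-s) r Ψ v ω y) p volume
        ^ (p.toReal * k) ∂P ≤
      M * ENNReal.ofReal (dist (paramEmb u) (paramEmb v)) ^ (θ * (p.toReal * k / 2)) := by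
  have hpr : 2 ≤ p.toReal := by
    have := ENNReal.toReal_mono hp'.ne hp
    simpa using this
  set pr := p.toReal with hprdef
  have hk0 : 0 < k := by linarith
  have hpr0 : 0 < pr := by linarith
  have hq : 0 < pr * k := by positivity
  obtain ⟨C, hCt, hC⟩ := exists_gaussian_moment_bound (pr * k) hq
  obtain ⟨B, hB, hBb⟩ := exists_incrVariance_bound hT hθ0 hθ1 hθ φ
  refine ⟨C * ENNReal.ofReal B ^ (pr * k / 2), by finiteness, fun u v => ?_⟩
  set Δ := dist (paramEmb u) (paramEmb v) with hΔ
  have hd : ∀ i, |paramEmb u i - paramEmb v i| ≤ Δ := fun i => by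
    rw [← Real.dist_eq]; exact dist_le_pi_dist _ _ i
  have hV := hBb u.1 v.1 u.2.1 v.2.1 u.2.2 v.2.2 Δ (hd 0) (hd 1) (hd 2)
  set V := incrVariance α s T φ u.1 v.1 u.2.1 v.2.1 u.2.2 v.2.2 with hVdef
  have hVm : Measurable V := measurable_incrVariance φ _ _ _ _ _ _
  have hVy : ∀ y, V y ≤ ENNReal.ofReal (B * Δ ^ θ) := by
    intro y
    have := hV (Measure.dirac y) (Or.inr ⟨y, rfl⟩)
    rwa [lintegral_dirac' _ hVm] at this
  have hV1 := hV volume (Or.inl rfl)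
  have hW : ∫⁻ y, V y ^ (pr / 2) ≤ ENNReal.ofReal (B * Δ ^ θ) ^ (pr / 2) := by
    calc ∫⁻ y, V y ^ (pr / 2) ≤ ∫⁻ y, ENNReal.ofReal (B * Δ ^ θ) ^ (pr / 2 - 1) * V y := by
          refine lintegral_mono fun y => ?_
          have e : V y ^ (pr / 2) = V y ^ (pr / 2 - 1) * V y := by
            conv_rhs => rw [← ENNReal.rpow_one (V y), ← ENNReal.rpow_mul, one_mul,
              ← ENNReal.rpow_add_of_nonneg _ _ (by linarith) (by linarith)]
            congr 1; ring
          dsimp only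
          rw [e]
          exact mul_le_mul_left (ENNReal.rpow_le_rpow (hVy y) (by linarith)) _
      _ ≤ ENNReal.ofReal (B * Δ ^ θ) ^ (pr / 2 - 1) * ENNReal.ofReal (B * Δ ^ θ) := by
          rw [lintegral_const_mul _ hVm]
          exact mul_le_mul_right hV1 _
      _ = _ := by
          conv_lhs =>
            rw [← ENNReal.rpow_one (ENNReal.ofReal (B * Δ ^ θ)), ← ENNReal.rpow_mul, one_mul,
              ← ENNReal.rpow_add_of_nonneg _ _ (by linarith) (by linarith)]
          congr 1; ring
  have hmF := measurable_regField (-s) r hcont hmeas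
  have hkey := lintegral_rpow_lintegral_le (μ := (volume : Measure (Space d))) (P := P)
    (g := fun y ω => ‖regField (-s) r Ψ u ω y - regField (-s) r Ψ v ω y‖ₑ ^ pr)
    (((hmF u).sub (hmF v)).enorm.pow_const pr) (hVm.pow_const (pr / 2))
    (hW.trans_lt (ENNReal.rpow_lt_top_of_nonneg (by positivity) ENNReal.ofReal_ne_top)).ne
    hk hCt (fun y => by
      have := hΨ.moment_regField_sub_le (s := s) hcont hmeas hq hCt hC hr hφ u v y
      simp_rw [← ENNReal.rpow_mul]
      rwa [show pr / 2 * k = pr * k / 2 by ring])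
  have hnorm : ∀ ω, eLpNorm (fun y => regField (-s) r Ψ u ω y - regField (-s) r Ψ v ω y) p volume
      ^ (pr * k) = (∫⁻ y, ‖regField (-s) r Ψ u ω y - regField (-s) r Ψ v ω y‖ₑ ^ pr) ^ k := by
    intro ω
    rw [eLpNorm_eq_lintegral_rpow_enorm_toReal (by rintro rfl; simp at hp) hp'.ne,
      ← ENNReal.rpow_mul, ← hprdef]
    congr 1
    field_simp
  simp_rw [hnorm]
  refine hkey.trans ?_
  rw [mul_assoc]
  refine mul_le_mul_right ?_ _
  refine (ENNReal.rpow_le_rpow hW hk0.le).trans (le_of_eq ?_)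
  rw [ENNReal.ofReal_mul hB, ← ENNReal.rpow_mul, show pr / 2 * k = pr * k / 2 by ring,
    ENNReal.mul_rpow_of_nonneg _ _ (by positivity), ENNReal.rpow_mul,
    ENNReal.ofReal_rpow_of_nonneg dist_nonneg hθ0.le]

end

/-! ### The truncated Bessel operators and the Sobolev space -/

section

open FourierTransform

variable {d : ℕ}

theorem integral_fourier_mul_eq {f g : Space d → ℂ} (hf : Integrable f) (hg : Integrable g) :
    ∫ ξ, 𝓕 f ξ * g ξ = ∫ x, f x * 𝓕 g x := by
  have h := VectorFourier.integral_fourierIntegral_smul_eq_flip (μ := volume) (ν := volume)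
    (L := innerₗ (Space d)) Real.continuous_fourierChar (by exact continuous_inner) hf hg
  rw [flip_innerₗ] at h
  exact h

theorem integral_fourierInv_mul_eq {f g : Space d → ℂ} (hf : Integrable f) (hg : Integrable g) :
    ∫ ξ, 𝓕⁻ f ξ * g ξ = ∫ x, f x * 𝓕⁻ g x := by
  have h := integral_fourier_mul_eq hf hg.comp_neg
  rw [Real.fourierInv_eq_fourier_comp_neg g, ← h,
    ← integral_neg_eq_self (fun ξ => 𝓕 f ξ * g (-ξ))]
  refine integral_congr_ae (Eventually.of_forall fun ξ => ?_)
  dsimp only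
  rw [Real.fourierInv_eq_fourier_neg, neg_neg]

/-- The operator `(1 - Δ)^(σ/2)` truncated at the frequencies of norm at most `2π R`. -/
def cutBessel (σ : ℝ) (R : ℕ) (g : Space d → ℂ) : Space d → ℂ :=
  𝓕⁻ fun η => cutSymbol d σ R η * 𝓕 g η

theorem continuous_fourier_of_integrable {g : Space d → ℂ} (hg : Integrable g) :
    Continuous (𝓕 g) :=
  VectorFourier.fourierIntegral_continuous Real.continuous_fourierChar
    (by exact continuous_inner) hg

theorem norm_fourier_le (g : Space d → ℂ) (η : Space d) : ‖𝓕 g η‖ ≤ ∫ x, ‖g x‖ :=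
  VectorFourier.norm_fourierIntegral_le_integral_norm _ _ _ _ _

theorem memLp_cutSymbol (σ : ℝ) (R : ℕ) : MemLp (cutSymbol d σ R) 2 := by
  have h : Continuous fun η : Space d => (besselSymbol d σ η : ℂ) :=
    Complex.continuous_ofReal.comp (continuous_besselSymbol σ)
  rw [cutSymbol, memLp_indicator_iff_restrict Metric.isClosed_closedBall.measurableSet]
  exact (memLp_two_iff_integrable_sq_norm h.aestronglyMeasurable.restrict).2
    ((h.norm.pow 2).continuousOn.integrableOn_compact (isCompact_closedBall 0 (R : ℝ)))

theorem integrable_cutSymbol_mul_fourier (σ : ℝ) (R : ℕ) {g : Space d → ℂ} (hg : Integrable g) :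
    Integrable fun η => cutSymbol d σ R η * 𝓕 g η :=
  (integrable_cutSymbol σ R).mul_bdd (continuous_fourier_of_integrable hg).aestronglyMeasurable
    (Eventually.of_forall (norm_fourier_le g))

theorem integral_cutKernel_mul (σ : ℝ) (R : ℕ) {g : Space d → ℂ} (hg : Integrable g) (y : Space d) :
    ∫ x, 𝓕⁻ (cutSymbol d σ R) (y - x) * g x = cutBessel σ R g y := by
  have h := integral_fourier_mul_eq (integrable_exp_mul (integrable_cutSymbol σ R) y) hg
  have h1 : ∀ x, 𝓕⁻ (cutSymbol d σ R) (y - x) = 𝓕 (fun η : Space d =>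
      Complex.exp (Complex.I * (2 * Real.pi * inner ℝ η y : ℝ)) * cutSymbol d σ R η) x := by
    intro x
    rw [fourierInv_eq_integral_exp, Real.fourier_eq']
    refine integral_congr_ae (Eventually.of_forall fun η => ?_)
    dsimp only
    rw [smul_eq_mul, ← mul_assoc, ← Complex.exp_add, inner_sub_right]
    congr 2
    push_cast
    ring
  simp_rw [h1]
  rw [h, cutBessel, fourierInv_eq_integral_exp]
  simp_rw [mul_assoc]

theorem memLp_cutBessel (σ : ℝ) (R : ℕ) {g : Space d → ℂ} (hg : Integrable g) {p : ℝ≥0∞}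
    (hp : 2 ≤ p) (hp' : p < ∞) : MemLp (cutBessel σ R g) p := by
  set a := fun η => cutSymbol d σ R η * 𝓕 g η with ha
  have h1 : Integrable a := integrable_cutSymbol_mul_fourier σ R hg
  have h2 : MemLp a 2 :=
    (memLp_cutSymbol σ R).of_le_mul (c := ∫ x, ‖g x‖) h1.1 (Eventually.of_forall fun η => by
      rw [ha, norm_mul, mul_comm]
      exact mul_le_mul_of_nonneg_right (norm_fourier_le g η) (norm_nonneg _))
  have hcont : Continuous (𝓕⁻ a) := by
    rw [Real.fourierInv_eq_fourier_comp_neg]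
    exact continuous_fourier_of_integrable h1.comp_neg
  have hbdd : ∀ y, ‖𝓕⁻ a y‖ₑ ≤ ENNReal.ofReal (∫ η, ‖a η‖) := fun y => by
    rw [Real.fourierInv_eq_fourier_neg, ← ofReal_norm]
    exact ENNReal.ofReal_le_ofReal (norm_fourier_le a _)
  have hL2 : ∫⁻ y, ‖𝓕⁻ a y‖ₑ ^ 2 ≠ ∞ := by
    rw [lintegral_enorm_fourierInv_sq h1 h2]
    have := h2.2
    rw [eLpNorm_lt_top_iff_lintegral_rpow_enorm_lt_top (by norm_num) (by norm_num)] at this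
    simpa using this.ne
  have hpr : 2 ≤ p.toReal := by
    have := ENNReal.toReal_mono hp'.ne hp
    simpa using this
  refine ⟨hcont.aestronglyMeasurable, ?_⟩
  rw [eLpNorm_lt_top_iff_lintegral_rpow_enorm_lt_top (by rintro rfl; simp at hp) hp'.ne]
  calc ∫⁻ y, ‖𝓕⁻ a y‖ₑ ^ p.toReal
      ≤ ∫⁻ y, ENNReal.ofReal (∫ η, ‖a η‖) ^ (p.toReal - 2) * ‖𝓕⁻ a y‖ₑ ^ 2 := by
        refine lintegral_mono fun y => ?_
        have e : ‖𝓕⁻ a y‖ₑ ^ p.toReal = ‖𝓕⁻ a y‖ₑ ^ (p.toReal - 2) * ‖𝓕⁻ a y‖ₑ ^ 2 := by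
          rw [← ENNReal.rpow_natCast, ← ENNReal.rpow_add_of_nonneg _ _ (by linarith) (by simp)]
          norm_num
        dsimp only
        rw [e]
        exact mul_le_mul_left (ENNReal.rpow_le_rpow (hbdd y) (by linarith)) _
    _ < ∞ := by
        rw [lintegral_const_mul' _ _ (by
          exact ENNReal.rpow_ne_top_of_nonneg (by linarith) ENNReal.ofReal_ne_top)]
        exact ENNReal.mul_lt_top (ENNReal.rpow_lt_top_of_nonneg (by linarith)
          ENNReal.ofReal_ne_top) hL2.lt_top

/-- The truncated Bessel operators converge to the Bessel operator in the sense of tempered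
distributions. -/
theorem tendsto_integral_mul_cutBessel (σ : ℝ) {g : Space d → ℂ} (hg : Integrable g)
    (φ : 𝓢(Space d, ℂ)) :
    Tendsto (fun R : ℕ => ∫ y, φ y * cutBessel σ R g y) atTop
      (𝓝 (∫ x, 𝓕 (SchwartzMap.smulLeftCLM ℂ (fun ξ : Space d => (besselSymbol d σ ξ : ℂ))
        (𝓕⁻ φ)) x * g x)) := by
  obtain ⟨ψ, hψ⟩ : ∃ ψ, ψ = SchwartzMap.smulLeftCLM ℂ
    (fun ξ : Space d => (besselSymbol d σ ξ : ℂ)) (𝓕⁻ φ) := ⟨_, rfl⟩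
  have hψ1 : ∀ η, ψ η = besselSymbol d σ η * 𝓕⁻ (φ : Space d → ℂ) η := fun η => by
    rw [hψ, SchwartzMap.smulLeftCLM_apply_apply (besselSymbol_hasTemperateGrowth d _),
      SchwartzMap.fourierInv_coe, smul_eq_mul]
  rw [← hψ, SchwartzMap.fourier_coe, integral_fourier_mul_eq (ψ.integrable (μ := volume)) hg]
  have h1 : ∀ R : ℕ, ∫ y, φ y * cutBessel σ R g y =
      ∫ η, indicator (Metric.closedBall 0 R) (fun η => ψ η * 𝓕 g η) η := by
    intro R
    rw [cutBessel, ← integral_fourierInv_mul_eq (φ.integrable (μ := volume))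
      (integrable_cutSymbol_mul_fourier σ R hg)]
    refine integral_congr_ae (Eventually.of_forall fun η => ?_)
    dsimp only
    by_cases h : η ∈ Metric.closedBall (0 : Space d) R
    · rw [cutSymbol, indicator_of_mem h, indicator_of_mem h, hψ1]
      ring
    · rw [cutSymbol, indicator_of_notMem h, indicator_of_notMem h]
      ring
  simp_rw [h1]
  have hint : Integrable fun η => ψ η * 𝓕 g η :=
    (ψ.integrable (μ := volume)).mul_bdd (continuous_fourier_of_integrable hg).aestronglyMeasurable
      (Eventually.of_forall (norm_fourier_le g))
  refine tendsto_integral_of_dominated_convergence _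
    (fun R => hint.1.indicator Metric.isClosed_closedBall.measurableSet) hint.norm
    (fun R => Eventually.of_forall fun η => norm_indicator_le_norm_self _ _)
    (Eventually.of_forall fun η => ?_)
  refine tendsto_const_nhds.congr' ?_
  filter_upwards [eventually_ge_atTop ⌈‖η‖⌉₊] with R hR
  rw [indicator_of_mem]
  simpa using Nat.ceil_le.1 hR

section

variable (σ : ℝ) (p : ℝ≥0∞) [Fact (1 ≤ p)]

theorem lpEmb_apply (f : Lp ℂ p (volume : Measure (Space d))) (φ : 𝓢(Space d, ℂ)) :
    lpEmb d p f φ = ∫ x, φ x * f x :=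
  Lp.toTemperedDistribution_apply f φ

theorem tendsto_lpEmb {f : ℕ → Lp ℂ p (volume : Measure (Space d))} {f₀ : Lp ℂ p volume}
    (h : Tendsto f atTop (𝓝 f₀)) (φ : 𝓢(Space d, ℂ)) :
    Tendsto (fun k => lpEmb d p (f k) φ) atTop (𝓝 (lpEmb d p f₀ φ)) := by
  have h1 := ((Lp.toTemperedDistributionCLM ℂ (volume : Measure (Space d)) p).continuous.tendsto
    f₀).comp h
  exact ((PointwiseConvergenceCLM.evalCLM (RingHom.id ℂ) ℂ φ).continuous.tendsto _).comp h1

theorem SobolevSpace.exists_of_besselOp_eq {f : 𝓢'(Space d, ℂ)}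
    {F : Lp ℂ p (volume : Measure (Space d))} (h : besselOp d σ f = lpEmb d p F) :
    ∃ G : SobolevSpace d σ p, SobolevSpace.toDistribution d σ p G = f ∧
      SobolevSpace.toLp d σ p G = F := by
  let G : sobolevSubmodule d σ p := ⟨f, ⟨F, h.symm⟩⟩
  exact ⟨G, rfl, lpEmb_injective d p ((SobolevSpace.lpEmb_toLp d σ p G).trans h)⟩

instance : CompleteSpace (SobolevSpace d σ p) := by
  have hiso : Isometry (SobolevSpace.toLp d σ p) :=
    AddMonoidHomClass.isometry_of_norm _ fun _ => rfl
  have hsurj : Function.Surjective (SobolevSpace.toLp d σ p) := by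
    intro g
    have hg : besselOp d σ (besselOp d (-σ) (lpEmb d p g)) = lpEmb d p g := by
      have := besselOp_neg_besselOp d (-σ) (lpEmb d p g)
      rwa [neg_neg] at this
    obtain ⟨G, -, hG⟩ := SobolevSpace.exists_of_besselOp_eq σ p hg
    exact ⟨G, hG⟩
  exact (hiso.isUniformInducing.completeSpace_congr hsurj).2 inferInstance

/-- A continuous function with compact support belongs to the Sobolev space as soon as the truncated
Bessel operators applied to it form a Cauchy sequence in `L^p`; the limit of that sequence gives its
norm. -/
theorem exists_sobolevSpace_of_cauchySeq {g : Space d → ℂ} (hg : Continuous g)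
    (hgc : HasCompactSupport g) (hm : ∀ R, MemLp (cutBessel σ R g) p)
    (hc : CauchySeq fun R => (hm R).toLp) :
    ∃ G : SobolevSpace d σ p, IsGivenBy (SobolevSpace.toDistribution d σ p G) g ∧
      Tendsto (fun R => (hm R).toLp) atTop (𝓝 (SobolevSpace.toLp d σ p G)) := by
  have hgi : Integrable g := hg.integrable_of_hasCompactSupport hgc
  obtain ⟨F, hF⟩ := cauchySeq_tendsto_of_complete hc
  have hgm : MemLp g p := hg.memLp_of_hasCompactSupport hgc
  have hD : ∀ φ : 𝓢(Space d, ℂ), lpEmb d p hgm.toLp φ = ∫ x, φ x * g x := by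
    intro φ
    rw [lpEmb_apply]
    refine integral_congr_ae ?_
    filter_upwards [hgm.coeFn_toLp] with x hx
    rw [hx]
  have hB : besselOp d σ (lpEmb d p hgm.toLp) = lpEmb d p F := by
    ext φ
    have h1 := tendsto_integral_mul_cutBessel σ hgi φ
    have h2 := tendsto_lpEmb p hF φ
    have h3 : ∀ R, lpEmb d p (hm R).toLp φ = ∫ y, φ y * cutBessel σ R g y := by
      intro R
      rw [lpEmb_apply]
      refine integral_congr_ae ?_
      filter_upwards [(hm R).coeFn_toLp] with x hx
      rw [hx]
    simp_rw [h3] at h2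
    rw [tendsto_nhds_unique h2 h1, besselOp, TemperedDistribution.fourierMultiplierCLM_apply_apply,
      hD]
  obtain ⟨G, hG1, hG2⟩ := SobolevSpace.exists_of_besselOp_eq σ p hB
  refine ⟨G, fun φ => ⟨?_, by rw [hG1]; exact hD φ⟩, by rwa [hG2]⟩
  have : Continuous fun x => φ x * g x := φ.continuous.mul hg
  exact this.integrable_of_hasCompactSupport hgc.mul_left

end

/-- A sequence of functions on a compact interval with a joint modulus of continuity in `t` and
`1 / (n + 1)` consists of continuous functions and converges uniformly. -/
theorem exists_tendsto_of_modulus {X E : Type*} [PseudoMetricSpace X] [CompactSpace X]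
    [NormedAddCommGroup E] [CompleteSpace E] {G : ℕ → X → E}
    (h : ∀ ε : ℝ, 0 < ε → ∃ η : ℝ, 0 < η ∧ ∀ (n m : ℕ) (t r : X), dist t r < η →
      |1 / ((n : ℝ) + 1) - 1 / ((m : ℝ) + 1)| < η → ‖G n t - G m r‖ ≤ ε) :
    ∃ (u : ℕ → C(X, E)) (v : C(X, E)), (∀ n t, u n t = G n t) ∧ Tendsto u atTop (𝓝 v) := by
  have hcont : ∀ n, Continuous (G n) := by
    intro n
    rw [Metric.continuous_iff]
    intro t ε hε
    obtain ⟨η, hη, H⟩ := h (ε / 2) (by positivity)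
    refine ⟨η, hη, fun r hr => ?_⟩
    rw [dist_eq_norm]
    exact (H n n r t hr (by simpa using hη)).trans_lt (by linarith)
  let u : ℕ → C(X, E) := fun n => ⟨G n, hcont n⟩
  have hu : CauchySeq u := by
    rw [Metric.cauchySeq_iff]
    intro ε hε
    obtain ⟨η, hη, H⟩ := h (ε / 2) (by positivity)
    obtain ⟨N, hN⟩ := exists_nat_one_div_lt hη
    refine ⟨N, fun n hn m hm => ?_⟩
    refine lt_of_le_of_lt ((ContinuousMap.dist_le (by positivity : 0 ≤ ε / 2)).2 fun t => ?_)
      (by linarith)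
    rw [dist_eq_norm]
    refine H n m t t (by simpa using hη) ?_
    have hb : ∀ n : ℕ, N ≤ n → 1 / ((n : ℝ) + 1) ≤ 1 / ((N : ℝ) + 1) := fun n hn =>
      one_div_le_one_div_of_le (by positivity) (by gcongr)
    have h0 : ∀ n : ℕ, 0 ≤ 1 / ((n : ℝ) + 1) := fun n => by positivity
    rw [abs_lt]
    constructor <;> linarith [hb n hn, hb m hm, h0 n, h0 m]
  obtain ⟨v, hv⟩ := cauchySeq_tendsto_of_complete hu
  exact ⟨u, v, fun _ _ => rfl, hv⟩

/-- The deterministic part of the convergence: a joint modulus of continuity of the regularizations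
in the parameters `(t, n, R)` yields the convergence of the sequence in `C([0, T]; W^{σ,p})`. -/
theorem exists_tendsto_sobolevSpace {T : ℝ} (σ : ℝ) (p : ℝ≥0∞) [Fact (1 ≤ p)] (hp : 2 ≤ p)
    (hp' : p < ∞) {f : ℕ → Icc (0 : ℝ) T → Space d → ℂ} (hf : ∀ n t, Continuous (f n t))
    (hfc : ∀ n t, HasCompactSupport (f n t))
    (h : ∀ ε : ℝ≥0∞, 0 < ε → ∃ η : ℝ, 0 < η ∧ ∀ u v : Icc (0 : ℝ) T × ℕ × ℕ,
      dist (paramEmb u) (paramEmb v) < η →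
      eLpNorm (cutBessel σ u.2.2 (f u.2.1 u.1) - cutBessel σ v.2.2 (f v.2.1 v.1)) p volume ≤ ε) :
    ∃ (u : ℕ → C(Icc (0 : ℝ) T, SobolevSpace d σ p)) (v : C(Icc (0 : ℝ) T, SobolevSpace d σ p)),
      (∀ n t, IsGivenBy (SobolevSpace.toDistribution d σ p (u n t)) (f n t)) ∧
      Tendsto u atTop (𝓝 v) := by
  have hm : ∀ n t R, MemLp (cutBessel σ R (f n t)) p := fun n t R =>
    memLp_cutBessel σ R ((hf n t).integrable_of_hasCompactSupport (hfc n t)) hp hp'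
  have hmod : ∀ ε : ℝ, 0 < ε → ∃ η : ℝ, 0 < η ∧ ∀ (n m : ℕ) (t r : Icc (0 : ℝ) T)
      (R S : ℕ), |(t : ℝ) - r| < η →
      |1 / ((n : ℝ) + 1) - 1 / ((m : ℝ) + 1)| < η → |1 / ((R : ℝ) + 1) - 1 / ((S : ℝ) + 1)| < η →
      ‖(hm n t R).toLp - (hm m r S).toLp‖ ≤ ε := by
    intro ε hε
    obtain ⟨η, hη, H⟩ := h (ENNReal.ofReal ε) (by simpa using hε)
    refine ⟨η, hη, fun n m t r R S h1 h2 h3 => ?_⟩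
    have h4 := H (t, n, R) (r, m, S) ((dist_pi_lt_iff hη).2 fun i => by
      fin_cases i
      · exact h1
      · exact h2
      · exact h3)
    rw [← MemLp.toLp_sub, Lp.norm_toLp]
    exact ENNReal.toReal_le_of_le_ofReal hε.le h4
  have hcauchy : ∀ n t, CauchySeq fun R => (hm n t R).toLp := by
    intro n t
    rw [Metric.cauchySeq_iff]
    intro ε hε
    obtain ⟨η, hη, H⟩ := hmod (ε / 2) (by positivity)
    obtain ⟨N, hN⟩ := exists_nat_one_div_lt hη
    refine ⟨N, fun R hR S hS => ?_⟩
    rw [dist_eq_norm]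
    refine lt_of_le_of_lt (H n n t t R S (by simpa using hη) (by simpa using hη) ?_)
      (by linarith)
    have hb : ∀ n : ℕ, N ≤ n → 1 / ((n : ℝ) + 1) ≤ 1 / ((N : ℝ) + 1) := fun n hn =>
      one_div_le_one_div_of_le (by positivity) (by gcongr)
    have h0 : ∀ n : ℕ, 0 ≤ 1 / ((n : ℝ) + 1) := fun n => by positivity
    rw [abs_lt]
    constructor <;> linarith [hb R hR, hb S hS, h0 R, h0 S]
  choose G hG hGt using fun n t =>
    exists_sobolevSpace_of_cauchySeq σ p (hf n t) (hfc n t) (hm n t) (hcauchy n t)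
  obtain ⟨u, v, hu, huv⟩ := exists_tendsto_of_modulus (G := G) fun ε hε => by
    obtain ⟨η, hη, H⟩ := hmod ε hε
    refine ⟨η, hη, fun n m t r h1 h2 => ?_⟩
    have h3 := ((hGt n t).sub (hGt m r)).norm
    have h4 : ‖G n t - G m r‖ =
        ‖SobolevSpace.toLp d σ p (G n t) - SobolevSpace.toLp d σ p (G m r)‖ := by
      rw [← map_sub]
      rfl
    rw [h4]
    exact le_of_tendsto h3 (Eventually.of_forall fun R =>
      H n m t r R R h1 h2 (by simpa using hη))
  exact ⟨u, v, fun n t => by rw [hu]; exact hG n t, huv⟩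

end

/-! ### Almost sure convergence of the localized sequence -/

section

open FourierTransform

variable {d : ℕ} {T α s : ℝ} {Ω : Type*}
  {Ψ : ℕ → Icc (0 : ℝ) T → Space d → Ω → ℂ}

theorem regField_eq_cutBessel (σ : ℝ) {r : 𝓢(Space d, ℂ)} (hr : HasCompactSupport r)
    (hcont : ∀ n ω, Continuous fun z : Icc (0 : ℝ) T × Space d => Ψ n z.1 z.2 ω)
    (u : Icc (0 : ℝ) T × ℕ × ℕ) (ω : Ω) :
    regField σ r Ψ u ω = cutBessel σ u.2.2 fun x => r x * Ψ u.2.1 u.1 x ω := by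
  funext y
  have hc : Continuous fun x => r x * Ψ u.2.1 u.1 x ω :=
    r.continuous.mul ((hcont u.2.1 ω).comp (Continuous.prodMk_right u.1))
  rw [← integral_cutKernel_mul σ u.2.2 (hc.integrable_of_hasCompactSupport hr.mul_right) y]
  unfold regField
  simp_rw [cutKernel_eq, mul_assoc]

theorem continuous_regField_time (σ : ℝ) {r : 𝓢(Space d, ℂ)} (hr : HasCompactSupport r)
    (hcont : ∀ n ω, Continuous fun z : Icc (0 : ℝ) T × Space d => Ψ n z.1 z.2 ω)
    (n R : ℕ) (ω : Ω) (y : Space d) :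
    Continuous fun t : Icc (0 : ℝ) T => regField σ r Ψ (t, n, R) ω y := by
  have h1 : ∀ t : Icc (0 : ℝ) T, regField σ r Ψ (t, n, R) ω y =
      ∫ x in tsupport r, cutKernel σ r R y x * Ψ n t x ω := by
    intro t
    refine (setIntegral_eq_integral_of_forall_compl_eq_zero fun x hx => ?_).symm
    rw [cutKernel, image_eq_zero_of_notMem_tsupport hx, mul_zero, zero_mul]
  simp_rw [h1]
  refine continuous_parametric_integral_of_continuous
    (f := fun (t : Icc (0 : ℝ) T) x => cutKernel σ r R y x * Ψ n t x ω) ?_ hr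
  exact ((continuous_cutKernel σ r R).comp (continuous_const.prodMk continuous_snd)).mul (hcont n ω)

variable [MeasurableSpace Ω] {P : Measure Ω}

theorem IsRegularizedConvolution.ae_modulus_regField [IsProbabilityMeasure P]
    (hΨ : IsRegularizedConvolution α Ψ P) (hT : 0 < T) (hs : (d : ℝ) / 2 - α < s)
    (hcont : ∀ n ω, Continuous fun z : Icc (0 : ℝ) T × Space d => Ψ n z.1 z.2 ω)
    (hmeas : ∀ n t x, Measurable (Ψ n t x)) {p : ℝ≥0∞} (hp : 2 ≤ p) (hp' : p < ∞)
    {r : 𝓢(Space d, ℂ)} (hr : HasCompactSupport r) :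
    ∀ᵐ ω ∂P, ∀ ε : ℝ≥0∞, 0 < ε → ∃ η : ℝ, 0 < η ∧ ∀ u v : Icc (0 : ℝ) T × ℕ × ℕ,
      dist (paramEmb u) (paramEmb v) < η →
      eLpNorm (regField (-s) r Ψ u ω - regField (-s) r Ψ v ω) p volume ≤ ε := by
  have hpr : 2 ≤ p.toReal := by
    have := ENNReal.toReal_mono hp'.ne hp
    simpa using this
  have hp1 : 1 ≤ p := le_trans (by norm_num) hp
  set θ := min 1 ((α + s - d / 2) / 2) with hθdef
  have hθ0 : 0 < θ := lt_min one_pos (by linarith)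
  have hθ : (d : ℝ) / 2 < α + s - θ := by
    have := min_le_right 1 ((α + s - d / 2) / 2)
    linarith
  -- the exponent is taken so large that Kolmogorov's criterion applies with three parameters
  set k := 1 + 7 / θ with hkdef
  have hk : 1 < k := by rw [hkdef]; have : 0 < 7 / θ := by positivity
                        linarith
  have hθk : 6 < θ * (p.toReal * k / 2) := by
    have h1 : θ * k = θ + 7 := by rw [hkdef]; field_simp
    nlinarith
  obtain ⟨φ, hφ⟩ : ∃ φ : 𝓢(Space d, ℂ),
      ∀ η, φ η = ∫ x, Complex.exp (Complex.I * (-(2 * Real.pi * inner ℝ x η) : ℝ)) * r x := by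
    refine ⟨𝓕 r, fun η => ?_⟩
    rw [SchwartzMap.fourier_coe, Real.fourier_eq']
    refine integral_congr_ae (Eventually.of_forall fun x => ?_)
    dsimp only
    rw [smul_eq_mul, mul_comm Complex.I, ← neg_mul, ← neg_mul]
  obtain ⟨M, hM, hMb⟩ := hΨ.moment_eLpNorm_regField_sub_le hT hcont hmeas hθ0 (min_le_left _ _) hθ
    hp hp' hk hr hφ
  have hF := measurable_regField (-s) r hcont hmeas
  have hFm : ∀ u ω, AEStronglyMeasurable (regField (-s) r Ψ u ω) volume := fun u ω =>
    ((hF u).comp measurable_prodMk_right).aestronglyMeasurable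
  have hR : ∀ (u : Icc (0 : ℝ) T × ℕ × ℕ) i, |paramEmb u i| ≤ T + 1 := by
    intro u i
    have h1 : ∀ n : ℕ, |1 / ((n : ℝ) + 1)| ≤ T + 1 := fun n => by
      rw [abs_of_nonneg (by positivity), div_le_iff₀ (by positivity)]
      have : (0 : ℝ) ≤ n := n.cast_nonneg
      nlinarith
    fin_cases i
    · have := u.1.2
      change |(u.1 : ℝ)| ≤ T + 1
      rw [abs_of_nonneg this.1]
      linarith [this.2]
    · exact h1 _
    · exact h1 _
  obtain ⟨D, hDc, hDd⟩ := TopologicalSpace.exists_countable_dense (Icc (0 : ℝ) T)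
  have hkol := kolmogorov_criterion (P := P) paramEmb hR
    (fun u v ω => eLpNorm (regField (-s) r Ψ u ω - regField (-s) r Ψ v ω) p volume)
    (fun u v ω => eLpNorm_sub_comm _ _ _ _)
    (fun u v w ω => by
      rw [← sub_add_sub_cancel (regField (-s) r Ψ u ω) (regField (-s) r Ψ v ω)]
      exact eLpNorm_add_le ((hFm u ω).sub (hFm v ω)) ((hFm v ω).sub (hFm w ω)) hp1)
    (fun u v => by
      have h1 : Measurable fun z : Ω × Space d =>
          ‖regField (-s) r Ψ u z.1 z.2 - regField (-s) r Ψ v z.1 z.2‖ₑ ^ p.toReal :=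
        ((((hF u).comp measurable_swap).sub ((hF v).comp measurable_swap)).enorm).pow_const _
      have h2 : Measurable fun ω => (∫⁻ y,
          ‖regField (-s) r Ψ u ω y - regField (-s) r Ψ v ω y‖ₑ ^ p.toReal) ^ (1 / p.toReal) :=
        h1.lintegral_prod_right'.pow_const _
      refine h2.aemeasurable.congr (Eventually.of_forall fun ω => ?_)
      exact (eLpNorm_eq_lintegral_rpow_enorm_toReal (by rintro rfl; simp at hp) hp'.ne).symm)
    (q := p.toReal * k) (by positivity) (β := θ * (p.toReal * k / 2)) (by simpa using by linarith)
    hM hMb (D := D ×ˢ univ) (hDc.prod (to_countable _))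
  filter_upwards [hkol] with ω hω ε hε
  obtain ⟨η, hη, H⟩ := hω ε hε
  refine ⟨η, hη, fun u v huv => ?_⟩
  -- extend the bound to all times by Fatou's lemma
  obtain ⟨t, n, R⟩ := u
  obtain ⟨t', m, S⟩ := v
  obtain ⟨a, haD, ha⟩ := mem_closure_iff_seq_limit.1 (hDd t)
  obtain ⟨b, hbD, hb⟩ := mem_closure_iff_seq_limit.1 (hDd t')
  have hcp : ∀ n R : ℕ, Continuous fun t : Icc (0 : ℝ) T => paramEmb (t, n, R) := fun n R => by
    refine continuous_pi fun i => ?_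
    fin_cases i
    · exact continuous_subtype_val
    · exact (continuous_const : Continuous fun _ : Icc (0 : ℝ) T => 1 / ((n : ℝ) + 1))
    · exact (continuous_const : Continuous fun _ : Icc (0 : ℝ) T => 1 / ((R : ℝ) + 1))
  have hev : ∀ᶠ j in atTop, eLpNorm (regField (-s) r Ψ (a j, n, R) ω -
      regField (-s) r Ψ (b j, m, S) ω) p volume ≤ ε := by
    have h1 := (((hcp n R).tendsto t).comp ha).dist (((hcp m S).tendsto t').comp hb)
    filter_upwards [h1.eventually (gt_mem_nhds huv)] with j hj
    exact H _ ⟨haD j, mem_univ _⟩ _ ⟨hbD j, mem_univ _⟩ hj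
  refine (Lp.eLpNorm_lim_le_liminf_eLpNorm (fun j => (hFm (a j, n, R) ω).sub (hFm (b j, m, S) ω)) _
    (Eventually.of_forall fun y => ?_)).trans
    (liminf_le_of_frequently_le' hev.frequently)
  exact (((continuous_regField_time (-s) hr hcont n R ω y).tendsto t).comp ha).sub
    (((continuous_regField_time (-s) hr hcont m S ω y).tendsto t').comp hb)

/-- Almost sure convergence of the localized sequence, for every almost surely continuous
modification. -/
theorem IsRegularizedConvolution.ae_tendsto_sobolevSpace [IsProbabilityMeasure P]
    (hΨ : IsRegularizedConvolution α Ψ P) (hT : 0 < T) (hs : (d : ℝ) / 2 - α < s)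
    {ρ : Space d → ℝ} (hρ : ContDiff ℝ (⊤ : ℕ∞) ρ) (hρc : HasCompactSupport ρ)
    {p : ℝ≥0∞} [Fact (1 ≤ p)] (hp : 2 ≤ p) (hp' : p < ∞)
    {Φ : ℕ → Icc (0 : ℝ) T → Space d → Ω → ℂ} (hΦ : IsContinuousModification Φ Ψ P) :
    ∀ᵐ ω ∂P, ∃ (u : ℕ → C(Icc (0 : ℝ) T, SobolevSpace d (-s) p))
      (v : C(Icc (0 : ℝ) T, SobolevSpace d (-s) p)),
      (∀ n t, IsGivenBy (SobolevSpace.toDistribution d (-s) p (u n t))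
        (fun x => (ρ x : ℂ) * Φ n t x ω)) ∧
      Tendsto u atTop (𝓝 v) := by
  obtain ⟨Φ', hΦ', hcont, hmeas⟩ := hΦ.exists_continuous_measurable
    fun n t x => hΨ.gaussian.aemeasurable (n, t, x)
  have hΨ' : IsRegularizedConvolution α Φ' P := hΨ.congr fun n t x => by
    filter_upwards [hΦ', hΦ.1 n t x] with ω h1 h2
    rw [h1, h2]
  have hρ' : ContDiff ℝ (⊤ : ℕ∞) fun x => (ρ x : ℂ) := Complex.ofRealCLM.contDiff.comp hρ
  have hρc' : HasCompactSupport fun x => (ρ x : ℂ) := hρc.comp_left (g := Complex.ofReal) rfl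
  obtain ⟨r, hr⟩ : ∃ r : 𝓢(Space d, ℂ), (r : Space d → ℂ) = fun x => (ρ x : ℂ) :=
    ⟨hρc'.toSchwartzMap hρ', rfl⟩
  have hrc : HasCompactSupport r := by rwa [hr]
  filter_upwards [hΦ', hΨ'.ae_modulus_regField hT hs hcont hmeas hp hp' hrc] with ω h1 h2
  simp only [regField_eq_cutBessel _ hrc hcont] at h2
  obtain ⟨u, v, hu, huv⟩ := exists_tendsto_sobolevSpace (-s) p hp hp'
    (f := fun n t x => r x * Φ' n t x ω)
    (fun n t => r.continuous.mul ((hcont n ω).comp (Continuous.prodMk_right t)))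
    (fun n t => hrc.mul_right) h2
  refine ⟨u, v, fun n t => ?_, huv⟩
  have := hu n t
  simpa only [hr, h1] using this

end

/-! ### Integrals with respect to a white noise -/

section

variable {d : ℕ} {T : ℝ} {Ω : Type*} [MeasurableSpace Ω] {W : (ℝ × Space d → ℝ) → Ω → ℝ}
  {P : Measure Ω}

theorem integral_add_sq {X : Type*} [MeasurableSpace X] {μ : Measure X} {a b : X → ℝ}
    (ha : MemLp a 2 μ) (hb : MemLp b 2 μ) :
    ∫ x, (a x + b x) ^ 2 ∂μ = ∫ x, a x ^ 2 ∂μ + ∫ x, b x ^ 2 ∂μ + 2 * ∫ x, a x * b x ∂μ := by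
  have h1 : Integrable (fun x => a x ^ 2 + b x ^ 2) μ := ha.integrable_sq.add hb.integrable_sq
  have h2 : Integrable (fun x => 2 * (a x * b x)) μ := (ha.integrable_mul hb).const_mul 2
  rw [← integral_const_mul, ← integral_add ha.integrable_sq hb.integrable_sq, ← integral_add h1 h2]
  refine integral_congr_ae (Eventually.of_forall fun x => ?_)
  dsimp only
  ring

namespace IsWhiteNoise

variable {f g : ℝ × Space d → ℝ}

theorem hasGaussianLaw (hW : IsWhiteNoise T W P) (hf : MemLp f 2 (slabMeasure d T)) : HasGaussianLaw (W f) P :=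
  (hW.hasLaw f hf).hasGaussianLaw

theorem integral_eq_zero (hW : IsWhiteNoise T W P) (hf : MemLp f 2 (slabMeasure d T)) : ∫ ω, W f ω ∂P = 0 := by
  rw [(hW.hasLaw f hf).integral_eq, integral_id_gaussianReal]

theorem integral_sq (hW : IsWhiteNoise T W P) (hf : MemLp f 2 (slabMeasure d T)) :
    ∫ ω, W f ω ^ 2 ∂P = ∫ z, f z ^ 2 ∂(slabMeasure d T) := by
  have h1 := (hW.hasLaw f hf).variance_eq
  rw [variance_id_gaussianReal, variance_of_integral_eq_zero
    (hW.hasLaw f hf).aemeasurable (hW.integral_eq_zero hf)] at h1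
  rw [h1, Real.coe_toNNReal _ (integral_nonneg fun _ => sq_nonneg _)]

/-- The Itô isometry, by polarization. -/
theorem integral_mul (hW : IsWhiteNoise T W P) (hf : MemLp f 2 (slabMeasure d T))
    (hg : MemLp g 2 (slabMeasure d T)) :
    ∫ ω, W f ω * W g ω ∂P = ∫ z, f z * g z ∂(slabMeasure d T) := by
  have h1 : ∫ ω, W (f + g) ω ^ 2 ∂P = ∫ ω, (W f ω + W g ω) ^ 2 ∂P := by
    refine integral_congr_ae ?_
    have := hW.linear f g hf hg 1 1
    simp only [one_smul] at this
    filter_upwards [this] with ω hω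
    rw [hω]
    rfl
  rw [hW.integral_sq (hf.add hg), integral_add_sq (hW.hasGaussianLaw hf).memLp_two
    (hW.hasGaussianLaw hg).memLp_two, hW.integral_sq hf, hW.integral_sq hg] at h1
  have h3 := integral_add_sq hf hg
  simp only [Pi.add_apply] at h1
  linarith

theorem map_sum (hW : IsWhiteNoise T W P) {ι : Type*} (s : Finset ι) {h : ι → ℝ × Space d → ℝ}
    (hh : ∀ i, MemLp (h i) 2 (slabMeasure d T)) :
    W (∑ i ∈ s, h i) =ᵐ[P] ∑ i ∈ s, W (h i) := by
  classical
  induction s using Finset.induction_on with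
  | empty =>
    have h0 : MemLp (0 : ℝ × Space d → ℝ) 2 (slabMeasure d T) := MemLp.zero
    have := hW.linear 0 0 h0 h0 0 0
    simpa using this
  | insert i s hi ih =>
    have h1 := hW.linear (h i) (∑ j ∈ s, h j) (hh i) (memLp_finsetSum' s fun j _ => hh j) 1 1
    simp only [one_smul] at h1
    rw [Finset.sum_insert hi, Finset.sum_insert hi]
    filter_upwards [h1, ih] with ω h1 h2
    rw [h1, Pi.add_apply, h2, Pi.add_apply]

end IsWhiteNoise

theorem integral_mul_add_I_mul {X : Type*} [MeasurableSpace X] {μ : Measure X} {a b a' b' : X → ℝ}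
    (ha : MemLp a 2 μ) (hb : MemLp b 2 μ) (ha' : MemLp a' 2 μ) (hb' : MemLp b' 2 μ) :
    ∫ x, ((a x : ℂ) + Complex.I * b x) * ((a' x : ℂ) + Complex.I * b' x) ∂μ =
      ((∫ x, a x * a' x ∂μ) - (∫ x, b x * b' x ∂μ) : ℝ) +
        Complex.I * ((∫ x, a x * b' x ∂μ) + (∫ x, b x * a' x ∂μ) : ℝ) := by
  have h1 : ∀ x, ((a x : ℂ) + Complex.I * b x) * ((a' x : ℂ) + Complex.I * b' x) =
      ((a x * a' x - b x * b' x : ℝ) : ℂ) +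
        Complex.I * ((a x * b' x + b x * a' x : ℝ) : ℂ) := by
    intro x
    push_cast
    linear_combination (b x * b' x : ℂ) * Complex.I_sq
  simp_rw [h1]
  have e1 : Integrable (fun x => a x * a' x - b x * b' x) μ :=
    (ha.integrable_mul ha').sub (hb.integrable_mul hb')
  have e2 : Integrable (fun x => a x * b' x + b x * a' x) μ :=
    (ha.integrable_mul hb').add (hb.integrable_mul ha')
  have e3 : ∫ x, (a x * a' x - b x * b' x) ∂μ = (∫ x, a x * a' x ∂μ) - ∫ x, b x * b' x ∂μ :=
    integral_sub (ha.integrable_mul ha') (hb.integrable_mul hb')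
  have e4 : ∫ x, (a x * b' x + b x * a' x) ∂μ = (∫ x, a x * b' x ∂μ) + ∫ x, b x * a' x ∂μ :=
    integral_add (ha.integrable_mul hb') (hb.integrable_mul ha')
  rw [integral_add e1.ofReal (e2.ofReal.const_mul _), integral_const_mul, integral_complex_ofReal,
    integral_complex_ofReal, e3, e4]

/-- The stochastic integral of a complex function. -/
def noiseInt (W : (ℝ × Space d → ℝ) → Ω → ℝ) (F : ℝ × Space d → ℂ) (ω : Ω) : ℂ :=
  W (fun z => (F z).re) ω + Complex.I * W (fun z => (F z).im) ω

theorem IsWhiteNoise.integral_noiseInt_mul (hW : IsWhiteNoise T W P) {F G : ℝ × Space d → ℂ}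
    (hF : MemLp F 2 (slabMeasure d T)) (hG : MemLp G 2 (slabMeasure d T)) :
    ∫ ω, noiseInt W F ω * noiseInt W G ω ∂P = ∫ z, F z * G z ∂(slabMeasure d T) := by
  have h : ∀ F : ℝ × Space d → ℂ, ∀ z, F z = ((F z).re : ℂ) + Complex.I * ((F z).im : ℂ) :=
    fun F z => by rw [mul_comm]; exact (Complex.re_add_im _).symm
  have m : ∀ {f}, MemLp f 2 (slabMeasure d T) → MemLp (W f) 2 P := fun hf =>
    (hW.hasGaussianLaw hf).memLp_two
  have e : ∫ z, F z * G z ∂(slabMeasure d T) = ∫ z, (((F z).re : ℂ) + Complex.I * ((F z).im : ℂ)) *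
      (((G z).re : ℂ) + Complex.I * ((G z).im : ℂ)) ∂(slabMeasure d T) :=
    integral_congr_ae (Eventually.of_forall fun z => by dsimp only; rw [← h F z, ← h G z])
  have hFr : MemLp (fun z => (F z).re) 2 (slabMeasure d T) := hF.re
  have hFi : MemLp (fun z => (F z).im) 2 (slabMeasure d T) := hF.im
  have hGr : MemLp (fun z => (G z).re) 2 (slabMeasure d T) := hG.re
  have hGi : MemLp (fun z => (G z).im) 2 (slabMeasure d T) := hG.im
  rw [e, integral_mul_add_I_mul hFr hFi hGr hGi]
  unfold noiseInt
  rw [integral_mul_add_I_mul (m hFr) (m hFi) (m hGr) (m hGi), hW.integral_mul hFr hGr,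
    hW.integral_mul hFi hGi, hW.integral_mul hFr hGi, hW.integral_mul hFi hGr]

theorem IsWhiteNoise.conj_noiseInt (hW : IsWhiteNoise T W P) {G : ℝ × Space d → ℂ}
    (hG : MemLp G 2 (slabMeasure d T)) :
    (fun ω => conj (noiseInt W G ω)) =ᵐ[P] noiseInt W fun z => conj (G z) := by
  have h := hW.linear _ _ hG.im hG.im (-1) 0
  have e : (-1 : ℝ) • (fun z => RCLike.im (G z)) + (0 : ℝ) • (fun z => RCLike.im (G z)) =
      fun z => (conj (G z)).im := by
    funext z
    simp
  rw [e] at h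
  filter_upwards [h] with ω hω
  unfold noiseInt
  rw [hω]
  simp

theorem IsWhiteNoise.integral_noiseInt_mul_conj (hW : IsWhiteNoise T W P) {F G : ℝ × Space d → ℂ}
    (hF : MemLp F 2 (slabMeasure d T)) (hG : MemLp G 2 (slabMeasure d T)) :
    ∫ ω, noiseInt W F ω * conj (noiseInt W G ω) ∂P =
      ∫ z, F z * conj (G z) ∂(slabMeasure d T) := by
  have hG' : MemLp (fun z => conj (G z)) 2 (slabMeasure d T) := hG.star
  rw [← hW.integral_noiseInt_mul hF hG']
  refine integral_congr_ae ?_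
  filter_upwards [hW.conj_noiseInt hG] with ω hω
  rw [hω]

/-- Stochastic integrals form a Gaussian process, since their real linear combinations are again
integrals with respect to the white noise. -/
theorem IsWhiteNoise.isGaussianProcess (hW : IsWhiteNoise T W P) [IsProbabilityMeasure P]
    {ι : Type*} {F : ι → ℝ × Space d → ℂ} (hF : ∀ i, MemLp (F i) 2 (slabMeasure d T)) (c : ℂ) :
    IsGaussianProcess (fun i ω => c * noiseInt W (F i) ω) P := by
  classical
  have hre : ∀ i, MemLp (fun z => (F i z).re) 2 (slabMeasure d T) := fun i => (hF i).re
  have him : ∀ i, MemLp (fun z => (F i z).im) 2 (slabMeasure d T) := fun i => (hF i).im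
  refine ⟨fun I => ⟨?_⟩⟩
  have hm : ∀ i, AEMeasurable (fun ω => c * noiseInt W (F i) ω) P := fun i =>
    ((Complex.measurable_ofReal.comp_aemeasurable (hW.hasGaussianLaw (hre i)).aemeasurable).add
      ((Complex.measurable_ofReal.comp_aemeasurable
        (hW.hasGaussianLaw (him i)).aemeasurable).const_mul _)).const_mul _
  have hZ : AEMeasurable (fun ω => I.restrict fun i => c * noiseInt W (F i) ω) P :=
    aemeasurable_pi_lambda _ fun i => hm i
  refine isGaussian_of_isGaussian_map fun L => ?_
  rw [AEMeasurable.map_map_of_aemeasurable L.continuous.measurable.aemeasurable hZ]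
  let h : I → ℝ × Space d → ℝ := fun i =>
    L (Pi.single i c) • (fun z => (F i z).re) + L (Pi.single i (c * Complex.I)) •
      fun z => (F i z).im
  have hh : ∀ i, MemLp (h i) 2 (slabMeasure d T) := fun i =>
    ((hre i).const_smul _).add ((him i).const_smul _)
  have hL : (L ∘ fun ω => I.restrict fun i => c * noiseInt W (F i) ω) =ᵐ[P]
      W (∑ i ∈ Finset.univ, h i) := by
    have h1 := hW.map_sum Finset.univ hh
    have h2 : ∀ i, W (h i) =ᵐ[P] _ := fun i => hW.linear _ _ (hre i) (him i) (L (Pi.single i c))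
      (L (Pi.single i (c * Complex.I)))
    filter_upwards [h1, ae_all_iff.2 h2] with ω h1 h2
    rw [h1, Finset.sum_apply, Function.comp_apply,
      ← Finset.univ_sum_single (I.restrict fun i => c * noiseInt W (F i) ω), _root_.map_sum]
    refine Finset.sum_congr rfl fun i _ => ?_
    rw [h2 i]
    have e : (Pi.single i (I.restrict (fun i => c * noiseInt W (F i) ω) i) : I → ℂ) =
        W (fun z => (F i z).re) ω • (Pi.single i c : I → ℂ) +
          W (fun z => (F i z).im) ω • (Pi.single i (c * Complex.I) : I → ℂ) := by
      rw [← Pi.single_smul, ← Pi.single_smul, ← Pi.single_add]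
      congr 1
      simp only [Finset.restrict, noiseInt, Complex.real_smul]
      ring
    rw [e, map_add, map_smul, map_smul]
    simp only [Pi.add_apply, Pi.smul_apply, smul_eq_mul]
    ring
  rw [Measure.map_congr hL]
  exact (hW.hasGaussianLaw (memLp_finsetSum' _ fun i _ => hh i)).isGaussian_map

end

/-! ### The law of the truncated stochastic convolutions -/

section

open FourierTransform

variable {d : ℕ} {α : ℝ}

/-- The integrand of the kernel `a_n(s, x)`, as a function of the frequency. -/
def waveProfile (d : ℕ) (α : ℝ) (n : ℕ) (s : ℝ) (x : Space d) : Space d → ℂ :=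
  indicator (Metric.closedBall (0 : Space d) n) fun ξ =>
    Complex.exp (Complex.I * (s * ‖ξ‖ ^ 2 : ℝ)) / ((1 + ‖ξ‖ ^ 2) ^ (α / 2) : ℝ) *
      Complex.exp (Complex.I * (inner ℝ x ξ : ℝ))

theorem convKernel_eq (n : ℕ) (s : ℝ) (x : Space d) :
    convKernel d α n s x = 1 / (2 * Real.pi : ℂ) ^ d * ∫ ξ, waveProfile d α n s x ξ := by
  unfold convKernel waveProfile
  rw [integral_indicator Metric.isClosed_closedBall.measurableSet]

theorem continuous_waveProfile_aux :
    Continuous fun z : (ℝ × Space d) × Space d =>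
      Complex.exp (Complex.I * (z.1.1 * ‖z.2‖ ^ 2 : ℝ)) / ((1 + ‖z.2‖ ^ 2) ^ (α / 2) : ℝ) *
      Complex.exp (Complex.I * (inner ℝ z.1.2 z.2 : ℝ)) := by
  have h1 : Continuous fun z : (ℝ × Space d) × Space d => (((1 + ‖z.2‖ ^ 2) ^ (α / 2) : ℝ) : ℂ) :=
    Complex.continuous_ofReal.comp
      ((continuous_one_add_norm_sq_rpow (α / 2)).comp continuous_snd)
  have h2 : ∀ z : (ℝ × Space d) × Space d, (((1 + ‖z.2‖ ^ 2) ^ (α / 2) : ℝ) : ℂ) ≠ 0 := fun z => by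
    exact_mod_cast (Real.rpow_pos_of_pos (by positivity) _).ne'
  refine Continuous.mul (Continuous.div ?_ h1 h2) ?_
  · fun_prop
  · exact Complex.continuous_exp.comp (continuous_const.mul
      (Complex.continuous_ofReal.comp ((continuous_snd.comp continuous_fst).inner continuous_snd)))

theorem measurable_convKernel (n : ℕ) :
    Measurable fun z : ℝ × Space d => convKernel d α n z.1 z.2 := by
  unfold convKernel
  exact ((continuous_waveProfile_aux (d := d) (α := α)).stronglyMeasurable.integral_prod_right'
    (ν := volume.restrict (Metric.closedBall (0 : Space d) n))).measurable.const_mul _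

theorem norm_waveProfile (n : ℕ) (s : ℝ) (x ξ : Space d) :
    ‖waveProfile d α n s x ξ‖ = indicator (Metric.closedBall (0 : Space d) n)
      (fun ξ => ((1 + ‖ξ‖ ^ 2) ^ (α / 2))⁻¹) ξ := by
  unfold waveProfile
  rw [norm_indicator_eq_indicator_norm]
  congr 1
  funext ξ
  rw [norm_mul, norm_div, Complex.norm_exp_I_mul_ofReal, Complex.norm_exp_I_mul_ofReal,
    Complex.norm_real, Real.norm_of_nonneg (by positivity), mul_one, one_div]

theorem integrable_indicator_rpow (n : ℕ) (b : ℝ) :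
    Integrable (indicator (Metric.closedBall (0 : Space d) n) fun ξ => (1 + ‖ξ‖ ^ 2) ^ b) :=
  (integrable_indicator_iff Metric.isClosed_closedBall.measurableSet).2
    ((continuous_one_add_norm_sq_rpow b).continuousOn.integrableOn_compact (isCompact_closedBall _ _))

theorem measurable_waveProfile (n : ℕ) (s : ℝ) (x : Space d) :
    Measurable (waveProfile d α n s x) :=
  Measurable.indicator ((continuous_waveProfile_aux (d := d) (α := α)).comp
    (Continuous.prodMk_right (s, x))).measurable Metric.isClosed_closedBall.measurableSet

theorem integrable_waveProfile (n : ℕ) (s : ℝ) (x : Space d) :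
    Integrable (waveProfile d α n s x) := by
  refine (integrable_norm_iff (measurable_waveProfile n s x).aestronglyMeasurable).1 ?_
  refine (integrable_indicator_rpow (d := d) n (-(α / 2))).congr
    (Eventually.of_forall fun ξ => ?_)
  dsimp only
  rw [norm_waveProfile]
  congr 1
  funext ξ
  rw [Real.rpow_neg (by positivity)]

theorem integrable_norm_waveProfile_sq (n : ℕ) (s : ℝ) (x : Space d) :
    Integrable fun ξ => ‖waveProfile d α n s x ξ‖ ^ 2 := by
  refine (integrable_indicator_rpow (d := d) n (-α)).congr (Eventually.of_forall fun ξ => ?_)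
  dsimp only
  rw [norm_waveProfile]
  by_cases h : ξ ∈ Metric.closedBall (0 : Space d) n
  · rw [indicator_of_mem h, indicator_of_mem h, Real.rpow_neg (by positivity), inv_pow,
      sq (_ ^ (α / 2)), one_add_sq_rpow_mul_self]
  · rw [indicator_of_notMem h, indicator_of_notMem h]
    simp

theorem integrable_waveProfile_comp (n : ℕ) (s : ℝ) (x : Space d) :
    Integrable fun η => waveProfile d α n s x ((2 * Real.pi) • η) :=
  (integrable_waveProfile n s x).comp_smul (by positivity)

theorem memLp_waveProfile_comp (n : ℕ) (s : ℝ) (x : Space d) :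
    MemLp (fun η => waveProfile d α n s x ((2 * Real.pi) • η)) 2 :=
  (memLp_two_iff_integrable_sq_norm (integrable_waveProfile_comp n s x).1).2
    ((integrable_norm_waveProfile_sq n s x).comp_smul (by positivity))

theorem integral_comp_two_pi_smul (f : Space d → ℂ) :
    ∫ η, f ((2 * Real.pi) • η) = 1 / (2 * Real.pi : ℂ) ^ d * ∫ ξ, f ξ := by
  rw [Measure.integral_comp_smul, finrank_euclideanSpace_fin, abs_of_nonneg (by positivity),
    Complex.real_smul]
  push_cast
  rw [one_div]

/-- As a function of the integration variable, the kernel `a_n(s, x - x')` is a Fourier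
transform. -/
theorem fourier_waveProfile (n : ℕ) (s : ℝ) (x x' : Space d) :
    𝓕 (fun η => waveProfile d α n s x ((2 * Real.pi) • η)) x' = convKernel d α n s (x - x') := by
  rw [convKernel_eq, ← integral_comp_two_pi_smul, Real.fourier_eq']
  refine integral_congr_ae (Eventually.of_forall fun η => ?_)
  dsimp only
  unfold waveProfile
  by_cases h : (2 * Real.pi) • η ∈ Metric.closedBall (0 : Space d) n
  · rw [indicator_of_mem h, indicator_of_mem h, smul_eq_mul, mul_left_comm, ← Complex.exp_add,
      inner_sub_left]
    congr 2
    rw [inner_smul_right, inner_smul_right, real_inner_comm x' η]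
    push_cast
    ring
  · rw [indicator_of_notMem h, indicator_of_notMem h, smul_zero]

/-- The common value of the covariances and relations at a fixed time of the noise. -/
def covKernel (d : ℕ) (α : ℝ) (n m : ℕ) (s : ℝ) (x : Space d) : ℂ :=
  ∫ ξ in Metric.closedBall (0 : Space d) n ∩ Metric.closedBall 0 m,
    Complex.exp (Complex.I * (s * ‖ξ‖ ^ 2 : ℝ)) / ((1 + ‖ξ‖ ^ 2) ^ α : ℝ) *
      Complex.exp (-Complex.I * (inner ℝ ξ x : ℝ))

theorem integral_convKernel_mul_conj (n m : ℕ) (s s' : ℝ) (x y : Space d) :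
    ∫ x', convKernel d α n s (x - x') * conj (convKernel d α m s' (y - x')) =
      1 / (2 * Real.pi : ℂ) ^ d * covKernel d α n m (s - s') (x - y) := by
  simp_rw [← fourier_waveProfile]
  rw [integral_conj_fourier_mul_fourier (integrable_waveProfile_comp m s' y)
    (memLp_waveProfile_comp m s' y) (integrable_waveProfile_comp n s x)
    (memLp_waveProfile_comp n s x),
    integral_comp_two_pi_smul fun ξ => waveProfile d α n s x ξ * conj (waveProfile d α m s' y ξ)]
  congr 1
  unfold covKernel
  rw [← integral_indicator ((Metric.isClosed_closedBall.inter
    Metric.isClosed_closedBall).measurableSet), ← integral_neg_eq_self]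
  refine integral_congr_ae (Eventually.of_forall fun ξ => ?_)
  dsimp only
  unfold waveProfile
  by_cases h1 : ξ ∈ Metric.closedBall (0 : Space d) n
  · by_cases h2 : ξ ∈ Metric.closedBall (0 : Space d) m
    · have h1' : -ξ ∈ Metric.closedBall (0 : Space d) n := by simpa using h1
      have h2' : -ξ ∈ Metric.closedBall (0 : Space d) m := by simpa using h2
      rw [indicator_of_mem h1', indicator_of_mem h2', indicator_of_mem (mem_inter h1 h2)]
      have e2 : (((1 + ‖ξ‖ ^ 2) ^ α : ℝ) : ℂ) =
          ((1 + ‖ξ‖ ^ 2) ^ (α / 2) : ℝ) * ((1 + ‖ξ‖ ^ 2) ^ (α / 2) : ℝ) := by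
        rw [← one_add_sq_rpow_mul_self, Complex.ofReal_mul]
      have e3 : Complex.exp (Complex.I * ((s - s') * ‖ξ‖ ^ 2 : ℝ)) =
          Complex.exp (Complex.I * (s * ‖ξ‖ ^ 2 : ℝ)) *
            Complex.exp (-Complex.I * (s' * ‖ξ‖ ^ 2 : ℝ)) := by
        rw [← Complex.exp_add]; congr 1; push_cast; ring
      have e4 : Complex.exp (-Complex.I * (inner ℝ ξ (x - y) : ℝ)) =
          Complex.exp (Complex.I * (inner ℝ x (-ξ) : ℝ)) *
            Complex.exp (-Complex.I * (inner ℝ y (-ξ) : ℝ)) := by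
        rw [← Complex.exp_add, inner_sub_right, inner_neg_right, inner_neg_right,
          real_inner_comm x ξ, real_inner_comm y ξ]
        congr 1; push_cast; ring
      simp only [map_mul, map_div₀, Complex.conj_ofReal, ← Complex.exp_conj, Complex.conj_I,
        norm_neg]
      rw [e2, e3, e4]
      ring
    · rw [indicator_of_notMem (fun h => h2 (by simpa using h) :
        -ξ ∉ Metric.closedBall (0 : Space d) m), indicator_of_notMem fun h :
        ξ ∈ Metric.closedBall (0 : Space d) n ∩ Metric.closedBall 0 m => h2 h.2]
      simp
  · rw [indicator_of_notMem (fun h => h1 (by simpa using h) :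
      -ξ ∉ Metric.closedBall (0 : Space d) n), indicator_of_notMem fun h :
      ξ ∈ Metric.closedBall (0 : Space d) n ∩ Metric.closedBall 0 m => h1 h.1]
    simp

theorem conj_convKernel (n : ℕ) (s : ℝ) (x : Space d) :
    conj (convKernel d α n s x) = convKernel d α n (-s) x := by
  rw [convKernel_eq, convKernel_eq, map_mul, ← integral_conj]
  congr 1
  · have h2 : (starRingEnd ℂ) (2 : ℂ) = 2 := Complex.conj_ofNat 2
    simp [h2]
  rw [← integral_neg_eq_self]
  refine integral_congr_ae (Eventually.of_forall fun ξ => ?_)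
  dsimp only
  unfold waveProfile
  by_cases h : ξ ∈ Metric.closedBall (0 : Space d) n
  · rw [indicator_of_mem h, indicator_of_mem (by simpa using h :
      -ξ ∈ Metric.closedBall (0 : Space d) n)]
    simp only [map_mul, map_div₀, Complex.conj_ofReal, ← Complex.exp_conj, Complex.conj_I,
      norm_neg, inner_neg_right]
    have e1 : -Complex.I * (s * ‖ξ‖ ^ 2 : ℝ) = Complex.I * (-s * ‖ξ‖ ^ 2 : ℝ) := by
      push_cast; ring
    have e2 : -Complex.I * (-(inner ℝ x ξ) : ℝ) = Complex.I * (inner ℝ x ξ : ℝ) := by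
      push_cast; ring
    rw [e1, e2]
  · rw [indicator_of_notMem h, indicator_of_notMem (fun h' => h (by simpa using h') :
      -ξ ∉ Metric.closedBall (0 : Space d) n)]
    simp

theorem slabMeasure_eq_prod (d : ℕ) (T : ℝ) :
    slabMeasure d T = ((volume : Measure ℝ).restrict (Icc 0 T)).prod volume := by
  rw [slabMeasure, Measure.volume_eq_prod, ← Measure.prod_restrict, Measure.restrict_univ]

theorem memLp_convIntegrand (T : ℝ) (n : ℕ) (t : ℝ) (x : Space d) :
    MemLp (convIntegrand d α n t x) 2 (slabMeasure d T) := by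
  have h0 : Measurable fun z : ℝ × Space d => (t - z.1, x - z.2) := by fun_prop
  have hk : Measurable fun z : ℝ × Space d => convKernel d α n (t - z.1) (x - z.2) := by
    have h1 := (measurable_convKernel (d := d) (α := α) n).comp h0
    exact h1
  have hm : Measurable (convIntegrand d α n t x) :=
    hk.indicator (measurableSet_Icc.prod MeasurableSet.univ)
  refine ⟨hm.aestronglyMeasurable, ?_⟩
  rw [eLpNorm_lt_top_iff_lintegral_rpow_enorm_lt_top (by norm_num) (by norm_num)]
  simp only [ENNReal.toReal_ofNat, ENNReal.rpow_ofNat]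
  rw [slabMeasure_eq_prod, lintegral_prod _ (hm.enorm.pow_const 2).aemeasurable]
  have hL : ∫⁻ η, ‖waveProfile d α n 0 0 ((2 * Real.pi) • η)‖ₑ ^ 2 ≠ ∞ := by
    have := (memLp_waveProfile_comp (α := α) n 0 (0 : Space d)).2
    rw [eLpNorm_lt_top_iff_lintegral_rpow_enorm_lt_top (by norm_num) (by norm_num)] at this
    simpa using this.ne
  calc ∫⁻ τ in Icc 0 T, ∫⁻ x', ‖convIntegrand d α n t x (τ, x')‖ₑ ^ 2
      ≤ ∫⁻ _τ in Icc 0 T, ∫⁻ η, ‖waveProfile d α n 0 0 ((2 * Real.pi) • η)‖ₑ ^ 2 := by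
        refine lintegral_mono fun τ => ?_
        calc ∫⁻ x', ‖convIntegrand d α n t x (τ, x')‖ₑ ^ 2
            ≤ ∫⁻ x', ‖convKernel d α n (t - τ) (x - x')‖ₑ ^ 2 := by
              refine lintegral_mono fun x' => pow_le_pow_left' ?_ 2
              exact enorm_indicator_le_enorm_self _ _
          _ = ∫⁻ η, ‖waveProfile d α n (t - τ) x ((2 * Real.pi) • η)‖ₑ ^ 2 := by
              simp_rw [← fourier_waveProfile]
              exact lintegral_enorm_fourier_sq (integrable_waveProfile_comp n _ x)
                (memLp_waveProfile_comp n _ x)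
          _ = _ := by
              refine lintegral_congr fun η => ?_
              rw [← ofReal_norm, ← ofReal_norm, norm_waveProfile, norm_waveProfile]
    _ < ∞ := by
        rw [setLIntegral_const]
        exact ENNReal.mul_lt_top hL.lt_top measure_Icc_lt_top

/-- Integration over the slab of a product of functions which vanish after the times `r` and `t`. -/
theorem integral_slab_mul {T : ℝ} (r t : Icc (0 : ℝ) T) {k₁ k₂ f : ℝ × Space d → ℂ} {J : ℝ → ℂ}
    (hf : ∀ z, f z = indicator (Icc (0 : ℝ) r ×ˢ univ) k₁ z * indicator (Icc (0 : ℝ) t ×ˢ univ) k₂ z)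
    (hfi : Integrable f (slabMeasure d T)) (hJ : ∀ τ, ∫ x', k₁ (τ, x') * k₂ (τ, x') = J τ) :
    ∫ z, f z ∂(slabMeasure d T) = ∫ τ in (0 : ℝ)..(min (r : ℝ) t), J τ := by
  have hmin : 0 ≤ min (r : ℝ) t := le_min r.2.1 t.2.1
  rw [slabMeasure_eq_prod] at hfi ⊢
  rw [integral_prod _ hfi, intervalIntegral.integral_of_le hmin, ← integral_Icc_eq_integral_Ioc]
  have hin : ∀ τ, ∫ x', f (τ, x') = indicator (Icc 0 (min (r : ℝ) t)) J τ := by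
    intro τ
    have hiff : τ ∈ Icc 0 (min (r : ℝ) t) ↔ τ ∈ Icc (0 : ℝ) r ∧ τ ∈ Icc (0 : ℝ) t := by
      simp only [mem_Icc, le_min_iff]
      tauto
    by_cases h : τ ∈ Icc 0 (min (r : ℝ) t)
    · rw [indicator_of_mem h, ← hJ]
      refine integral_congr_ae (Eventually.of_forall fun x' => ?_)
      dsimp only
      rw [hf, indicator_of_mem (mk_mem_prod (hiff.1 h).1 (mem_univ _)),
        indicator_of_mem (mk_mem_prod (hiff.1 h).2 (mem_univ _))]
    · rw [indicator_of_notMem h]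
      refine integral_eq_zero_of_ae (Eventually.of_forall fun x' => ?_)
      dsimp only
      rw [hf]
      rcases not_and_or.1 (mt hiff.2 h) with h1 | h1
      · rw [indicator_of_notMem fun h2 => h1 h2.1, zero_mul]
        rfl
      · rw [indicator_of_notMem (fun h2 => h1 h2.1 :
          (τ, x') ∉ Icc (0 : ℝ) t ×ˢ (univ : Set (Space d))), mul_zero]
        rfl
  simp_rw [hin]
  rw [integral_indicator measurableSet_Icc, Measure.restrict_restrict measurableSet_Icc,
    inter_eq_left.2 (Icc_subset_Icc_right ((min_le_left _ _).trans r.2.2))]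

/-- The truncated stochastic convolutions built on a white noise have the law of a regularized
stochastic convolution. -/
theorem IsWhiteNoise.isRegularizedConvolution {T : ℝ} {Ω : Type*} [MeasurableSpace Ω]
    {P : Measure Ω} [IsProbabilityMeasure P] {W : (ℝ × Space d → ℝ) → Ω → ℝ}
    (hW : IsWhiteNoise T W P) : IsRegularizedConvolution (T := T) α (stochConv α W) P := by
  have hL := fun (n : ℕ) (t : ℝ) (x : Space d) => memLp_convIntegrand (α := α) T n t x
  have hΨ : ∀ (n : ℕ) (t : Icc (0 : ℝ) T) (x : Space d) ω, stochConv α W n t x ω =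
      -Complex.I * noiseInt W (convIntegrand d α n t x) ω := fun _ _ _ _ => rfl
  refine ⟨?_, ?_, ?_, ?_⟩
  · exact hW.isGaussianProcess (F := fun i : ℕ × Icc (0 : ℝ) T × Space d =>
      convIntegrand d α i.1 i.2.1 i.2.2) (fun i => hL _ _ _) (-Complex.I)
  · intro n t x
    simp_rw [hΨ]
    rw [integral_const_mul]
    have hre : MemLp (fun z => (convIntegrand d α n t x z).re) 2 (slabMeasure d T) :=
      (hL n t x).re
    have him : MemLp (fun z => (convIntegrand d α n t x z).im) 2 (slabMeasure d T) :=
      (hL n t x).im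
    unfold noiseInt
    rw [integral_add (hW.hasGaussianLaw hre).integrable.ofReal
      ((hW.hasGaussianLaw him).integrable.ofReal.const_mul _), integral_const_mul,
      integral_complex_ofReal, integral_complex_ofReal, hW.integral_eq_zero hre,
      hW.integral_eq_zero him]
    simp
  · intro n m r t x y
    have h1 : ∀ ω, stochConv α W n r x ω * conj (stochConv α W m t y ω) =
        noiseInt W (convIntegrand d α n r x) ω * conj (noiseInt W (convIntegrand d α m t y) ω) := by
      intro ω
      rw [hΨ, hΨ, map_mul, map_neg, Complex.conj_I]
      linear_combination (-(noiseInt W (convIntegrand d α n r x) ω *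
        conj (noiseInt W (convIntegrand d α m t y) ω))) * Complex.I_sq
    simp_rw [h1]
    rw [hW.integral_noiseInt_mul_conj (hL n r x) (hL m t y),
      integral_slab_mul (J := fun _ => 1 / (2 * Real.pi : ℂ) ^ d *
        covKernel d α n m ((r : ℝ) - t) (x - y)) r t
        (k₁ := fun z => convKernel d α n (r - z.1) (x - z.2))
        (k₂ := fun z => conj (convKernel d α m (t - z.1) (y - z.2)))]
    · rw [intervalIntegral.integral_const, sub_zero, Complex.real_smul, covKernel]
      push_cast
      ring
    · intro z
      congr 1
      unfold convIntegrand
      by_cases h : z ∈ Icc (0 : ℝ) t ×ˢ (univ : Set (Space d))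
      · rw [indicator_of_mem h, indicator_of_mem h]
      · rw [indicator_of_notMem h, indicator_of_notMem h, map_zero]
    · exact (hL n r x).integrable_mul (hL m t y).star
    · intro τ
      dsimp only
      rw [integral_convKernel_mul_conj, sub_sub_sub_cancel_right]
  · intro n m r t x y
    have h1 : ∀ ω, stochConv α W n r x ω * stochConv α W m t y ω =
        -(noiseInt W (convIntegrand d α n r x) ω * noiseInt W (convIntegrand d α m t y) ω) := by
      intro ω
      rw [hΨ, hΨ]
      linear_combination (noiseInt W (convIntegrand d α n r x) ω *
        noiseInt W (convIntegrand d α m t y) ω) * Complex.I_sq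
    simp_rw [h1]
    rw [integral_neg, hW.integral_noiseInt_mul (hL n r x) (hL m t y),
      integral_slab_mul (J := fun τ => 1 / (2 * Real.pi : ℂ) ^ d *
        covKernel d α n m ((r : ℝ) + t - 2 * τ) (x - y)) r t
        (k₁ := fun z => convKernel d α n (r - z.1) (x - z.2))
        (k₂ := fun z => convKernel d α m (t - z.1) (y - z.2))]
    · rw [intervalIntegral.integral_const_mul, ← neg_mul]
      rfl
    · exact fun z => rfl
    · exact (hL n r x).integrable_mul (hL m t y)
    · intro τ
      dsimp only
      have h2 : ∀ x', convKernel d α m (t - τ) (y - x') =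
          conj (convKernel d α m (τ - t) (y - x')) := fun x' => by
        rw [conj_convKernel, neg_sub]
      simp_rw [h2]
      rw [integral_convKernel_mul_conj]
      congr 2
      ring

end

end SNLS

end

theorem mainTheorem4 (d : ℕ) (hd : 1 ≤ d) (T : ℝ) (hT : 0 < T) (α : ℝ) (hα : 0 < α)
    (s : ℝ) (hs : (d : ℝ) / 2 - α < s)
    (ρ : Space d → ℝ) (hρ : ContDiff ℝ (⊤ : ℕ∞) ρ) (hρc : HasCompactSupport ρ)
    (p : ℝ≥0∞) [Fact (1 ≤ p)] (hp : 2 ≤ p) (hp' : p < ∞)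
    {Ω : Type*} [MeasurableSpace Ω] (P : Measure Ω) [IsProbabilityMeasure P] :
    -- the stochastic convolutions built on a white noise have the stated Gaussian law
    (∀ W : (ℝ × Space d → ℝ) → Ω → ℝ, IsWhiteNoise T W P →
      IsRegularizedConvolution (T := T) α (stochConv α W) P) ∧
    -- for every process with this law, the localized sequence converges
    ∀ Ψ : ℕ → Icc (0 : ℝ) T → Space d → Ω → ℂ, IsRegularizedConvolution α Ψ P →
      (∃ Φ, IsContinuousModification Φ Ψ P) ∧
      ∀ Φ, IsContinuousModification Φ Ψ P →
        ∀ᵐ ω ∂P, ∃ (u : ℕ → C(Icc (0 : ℝ) T, SobolevSpace d (-s) p))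
          (v : C(Icc (0 : ℝ) T, SobolevSpace d (-s) p)),
          (∀ n t, IsGivenBy (SobolevSpace.toDistribution d (-s) p (u n t))
            (fun x => (ρ x : ℂ) * Φ n t x ω)) ∧
          Tendsto u atTop (𝓝 v) := by
  exact ⟨fun W hW => hW.isRegularizedConvolution, fun Ψ hΨ =>
    ⟨hΨ.exists_continuousModification hT hα, fun Φ hΦ =>
      hΨ.ae_tendsto_sobolevSpace hT hs hρ hρc hp hp' hΦ⟩⟩
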